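/- Let $D=\{z\in\mathbb C:|z|<1\}$. Let $\hat H$ be the class of harmonic mappings $f=h+\overline g$ on $D$ with $h,g$ holomorphic in $D$, $h(z)=z+\sum_{n\ge2}A_nz^n$, $g(z)=\sum_{n\ge1}B_nz^n$, $|B_1|<1$. Let $K_{\hat H^o}$ be the class of all $f=h+\overline g\in\hat H$ that are univalent and sense-preserving in $D$ (the latter meaning $|g'(z)|<|h'(z)|$ for all $z\in D$), have $B_1=g'(0)=0$, and map $D$ onto a convex domain. For $0\le\alpha<1$ let $HS^*(\alpha)$ be the class of all $f\in\hat H$ such that, for every $0<r<1$ and every real $\theta$, $f(re^{i\theta})\ne0$ and $\frac{\partial}{\partial\theta}\arg f(re^{i\theta})>\alpha$. For real $a,c>0$ and $b,d\ge0$ with $b+d>0$ let $$W_{(a,b),(c,d)}(z)=z\,\Gamma(a)\Gamma(c)\sum_{n=0}^\infty\frac{z^n}{\Gamma(a+nb)\Gamma(c+nd)}$$ be the normalized four-parameter Wright function (the series converges for all $z\in\mathbb C$). **Theorem.** Let $0\le\alpha<1$; let $\alpha_1,\alpha_2,\gamma_1,\gamma_2>0$ and $\beta_1,\beta_2,\delta_1,\delta_2\ge0$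 be real with $\beta_1+\delta_1>0$ and $\beta_2+\delta_2>0$; and let $\sigma\in\mathbb C$, $|\sigma|<1$. Write $W_j=W_{(\alpha_j,\beta_j),(\gamma_j,\delta_j)}$ for $j=1,2$. Let $f=h+\overline g\in K_{\hat H^o}$ and $$L(f)=h*W_1+\overline{\sigma\,(g*W_2)},$$ where $*$ is the convolution (Hadamard product) of power series, $\big(\sum u_nz^n\big)*\big(\sum v_nz^n\big)=\sum u_nv_nz^n$. If $$W_1''(1)+(2-\alpha)\big(W_1'(1)-1\big)-\alpha\big(W_1(1)-1\big)+|\sigma|\Big(W_2''(1)+\alpha\big(W_2'(1)-W_2(1)\big)\Big)\le 2(1-\alpha),$$ then $L(f)\in HS^*(\alpha)$. -/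

import Mathlib

/-- The harmonic mapping `f = h + conj g` with analytic part `h` and co-analytic part `g`. -/
def harmonicMap (h g : ℂ → ℂ) (z : ℂ) : ℂ :=
  h z + (starRingEnd ℂ) (g z)

/-- `f = h + conj g` is a normalized harmonic mapping of the unit disk: `h`, `g` are holomorphic
there, `h(z) = z + ∑_{n ≥ 2} Aₙ zⁿ`, `g(z) = ∑_{n ≥ 1} Bₙ zⁿ` and `|B₁| < 1`.
As `g 0 = 0`, the pair `(h, g)` is determined by `f`. -/
structure IsNormalizedHarmonic (h g : ℂ → ℂ) : Prop where
  holo_h : DifferentiableOn ℂ h (Metric.ball 0 1)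
  holo_g : DifferentiableOn ℂ g (Metric.ball 0 1)
  h_zero : h 0 = 0
  deriv_h_zero : deriv h 0 = 1
  g_zero : g 0 = 0
  norm_deriv_g_zero : ‖deriv g 0‖ < 1

/-- The class of harmonic convex mappings with `B₁ = 0`: sense-preserving univalent normalized
harmonic mappings `f = h + conj g` of the unit disk with `g'(0) = 0` whose image is convex. -/
structure IsHarmonicConvexZero (h g : ℂ → ℂ) : Prop extends IsNormalizedHarmonic h g where
  sense_preserving : ∀ z ∈ Metric.ball (0 : ℂ) 1, ‖deriv g z‖ < ‖deriv h z‖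
  univalent : Set.InjOn (harmonicMap h g) (Metric.ball 0 1)
  deriv_g_zero : deriv g 0 = 0
  convex_image : Convex ℝ (harmonicMap h g '' Metric.ball 0 1)

/-- Harmonic starlike mappings of order `α`: `f = h + conj g` is a normalized harmonic mapping such
that, on every circle `|z| = r`, `0 < r < 1`, it does not vanish and
`∂/∂θ (arg f(r e^{iθ})) > α`. Here `φ` is a differentiable choice of `θ ↦ arg f(r e^{iθ})`. -/
structure IsHarmonicStarlike (α : ℝ) (h g : ℂ → ℂ) : Prop extends IsNormalizedHarmonic h g where
  arg_deriv : ∀ r : ℝ, 0 < r → r < 1 → ∃ φ : ℝ → ℝ, Differentiable ℝ φ ∧ ∀ θ : ℝ,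
    harmonicMap h g (circleMap 0 r θ) ≠ 0 ∧
    harmonicMap h g (circleMap 0 r θ) =
      (‖harmonicMap h g (circleMap 0 r θ)‖ : ℂ) * Complex.exp ((φ θ : ℂ) * Complex.I) ∧
    α < deriv φ θ

/-- The four-parameter Wright function `∑ₙ zⁿ / (Γ(α + nβ) Γ(γ + nδ))`. -/
noncomputable def wrightFun (α β γ δ : ℝ) (z : ℂ) : ℂ :=
  ∑' n : ℕ, z ^ n / ((Real.Gamma (α + n * β) * Real.Gamma (γ + n * δ) : ℝ) : ℂ)

/-- The normalized Wright function
`W(z) = z Γ(α) Γ(γ) ∑ₙ zⁿ / (Γ(α + nβ) Γ(γ + nδ))`. -/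
noncomputable def normWright (α β γ δ : ℝ) (z : ℂ) : ℂ :=
  z * ((Real.Gamma α * Real.Gamma γ : ℝ) : ℂ) * wrightFun α β γ δ z

/-- The `n`-th Taylor coefficient at `0`. -/
noncomputable def taylorCoeffZero (u : ℂ → ℂ) (n : ℕ) : ℂ :=
  iteratedDeriv n u 0 / (n.factorial : ℂ)

/-- Convolution (Hadamard product) of power series: `(u * v)(z) = ∑ₙ uₙ vₙ zⁿ`. -/
noncomputable def hadamardConv (u v : ℂ → ℂ) (z : ℂ) : ℂ :=
  ∑' n : ℕ, taylorCoeffZero u n * taylorCoeffZero v n * z ^ n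

open Set Filter Topology Complex Metric MeasureTheory
open scoped ENNReal

/-! Two facts combine. First, if `∑ (n - α)|aₙ| + ∑ (n + α)|bₙ| ≤ 1 - α` over `n ≥ 2`, then `z + ∑
aₙ zⁿ + conj (∑ bₙ zⁿ)` is starlike of order `α` (`isHarmonicStarlike_of_tsum_le`). Second, a convex
`f` with `B₁ = 0` has `|Aₙ| ≤ (n + 1)/2` and `|Bₙ| ≤ (n - 1)/2`
(`IsHarmonicConvexZero.norm_taylorCoeffZero_le`). The Wright coefficients are nonnegative, and
writing `(n - α)(n + 1)` and `(n + α)(n - 1)` in terms of `n(n - 1)`, `n` and `1` turns the required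
sum into the values of `W`, `W'`, `W''` at `1`.

The coefficient bounds are the deep part. For a direction `ν` let `q = e^{-iν} h + e^{iν} g`, so
that `Re q` is a component of `f`. As `f` is a homeomorphism onto a convex domain, the sets `Re q >
c` and `Re q < c` are path connected. Hence the boundary values of `Re q` rise on one arc of the
circle and fall on the complementary one: otherwise four radii would end alternately in two disjoint
connected sets (`false_of_interlaced_radii`). Such a function increases along a flow of disk
automorphisms fixing the two turning points: `Re (i q' V) ≥ 0` with `V = c + c₀ z + conj c z²`, `|c|
= 1`, `c₀` real (`exists_diskField_of_joinedIn_levels`). This is checked for step functions and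
passed to the limit. To have boundary values at all, the image is first shrunk to convex polygons;
their preimages are parametrized by Riemann maps, which have radial limits almost everywhere and
tend to the identity as the polygons grow.

Replacing `ν` by `ν + π` changes the sign of `c₀`, so by connectedness some `ν` admits fields of
both signs, and a combination of them has `c₀ = 0` (`exists_diskField_zero_directionalPart`).
Carathéodory's inequality for `i q' (c + conj c z²)` then bounds the `n`-th coefficient of `q'` by
`n + 1`. Finally `e^{-iν} h' = q' B`, where `|g'| < |h'|` gives `Re B ≥ 1/2` and hence coefficients
of modulus at most one; Cauchy products finish the bounds. -/

/-! ### Crossing of curves in the disk -/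

lemma eq_of_continuous_of_exp_eq {g : ℝ → ℂ} (hg : Continuous g)
    (h : ∀ s t, exp (g s) = exp (g t)) (s t : ℝ) : g s = g t := by
  have h1 : ∀ x, ∃ n : ℤ, g x = g t + n * (2 * Real.pi * I) := fun x => exp_eq_exp_iff_exists_int.1 (h x t)
  choose n hn using h1
  have hπ : (2 * Real.pi * I : ℂ) ≠ 0 := by simp [Real.pi_ne_zero]
  have hc : Continuous n := by
    rw [Int.isClosedEmbedding_coe_real.isInducing.continuous_iff]
    have : ((↑) ∘ n : ℝ → ℝ) = fun x => ((g x - g t) / (2 * Real.pi * I)).re := by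
      ext x
      rw [hn x]
      have : ((n x : ℂ) * (2 * Real.pi * I)) / (2 * Real.pi * I) = n x := by field_simp
      simp only [add_sub_cancel_left, this]
      simp
    rw [this]
    fun_prop
  have h2 : n s = n t := PreconnectedSpace.constant inferInstance hc
  rw [hn s, h2, ← hn t]

/-- Along a curve in a half-plane, the variation of a continuous argument is the variation of the
principal argument. -/
lemma im_lift_sub_eq_arg_sub {w L : ℝ → ℂ} (hL : Continuous L) (hexp : ∀ t, exp (L t) = w t)
    {u : ℂ} (hu : ∀ t ∈ Icc (0 : ℝ) 1, 0 < (u * w t).re) :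
    (L 1).im - (L 0).im = (u * w 1).arg - (u * w 0).arg := by
  -- The half-plane hypothesis holds only on `[0, 1]`; clamping the parameter extends it to all of
  -- `ℝ`. There `L` and the principal logarithm of `u * w` differ by a constant.
  set p : ℝ → ℝ := fun t => (projIcc (0 : ℝ) 1 zero_le_one t : ℝ) with hp
  have hpc : Continuous p := continuous_subtype_val.comp continuous_projIcc
  have hpm : ∀ t, p t ∈ Icc (0 : ℝ) 1 := fun t => (projIcc (0 : ℝ) 1 zero_le_one t).2
  have hw : Continuous w := by
    have : w = fun t => exp (L t) := funext fun t => (hexp t).symm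
    rw [this]; fun_prop
  have hslit : ∀ t, u * w (p t) ∈ slitPlane := fun t => Or.inl (hu _ (hpm t))
  have hg : Continuous fun t => L (p t) - log (u * w (p t)) := by
    refine (hL.comp hpc).sub (Continuous.clog ?_ hslit)
    exact continuous_const.mul (hw.comp hpc)
  have hu0 : u ≠ 0 := by
    rintro rfl
    have := hu 0 (by simp)
    simp at this
  have key := eq_of_continuous_of_exp_eq hg (fun s t => by
    have h1 : ∀ t, exp (L (p t) - log (u * w (p t))) = u⁻¹ := fun t => by
      have h0 := slitPlane_ne_zero (hslit t)
      rw [exp_sub, exp_log h0, hexp]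
      have : w (p t) ≠ 0 := right_ne_zero_of_mul h0
      field_simp
    rw [h1, h1]) 1 0
  have p0 : p 0 = 0 := by simp [hp]
  have p1 : p 1 = 1 := by simp [hp]
  simp only [p0, p1] at key
  have := congrArg Complex.im key
  simp only [sub_im, log_im] at this
  linarith

lemma exp_I_sub_exp_I (a b : ℝ) :
    exp (a * I) - exp (b * I) =
      (2 * Real.sin ((b - a) / 2) : ℝ) * exp ((((a + b) / 2 - Real.pi / 2 : ℝ) : ℂ) * I) := by
  have h1 : ((a : ℂ) * I) = (((a + b) / 2 : ℝ) : ℂ) * I + (((a - b) / 2 : ℝ) : ℂ) * I := by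
    push_cast; ring
  have h2 : ((b : ℂ) * I) = (((a + b) / 2 : ℝ) : ℂ) * I + (((b - a) / 2 : ℝ) : ℂ) * I := by
    push_cast; ring
  have h3 : (((a + b) / 2 - Real.pi / 2 : ℝ) : ℂ) * I
      = (((a + b) / 2 : ℝ) : ℂ) * I + ((-(Real.pi / 2) : ℝ) : ℂ) * I := by push_cast; ring
  rw [h3, h1, h2, exp_add, exp_add, exp_add]
  have h4 : exp (((-(Real.pi / 2) : ℝ) : ℂ) * I) = -I := by
    rw [exp_mul_I, ← ofReal_cos, ← ofReal_sin]; simp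
  have h5 : ∀ d : ℝ, exp ((d : ℂ) * I) = (Real.cos d : ℂ) + Real.sin d * I := fun d => by
    rw [exp_mul_I, ofReal_cos, ofReal_sin]
  have h6 : (a - b) / 2 = -((b - a) / 2) := by ring
  rw [h4, h5 ((a - b) / 2), h5 ((b - a) / 2), h6, Real.cos_neg, Real.sin_neg]
  push_cast
  ring

/-- For `0 < b - a < 2π` the chord is a positive multiple of the unit vector at angle `(a + b)/2 -
π/2`; the last two hypotheses keep the rotated angle in the principal branch. -/
lemma arg_rotated_exp_sub {a b x : ℝ} (hab : a < b) (hab' : b < a + 2 * Real.pi)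
    (h1 : -Real.pi < (a + b) / 2 - Real.pi / 2 + x) (h2 : (a + b) / 2 - Real.pi / 2 + x ≤ Real.pi) :
    (exp (x * I) * (exp (a * I) - exp (b * I))).arg = (a + b) / 2 - Real.pi / 2 + x := by
  rw [exp_I_sub_exp_I, mul_left_comm, ← exp_add, ← add_mul, arg_real_mul]
  · rw [← ofReal_add, add_comm x, exp_mul_I, Complex.arg_cos_add_sin_mul_I ⟨h1, h2⟩]
  · have := Real.sin_pos_of_pos_of_lt_pi (x := (b - a) / 2) (by linarith) (by linarith)
    linarith

/-- A boundary point sees the rest of the closed disk inside an open half-plane: after rotation, `Re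
(1 - y)` with `|y| ≤ 1` vanishes only at `y = 1`. -/
lemma re_rotated_pos {x : ℝ} {z : ℂ} (hz : ‖z‖ ≤ 1) (hne : z ≠ exp (x * I)) :
    0 < (exp ((-x : ℝ) * I) * (exp (x * I) - z)).re := by
  have h1 : exp ((-x : ℝ) * I) * (exp (x * I) - z) = 1 - exp ((-x : ℝ) * I) * z := by
    rw [mul_sub, ← exp_add]; simp
  set y := exp ((-x : ℝ) * I) * z with hy
  have hyn : ‖y‖ ≤ 1 := by rw [hy, norm_mul, norm_exp_ofReal_mul_I, one_mul]; exact hz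
  have hy1 : y ≠ 1 := by
    intro h
    apply hne
    have : exp (x * I) * y = exp (x * I) := by rw [h, mul_one]
    rw [← this, hy, ← mul_assoc, ← exp_add]; simp
  rw [h1]
  simp only [sub_re, one_re, sub_pos]
  rcases lt_or_eq_of_le ((re_le_norm y).trans hyn) with h | h
  · exact h
  · exfalso
    apply hy1
    have h2 : y.re ^ 2 + y.im ^ 2 ≤ 1 := by
      have := Complex.sq_norm y
      rw [normSq_apply] at this
      nlinarith [norm_nonneg y]
    have : y.im = 0 := by nlinarith
    exact Complex.ext h this

/-- Two curves in the closed unit disk joining interlaced pairs of boundary points meet. -/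
theorem exists_mem_of_interlaced {s₁ s₂ s₃ s₄ : ℝ} (h₁₂ : s₁ < s₂) (h₂₃ : s₂ < s₃)
    (h₃₄ : s₃ < s₄) (h₄₁ : s₄ < s₁ + 2 * Real.pi) {γ β : ℝ → ℂ} (hγ : Continuous γ)
    (hβ : Continuous β) (hγn : ∀ t, ‖γ t‖ ≤ 1) (hβn : ∀ t, ‖β t‖ ≤ 1)
    (hγ0 : γ 0 = exp (s₁ * I)) (hγ1 : γ 1 = exp (s₃ * I)) (hβ0 : β 0 = exp (s₂ * I))
    (hβ1 : β 1 = exp (s₄ * I)) : ∃ s t, γ s = β t := by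
  by_contra! hne
  -- If the curves never meet, `γ s - β t` has a continuous logarithm on the simply connected
  -- parameter plane. On each side of the unit square one of the two points is fixed on the circle,
  -- so the difference stays in a half-plane and its change of argument can be computed.
  obtain ⟨L, hL, hLexp⟩ := exists_continuousOn_eqOn_exp_comp (X := ℝ × ℝ) (U := univ)
    (by
      have := (convex_univ (𝕜 := ℝ) (E := ℝ × ℝ)).contractibleSpace univ_nonempty
      exact SimplyConnectedSpace.ofContractible _) isOpen_univ
    (g := fun p => γ p.1 - β p.2) (by fun_prop)
    (by rintro ⟨p, -, hp⟩; exact hne _ _ (sub_eq_zero.1 hp))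
  rw [continuousOn_univ] at hL
  have hLe : ∀ s t, exp (L (s, t)) = γ s - β t := fun s t => hLexp (mem_univ (s, t))
  have e1 := im_lift_sub_eq_arg_sub (w := fun t => γ 0 - β t) (L := fun t => L (0, t))
    (u := exp ((-s₁ : ℝ) * I)) (by fun_prop) (fun t => hLe 0 t)
    (fun t _ => by rw [hγ0]; exact re_rotated_pos (hβn t) (hγ0 ▸ (hne 0 t).symm))
  have e3 := im_lift_sub_eq_arg_sub (w := fun t => γ 1 - β t) (L := fun t => L (1, t))
    (u := exp ((-s₃ : ℝ) * I)) (by fun_prop) (fun t => hLe 1 t)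
    (fun t _ => by rw [hγ1]; exact re_rotated_pos (hβn t) (hγ1 ▸ (hne 1 t).symm))
  have neg : ∀ x : ℝ, exp ((-x + Real.pi : ℝ) * I) = - exp ((-x : ℝ) * I) := fun x => by
    push_cast; rw [add_mul, exp_add, exp_pi_mul_I]; ring
  have e2 := im_lift_sub_eq_arg_sub (w := fun s => γ s - β 0) (L := fun s => L (s, 0))
    (u := exp ((-s₂ + Real.pi : ℝ) * I)) (by fun_prop) (fun s => hLe s 0)
    (fun t _ => by
      have := re_rotated_pos (hγn t) (hβ0 ▸ (hne t 0))
      rw [hβ0, neg]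
      convert this using 2
      ring)
  have e4 := im_lift_sub_eq_arg_sub (w := fun s => γ s - β 1) (L := fun s => L (s, 1))
    (u := exp ((-s₄ + Real.pi : ℝ) * I)) (by fun_prop) (fun s => hLe s 1)
    (fun t _ => by
      have := re_rotated_pos (hγn t) (hβ1 ▸ (hne t 1))
      rw [hβ1, neg]
      convert this using 2
      ring)
  have swap : ∀ x a b : ℝ, exp (x * I) * (exp (a * I) - exp (b * I))
      = exp ((x + Real.pi : ℝ) * I) * (exp (b * I) - exp (a * I)) := fun x a b => by
    push_cast; rw [add_mul, exp_add, exp_pi_mul_I]; ring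
  simp only [hγ0, hγ1, hβ0, hβ1] at e1 e2 e3 e4
  rw [arg_rotated_exp_sub, arg_rotated_exp_sub] at e1
  rw [arg_rotated_exp_sub, swap, arg_rotated_exp_sub] at e3
  rw [show exp ((-s₂ + Real.pi : ℝ) * I) * (exp (s₃ * I) - exp (s₂ * I)) = exp ((-s₂ : ℝ) * I) * (exp (s₂ * I) - exp (s₃ * I)) from (swap _ _ _).symm,  arg_rotated_exp_sub, arg_rotated_exp_sub] at e2
  rw [arg_rotated_exp_sub, arg_rotated_exp_sub] at e4
  -- Main goal: around the square the changes `e1 + e4 - e3 - e2` telescope to zero, yet the chord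
  -- angles add up to `2π`. The other goals are the angle ranges.
  all_goals linarith

/-! ### Normal families: theorems of Montel and Hurwitz -/

/-- **Montel's theorem** along an ultrafilter. -/
theorem exists_tendstoLocallyUniformlyOn_of_norm_le {ι : Type*} (𝒰 : Ultrafilter ι) {U : Set ℂ}
    (hU : IsOpen U) {F : ι → ℂ → ℂ} (hF : ∀ i, DifferentiableOn ℂ (F i) U) {M : ℝ}
    (hM : ∀ i, ∀ z ∈ U, ‖F i z‖ ≤ M) :
    ∃ f : ℂ → ℂ, TendstoLocallyUniformlyOn F f 𝒰 U ∧ DifferentiableOn ℂ f U ∧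
      ∀ z ∈ U, ‖f z‖ ≤ M := by
  -- In a compact ball everything converges along an ultrafilter, so pointwise limits need no
  -- diagonal extraction. The Schwarz lemma gives Lipschitz bounds uniform in `i`, which upgrade
  -- this to locally uniform convergence.
  have hlim : ∀ z ∈ U, ∃ y ∈ closedBall (0 : ℂ) M, Tendsto (fun i => F i z) 𝒰 (𝓝 y) := by
    intro z hz
    obtain ⟨y, hy, hle⟩ := (isCompact_closedBall (0 : ℂ) M).ultrafilter_le_nhds
      (𝒰.map fun i => F i z) (by
        rw [le_principal_iff, Ultrafilter.mem_coe, Ultrafilter.mem_map]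
        exact Filter.univ_mem' fun i => by simpa using hM i z hz)
    exact ⟨y, hy, hle⟩
  choose! f hfM hf using hlim
  have hloc : TendstoLocallyUniformlyOn F f 𝒰 U := by
    rw [Metric.tendstoLocallyUniformlyOn_iff]
    intro ε hε z hz
    obtain ⟨ρ, hρ, hball⟩ := Metric.isOpen_iff.1 hU z hz
    have hM0 : 0 ≤ M := by
      obtain ⟨i⟩ := 𝒰.neBot.nonempty
      exact (norm_nonneg _).trans (hM i z hz)
    have hlip : ∀ i, ∀ w ∈ ball z ρ, dist (F i w) (F i z) ≤ (2 * M) / ρ * dist w z := by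
      intro i w hw
      refine dist_le_div_mul_dist_of_mapsTo_ball ((hF i).mono hball) (fun x hx => ?_) hw
      rw [mem_closedBall, dist_eq_norm]
      refine (norm_sub_le _ _).trans ?_
      linarith [hM i x (hball hx), hM i z hz]
    have hlipf : ∀ w ∈ ball z ρ, dist (f w) (f z) ≤ (2 * M) / ρ * dist w z := fun w hw =>
      le_of_tendsto ((hf w (hball hw)).dist (hf z hz)) (Eventually.of_forall fun i => hlip i w hw)
    set C := (2 * M) / ρ with hC
    have hC0 : 0 ≤ C := by positivity
    refine ⟨ball z (min ρ (ε / (4 * (C + 1)))), mem_nhdsWithin_of_mem_nhds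
      (ball_mem_nhds _ (by positivity)), ?_⟩
    filter_upwards [Metric.tendsto_nhds.1 (hf z hz) (ε / 2) (by positivity)] with i hi w hw
    rw [mem_ball, lt_min_iff] at hw
    have h1 := hlip i w hw.1
    have h2 := hlipf w hw.1
    have h3 : C * dist w z ≤ ε / 4 := by
      have : dist w z * (4 * (C + 1)) < ε := (lt_div_iff₀ (by positivity)).1 hw.2
      nlinarith [dist_nonneg (x := w) (y := z)]
    calc dist (f w) (F i w) ≤ dist (f w) (f z) + dist (f z) (F i z) + dist (F i z) (F i w) :=
          dist_triangle4 _ _ _ _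
      _ < ε := by
          rw [dist_comm (f z) (F i z), dist_comm (F i z) (F i w)]
          linarith
  refine ⟨f, hloc, hloc.differentiableOn (Eventually.of_forall hF) hU, fun z hz => ?_⟩
  simpa using hfM z hz

/-- **Hurwitz's theorem**: a locally uniform limit of zero-free holomorphic functions is zero-free
or identically zero. -/
theorem ne_zero_or_eqOn_zero_of_tendstoLocallyUniformlyOn {ι : Type*} {l : Filter ι} [l.NeBot]
    {U : Set ℂ} (hU : IsOpen U) (hUc : IsPreconnected U) {F : ι → ℂ → ℂ} {f : ℂ → ℂ}
    (hlim : TendstoLocallyUniformlyOn F f l U) (hF : ∀ i, DifferentiableOn ℂ (F i) U)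
    (h0 : ∀ i, ∀ z ∈ U, F i z ≠ 0) : (∀ z ∈ U, f z ≠ 0) ∨ EqOn f 0 U := by
  by_contra! hcon
  obtain ⟨⟨z₀, hz₀, hfz⟩, hne⟩ := hcon
  have hfd : DifferentiableOn ℂ f U := hlim.differentiableOn (Eventually.of_forall hF) hU
  have hfa : AnalyticOnNhd ℂ f U := hfd.analyticOnNhd hU
  have hev : ∀ᶠ z in 𝓝[≠] z₀, f z ≠ 0 := by
    rcases (hfa z₀ hz₀).eventually_eq_zero_or_eventually_ne_zero with h | h
    · exact absurd (hfa.eqOn_zero_of_preconnected_of_eventuallyEq_zero hUc hz₀ h) hne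
    · exact h
  rw [eventually_nhdsWithin_iff, Metric.eventually_nhds_iff_ball] at hev
  obtain ⟨δ, hδ, hδf⟩ := hev
  obtain ⟨ρ, hρ, hρU⟩ := Metric.isOpen_iff.1 hU z₀ hz₀
  set r := min δ ρ / 2 with hr
  have hr0 : 0 < r := by positivity
  have hrδ : r < δ := by have := min_le_left δ ρ; have := lt_min hδ hρ; linarith
  have hrρ : r < ρ := by have := min_le_right δ ρ; have := lt_min hδ hρ; linarith
  have hcb : closedBall z₀ r ⊆ U := (closedBall_subset_ball hrρ).trans hρU
  have hsph : sphere z₀ r ⊆ U := sphere_subset_closedBall.trans hcb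
  obtain ⟨w, hw, hmin⟩ := (isCompact_sphere z₀ r).exists_isMinOn
    (NormedSpace.sphere_nonempty.2 hr0.le) (hfd.continuousOn.mono hsph).norm
  have hm : 0 < ‖f w‖ := by
    rw [norm_pos_iff]
    refine hδf w ?_ ?_
    · rw [mem_ball, mem_sphere.1 hw]; exact hrδ
    · rintro rfl; simp at hw; linarith
  have hunif := (tendstoLocallyUniformlyOn_iff_tendstoUniformlyOn_of_compact
    (isCompact_closedBall z₀ r)).1 (hlim.mono hcb)
  obtain ⟨i, hi⟩ := (Metric.tendstoUniformlyOn_iff.1 hunif (‖f w‖ / 3) (by positivity)).exists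
  -- With `m` the minimum of `|f|` on the circle, `|F i| ≥ 2m/3` there. The maximum principle for `1
  -- / F i` carries this to the center, where `|F i z₀| < m/3`.
  have hbd : ∀ z ∈ frontier (ball z₀ r), ‖(F i z)⁻¹‖ ≤ (2 * ‖f w‖ / 3)⁻¹ := by
    intro z hz
    rw [frontier_ball _ hr0.ne'] at hz
    have h1 := hi z (sphere_subset_closedBall hz)
    have h2 : ‖f w‖ ≤ ‖f z‖ := hmin hz
    have h3 : ‖f z‖ ≤ ‖F i z‖ + dist (f z) (F i z) := by
      rw [dist_eq_norm]; linarith [norm_sub_norm_le (f z) (F i z)]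
    rw [norm_inv]
    exact inv_anti₀ (by positivity) (by linarith)
  have hd : DiffContOnCl ℂ (fun z => (F i z)⁻¹) (ball z₀ r) := by
    have : DifferentiableOn ℂ (fun z => (F i z)⁻¹) (closure (ball z₀ r)) := by
      rw [closure_ball _ hr0.ne']
      exact ((hF i).mono hcb).inv fun z hz => h0 i z (hcb hz)
    exact this.diffContOnCl
  have h4 := norm_le_of_forall_mem_frontier_norm_le isBounded_ball hd hbd
    (subset_closure (mem_ball_self hr0))
  have h5 := hi z₀ (mem_closedBall_self hr0.le)
  rw [hfz, dist_eq_norm, zero_sub, norm_neg] at h5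
  have h6 : 0 < ‖F i z₀‖ := norm_pos_iff.2 (h0 i z₀ hz₀)
  rw [norm_inv, inv_le_inv₀ h6 (by positivity)] at h4
  linarith

/-- Hurwitz's theorem for `F i z - F i z₁` on a ball about `z₂` that misses `z₁`: injectivity makes
these functions zero-free, while a failure of injectivity gives the limit a zero at `z₂`. -/
theorem injOn_or_const_of_tendstoLocallyUniformlyOn {ι : Type*} {l : Filter ι} [l.NeBot]
    {U : Set ℂ} (hU : IsOpen U) (hUc : IsPreconnected U) {F : ι → ℂ → ℂ} {f : ℂ → ℂ}
    (hlim : TendstoLocallyUniformlyOn F f l U) (hF : ∀ i, DifferentiableOn ℂ (F i) U)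
    (hinj : ∀ i, InjOn (F i) U) : InjOn f U ∨ ∃ c, EqOn f (fun _ => c) U := by
  by_contra! hcon
  obtain ⟨hninj, hnconst⟩ := hcon
  simp only [InjOn, not_forall] at hninj
  obtain ⟨z₁, hz₁, z₂, hz₂, heq, hne⟩ := hninj
  obtain ⟨ρ, hρ, hρU⟩ := Metric.isOpen_iff.1 hU z₂ hz₂
  set r := min ρ (dist z₁ z₂) with hr
  have hr0 : 0 < r := lt_min hρ (dist_pos.2 hne)
  have hB : ball z₂ r ⊆ U := (ball_subset_ball (min_le_left _ _)).trans hρU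
  have hz1 : z₁ ∉ ball z₂ r := fun h => absurd (mem_ball.1 h) (not_lt.2 (min_le_right _ _))
  have hfd : DifferentiableOn ℂ f U := hlim.differentiableOn (Eventually.of_forall hF) hU
  have hlim' : TendstoLocallyUniformlyOn (fun i z => F i z - F i z₁) (fun z => f z - f z₁) l
      (ball z₂ r) := by
    have hl2 := hlim.mono hB
    rw [Metric.tendstoLocallyUniformlyOn_iff] at hl2 ⊢
    intro ε hε x hx
    obtain ⟨t, ht, h⟩ := hl2 (ε / 2) (by positivity) x hx
    refine ⟨t, ht, ?_⟩
    filter_upwards [h, Metric.tendsto_nhds.1 (hlim.tendsto_at hz₁) (ε / 2) (by positivity)]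
      with i h1 h2 y hy
    have := dist_sub_sub_le (f y) (f z₁) (F i y) (F i z₁)
    rw [dist_comm (f z₁)] at this
    linarith [h1 y hy]
  rcases ne_zero_or_eqOn_zero_of_tendstoLocallyUniformlyOn isOpen_ball
    (convex_ball z₂ r).isPreconnected hlim' (fun i => ((hF i).mono hB).sub_const _)
    (fun i z hz h => hz1 (by
      rw [← hinj i (hB hz) hz₁ (sub_eq_zero.1 h)]; exact hz)) with h | h
  · exact h z₂ (mem_ball_self hr0) (by simp [heq])
  · refine hnconst (f z₁) ?_
    refine (hfd.analyticOnNhd hU).eqOn_of_preconnected_of_eventuallyEq analyticOnNhd_const hUc hz₂ ?_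
    filter_upwards [ball_mem_nhds z₂ hr0] with z hz
    exact sub_eq_zero.1 (h hz)

/-! ### The Riemann mapping theorem -/

/-- The automorphism of the unit disk that sends `a` to `0`. -/
noncomputable def diskMobius (a z : ℂ) : ℂ := (z - a) / (1 - (starRingEnd ℂ) a * z)

lemma one_sub_conj_mul_ne_zero {a z : ℂ} (ha : ‖a‖ < 1) (hz : ‖z‖ < 1) :
    1 - (starRingEnd ℂ) a * z ≠ 0 := by
  intro h
  have : ‖(starRingEnd ℂ) a * z‖ = 1 := by rw [← sub_eq_zero.1 h]; simp
  rw [norm_mul, RCLike.norm_conj] at this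
  nlinarith [norm_nonneg a, norm_nonneg z]

lemma norm_diskMobius_lt_one {a z : ℂ} (ha : ‖a‖ < 1) (hz : ‖z‖ < 1) : ‖diskMobius a z‖ < 1 := by
  have h0 := one_sub_conj_mul_ne_zero ha hz
  rw [diskMobius, norm_div, div_lt_one (norm_pos_iff.2 h0)]
  refine lt_of_pow_lt_pow_left₀ 2 (norm_nonneg _) ?_
  have h1 : ‖1 - (starRingEnd ℂ) a * z‖ ^ 2 - ‖z - a‖ ^ 2 = (1 - ‖a‖ ^ 2) * (1 - ‖z‖ ^ 2) := by
    simp only [Complex.sq_norm, normSq_apply, sub_re, sub_im, mul_re, mul_im, conj_re, conj_im,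
      one_re, one_im]
    ring
  have h2 : 0 < (1 - ‖a‖ ^ 2) * (1 - ‖z‖ ^ 2) := by
    apply mul_pos <;> nlinarith [norm_nonneg a, norm_nonneg z]
  linarith

lemma hasDerivAt_diskMobius {a z : ℂ} (ha : ‖a‖ < 1) (hz : ‖z‖ < 1) :
    HasDerivAt (diskMobius a) ((1 - ‖a‖ ^ 2 : ℝ) / (1 - (starRingEnd ℂ) a * z) ^ 2) z := by
  have h0 := one_sub_conj_mul_ne_zero ha hz
  have := ((hasDerivAt_id z).sub_const a).div
    (((hasDerivAt_id z).const_mul ((starRingEnd ℂ) a)).const_sub 1) h0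
  convert! this using 1
  have h1 : ((‖a‖ ^ 2 : ℝ) : ℂ) = a * (starRingEnd ℂ) a := by
    rw [mul_conj, normSq_eq_norm_sq]
  simp only [ofReal_sub, ofReal_one, h1, id]
  ring

lemma diskMobius_injOn {a : ℂ} (ha : ‖a‖ < 1) : InjOn (diskMobius a) (ball 0 1) := by
  intro z hz w hw h
  rw [mem_ball_zero_iff] at hz hw
  have h0 := one_sub_conj_mul_ne_zero ha hz
  have h1 := one_sub_conj_mul_ne_zero ha hw
  rw [diskMobius, diskMobius, div_eq_div_iff h0 h1] at h
  have h2 : (z - w) * (1 - a * (starRingEnd ℂ) a) = 0 := by linear_combination h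
  rcases mul_eq_zero.1 h2 with h3 | h3
  · exact sub_eq_zero.1 h3
  · exfalso
    rw [mul_comm, sub_eq_zero] at h3
    exact one_sub_conj_mul_ne_zero ha ha (sub_eq_zero.2 h3)

/-- The slope of `g` is the slope of `s` times `s w + s z`. Division by the second factor, which has
a nonzero limit, makes a merely continuous square root differentiable. -/
lemma hasDerivAt_of_sq_eq {s g : ℂ → ℂ} {z g' : ℂ} (hs : ContinuousAt s z) (hsg : ∀ w, s w ^ 2 = g w)
    (hg : HasDerivAt g g' z) (h0 : s z ≠ 0) : HasDerivAt s (g' / (2 * s z)) z := by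
  rw [hasDerivAt_iff_tendsto_slope] at hg ⊢
  have h1 : Tendsto (fun w => s w + s z) (𝓝[≠] z) (𝓝 (2 * s z)) := by
    have := (hs.tendsto.add_const (s z)).mono_left (nhdsWithin_le_nhds (s := {z}ᶜ))
    rwa [← two_mul] at this
  have h2 : (2 * s z) ≠ 0 := by simpa using h0
  refine (hg.div h1 h2).congr' ?_
  filter_upwards [h1.eventually_ne h2] with w hw
  simp only [slope_def_field, Pi.div_apply, ← hsg]
  by_cases hwz : w = z
  · simp [hwz]
  · have := sub_ne_zero.2 hwz
    field_simp
    ring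

/-- Holomorphic embeddings of `U` into the unit disk that fix the origin. -/
structure IsDiskEmbedding (U : Set ℂ) (ψ : ℂ → ℂ) : Prop where
  differentiableOn : DifferentiableOn ℂ ψ U
  mapsTo : MapsTo ψ U (ball 0 1)
  injOn : InjOn ψ U
  map_zero : ψ 0 = 0
  deriv_ne_zero : ∀ z ∈ U, deriv ψ z ≠ 0

lemma IsDiskEmbedding.norm_deriv_le {U : Set ℂ} {ψ : ℂ → ℂ} (h : IsDiskEmbedding U ψ) {r : ℝ}
    (hr : 0 < r) (hU : ball 0 r ⊆ U) : ‖deriv ψ 0‖ ≤ 1 / r :=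
  norm_deriv_le_div_of_mapsTo_ball (h.differentiableOn.mono hU)
    (fun z hz => by rw [h.map_zero]; exact ball_subset_closedBall (h.mapsTo (hU hz))) hr

/-- The square root trick: an embedding that omits a point of the disk is not extremal. -/
lemma IsDiskEmbedding.exists_norm_deriv_gt {U : Set ℂ} (hU : IsOpen U) (hUs : IsSimplyConnected U)
    (h0 : (0 : ℂ) ∈ U) {ψ : ℂ → ℂ} (h : IsDiskEmbedding U ψ) {w : ℂ} (hw : w ∈ ball (0 : ℂ) 1)
    (hwU : w ∉ ψ '' U) : ∃ ψ₂, IsDiskEmbedding U ψ₂ ∧ ‖deriv ψ 0‖ < ‖deriv ψ₂ 0‖ := by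
  have hw1 : ‖w‖ < 1 := by simpa using hw
  have hψ1 : ∀ z ∈ U, ‖ψ z‖ < 1 := fun z hz => by simpa using h.mapsTo hz
  have hψd : ∀ z ∈ U, HasDerivAt ψ (deriv ψ z) z := fun z hz =>
    (h.differentiableOn.differentiableAt (hU.mem_nhds hz)).hasDerivAt
  -- The Möbius map sends the omitted value `w` to `0`, so `g` is zero-free and has a square root
  -- `s` on `U`; a second Möbius map brings `s 0` back to the origin.
  set g : ℂ → ℂ := fun z => diskMobius w (ψ z) with hg
  have hgd : ∀ z ∈ U, HasDerivAt g ((1 - ‖w‖ ^ 2 : ℝ) / (1 - (starRingEnd ℂ) w * ψ z) ^ 2 *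
      deriv ψ z) z := fun z hz => (hasDerivAt_diskMobius hw1 (hψ1 z hz)).comp z (hψd z hz)
  have hg0 : ∀ z ∈ U, g z ≠ 0 := by
    intro z hz hgz
    rw [hg] at hgz
    simp only [diskMobius, div_eq_zero_iff] at hgz
    rcases hgz with h1 | h1
    · exact hwU ⟨z, hz, sub_eq_zero.1 h1⟩
    · exact one_sub_conj_mul_ne_zero hw1 (hψ1 z hz) h1
  obtain ⟨s, hsc, hs⟩ := exists_continuousOn_pow_eq hUs hU
    (fun z hz => (hgd z hz).continuousAt.continuousWithinAt)
    (by rintro ⟨z, hz, hgz⟩; exact hg0 z hz hgz) two_ne_zero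
  have hs0 : ∀ z ∈ U, s z ≠ 0 := fun z hz hsz => hg0 z hz (by rw [← hs z, hsz]; simp)
  have hs1 : ∀ z ∈ U, ‖s z‖ < 1 := by
    intro z hz
    have h1 : ‖s z‖ ^ 2 < 1 := by
      rw [← norm_pow, hs]; exact norm_diskMobius_lt_one hw1 (hψ1 z hz)
    nlinarith [norm_nonneg (s z)]
  have hsd : ∀ z ∈ U, HasDerivAt s _ z := fun z hz =>
    hasDerivAt_of_sq_eq (hsc.continuousAt (hU.mem_nhds hz)) hs (hgd z hz) (hs0 z hz)
  have hψ₂d : ∀ z ∈ U, HasDerivAt (fun z => diskMobius (s 0) (s z)) _ z := fun z hz =>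
    (hasDerivAt_diskMobius (hs1 0 h0) (hs1 z hz)).comp z (hsd z hz)
  have hn1 : ∀ a : ℂ, ‖a‖ < 1 → ((1 - ‖a‖ ^ 2 : ℝ) : ℂ) ≠ 0 := by
    intro a ha
    rw [Ne, ofReal_eq_zero]
    nlinarith [norm_nonneg a]
  refine ⟨fun z => diskMobius (s 0) (s z), ⟨fun z hz =>
    (hψ₂d z hz).differentiableAt.differentiableWithinAt, ?_, ?_, ?_, ?_⟩, ?_⟩
  · intro z hz
    simpa using norm_diskMobius_lt_one (hs1 0 h0) (hs1 z hz)
  · intro x hx y hy hxy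
    have h1 := diskMobius_injOn (hs1 0 h0) (by simpa using hs1 x hx) (by simpa using hs1 y hy) hxy
    have h2 : g x = g y := by rw [← hs, ← hs, h1]
    exact h.injOn hx hy (diskMobius_injOn hw1 (h.mapsTo hx) (h.mapsTo hy) h2)
  · simp [diskMobius]
  · intro z hz
    rw [(hψ₂d z hz).deriv]
    have h1 := one_sub_conj_mul_ne_zero (hs1 0 h0) (hs1 z hz)
    have h2 := one_sub_conj_mul_ne_zero hw1 (hψ1 z hz)
    refine mul_ne_zero (div_ne_zero (hn1 _ (hs1 0 h0)) (pow_ne_zero _ h1))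
      (div_ne_zero (mul_ne_zero (div_ne_zero (hn1 _ hw1) (pow_ne_zero _ h2))
        (h.deriv_ne_zero z hz)) (mul_ne_zero two_ne_zero (hs0 z hz)))
  · rw [(hψ₂d 0 h0).deriv]
    have hsw : ‖s 0‖ ^ 2 = ‖w‖ := by
      rw [← norm_pow, hs, hg]
      simp [h.map_zero, diskMobius]
    have hq : 0 < ‖s 0‖ := norm_pos_iff.2 (hs0 0 h0)
    have hq1 := hs1 0 h0
    have hd0 : 0 < ‖deriv ψ 0‖ := norm_pos_iff.2 (h.deriv_ne_zero 0 h0)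
    have e1 : (1 - (starRingEnd ℂ) (s 0) * s 0 : ℂ) = ((1 - ‖s 0‖ ^ 2 : ℝ) : ℂ) := by
      rw [mul_comm, mul_conj, normSq_eq_norm_sq]; push_cast; ring
    rw [h.map_zero, e1, ← hsw]
    set q := ‖s 0‖ with hqdef
    have hp : 0 < 1 - q ^ 2 := by nlinarith
    have hp2 : 0 < 1 - (q ^ 2) ^ 2 := by nlinarith
    rw [norm_mul, norm_div, norm_div, norm_mul, norm_div, norm_pow, norm_pow, norm_mul, norm_real,
      norm_real, Real.norm_of_nonneg hp.le, Real.norm_of_nonneg hp2.le, ← hqdef]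
    simp only [mul_zero, sub_zero, norm_one, Complex.norm_ofNat]
    -- With `q² = |w|`, the derivative at `0` is multiplied by `(1 + q²)/(2q)`, which exceeds `1`
    -- because `q < 1`.
    have : (1 - q ^ 2) / (1 - q ^ 2) ^ 2 * ((1 - (q ^ 2) ^ 2) / 1 ^ 2 * ‖deriv ψ 0‖ / (2 * q))
        = ((1 + q ^ 2) / (2 * q)) * ‖deriv ψ 0‖ := by
      field_simp
      ring
    rw [this]
    have h3 : 1 < (1 + q ^ 2) / (2 * q) := by
      rw [one_lt_div (by positivity)]
      nlinarith [mul_pos (sub_pos.2 hq1) (sub_pos.2 hq1)]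
    nlinarith

/-- A maximizing sequence for `‖ψ' 0‖` converges along an ultrafilter. The identity competes, so the
supremum is at least `1`; this excludes the degenerate alternatives in Hurwitz's theorem for the
limit and for its derivative. -/
lemma exists_extremal_isDiskEmbedding {U : Set ℂ} (hU : IsOpen U) (hUc : IsPreconnected U)
    (h0 : (0 : ℂ) ∈ U) (hUb : U ⊆ ball 0 1) :
    ∃ ψ, IsDiskEmbedding U ψ ∧ ∀ ψ₂, IsDiskEmbedding U ψ₂ → ‖deriv ψ₂ 0‖ ≤ ‖deriv ψ 0‖ := by
  obtain ⟨r, hr, hrU⟩ := Metric.isOpen_iff.1 hU 0 h0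
  set S : Set ℝ := (fun ψ => ‖deriv ψ 0‖) '' {ψ | IsDiskEmbedding U ψ} with hS
  have hid : IsDiskEmbedding U id := ⟨differentiableOn_id, hUb, injOn_id _, rfl, by simp⟩
  have h1S : (1 : ℝ) ∈ S := ⟨id, hid, by simp⟩
  have hbdd : BddAbove S := ⟨1 / r, by rintro _ ⟨ψ, hψ, rfl⟩; exact hψ.norm_deriv_le hr hrU⟩
  obtain ⟨x, -, hxt, hxS⟩ := exists_seq_tendsto_sSup ⟨1, h1S⟩ hbdd
  choose F hF hFx using hxS
  set 𝒰 : Ultrafilter ℕ := Filter.hyperfilter ℕ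
  obtain ⟨ψ, hlim, hψd, hψ1⟩ := exists_tendstoLocallyUniformlyOn_of_norm_le 𝒰 hU
    (fun i => (hF i).differentiableOn) (M := 1)
    (fun i z hz => by simpa using ball_subset_closedBall ((hF i).mapsTo hz))
  have hFd : ∀ i, DifferentiableOn ℂ (deriv (F i)) U := fun i => (hF i).differentiableOn.deriv hU
  have hlimd := hlim.deriv (Eventually.of_forall fun i => (hF i).differentiableOn) hU
  have hder : ‖deriv ψ 0‖ = sSup S := by
    refine tendsto_nhds_unique (hlimd.tendsto_at h0).norm ?_
    simp only [Function.comp, hFx]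
    exact hxt.mono_left (Nat.hyperfilter_le_atTop)
  have hpos : 0 < ‖deriv ψ 0‖ := by rw [hder]; exact zero_lt_one.trans_le (le_csSup hbdd h1S)
  have hdne : ∀ z ∈ U, deriv ψ z ≠ 0 := by
    rcases ne_zero_or_eqOn_zero_of_tendstoLocallyUniformlyOn hU hUc hlimd hFd
      (fun i => (hF i).deriv_ne_zero) with h | h
    · exact h
    · exact absurd (h h0) (norm_pos_iff.1 hpos)
  have hinj : InjOn ψ U := by
    rcases injOn_or_const_of_tendstoLocallyUniformlyOn hU hUc hlim
      (fun i => (hF i).differentiableOn) (fun i => (hF i).injOn) with h | ⟨c, hc⟩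
    · exact h
    · exfalso
      have : deriv ψ 0 = 0 := by
        rw [(hc.eventuallyEq_of_mem (hU.mem_nhds h0)).deriv_eq]; simp
      simp [this] at hpos
  refine ⟨ψ, ⟨hψd, ?_, hinj, ?_, hdne⟩, ?_⟩
  -- The limit is known only to map into the closed disk; being open near `z`, it maps into the
  -- interior.
  · intro z hz
    have hs : HasStrictDerivAt ψ (deriv ψ z) z :=
      (hψd.analyticOnNhd hU z hz).hasStrictDerivAt
    have : ψ '' U ∈ 𝓝 (ψ z) := by
      rw [← hs.map_nhds_eq (hdne z hz)]
      exact image_mem_map (hU.mem_nhds hz)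
    have h2 : closedBall (0 : ℂ) 1 ∈ 𝓝 (ψ z) := by
      refine mem_of_superset this ?_
      rintro _ ⟨y, hy, rfl⟩
      simpa using hψ1 y hy
    have := mem_interior_iff_mem_nhds.2 h2
    rwa [interior_closedBall _ one_ne_zero] at this
  · refine tendsto_nhds_unique (hlim.tendsto_at h0) ?_
    simp only [fun i => (hF i).map_zero]
    exact tendsto_const_nhds
  · intro ψ₂ h₂
    rw [hder]
    exact le_csSup hbdd ⟨ψ₂, h₂, rfl⟩

/-- **Riemann mapping theorem** for bounded simply connected domains. -/
theorem exists_riemannMap {U : Set ℂ} (hU : IsOpen U) (hUs : IsSimplyConnected U)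
    (h0 : (0 : ℂ) ∈ U) (hUb : U ⊆ ball 0 1) :
    ∃ φ ψ : ℂ → ℂ, DifferentiableOn ℂ φ (ball 0 1) ∧ DifferentiableOn ℂ ψ U ∧
      MapsTo φ (ball 0 1) U ∧ MapsTo ψ U (ball 0 1) ∧ LeftInvOn ψ φ (ball 0 1) ∧
      LeftInvOn φ ψ U ∧ φ 0 = 0 ∧ ψ 0 = 0 ∧ ∃ ρ : ℝ, 0 < ρ ∧ deriv ψ 0 = ρ := by
  obtain ⟨ψ, h, hext⟩ := exists_extremal_isDiskEmbedding hU
    hUs.isPathConnected.isConnected.isPreconnected h0 hUb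
  have hsurj : ∀ w ∈ ball (0 : ℂ) 1, ∃ z ∈ U, ψ z = w := by
    intro w hw
    by_contra hcon
    obtain ⟨ψ₂, h₂, hlt⟩ := h.exists_norm_deriv_gt hU hUs h0 hw hcon
    exact absurd (hext ψ₂ h₂) (not_le.2 hlt)
  have hd0 := h.deriv_ne_zero 0 h0
  -- Making the derivative at `0` positive is what later forces the Riemann maps to tend to the
  -- identity rather than to a rotation.
  set c : ℂ := (‖deriv ψ 0‖ : ℂ) / deriv ψ 0 with hc
  have hcn : ‖c‖ = 1 := by
    rw [hc, norm_div, norm_real, norm_norm, div_self (norm_ne_zero_iff.2 hd0)]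
  have hc0 : c ≠ 0 := norm_ne_zero_iff.1 (by rw [hcn]; exact one_ne_zero)
  have hsurj' : ∀ w ∈ ball (0 : ℂ) 1, ∃ z ∈ U, c * ψ z = w := by
    intro w hw
    obtain ⟨z, hz, hzw⟩ := hsurj (c⁻¹ * w) (by simpa [hcn] using hw)
    exact ⟨z, hz, by rw [hzw]; field_simp⟩
  choose! φ hφU hφ using hsurj'
  have hψd : ∀ z ∈ U, HasStrictDerivAt (fun z => c * ψ z) (c * deriv ψ z) z := fun z hz =>
    ((h.differentiableOn.analyticOnNhd hU z hz).hasStrictDerivAt).const_mul c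
  have hmaps : MapsTo (fun z => c * ψ z) U (ball 0 1) := fun z hz => by
    simpa [hcn] using h.mapsTo hz
  have hinj : InjOn (fun z => c * ψ z) U := fun x hx y hy hxy =>
    h.injOn hx hy (mul_left_cancel₀ hc0 hxy)
  have hφψ : LeftInvOn φ (fun z => c * ψ z) U := fun z hz =>
    hinj (hφU _ (hmaps hz)) hz (hφ _ (hmaps hz))
  refine ⟨φ, fun z => c * ψ z, ?_, fun z hz =>
    (hψd z hz).hasDerivAt.differentiableAt.differentiableWithinAt, hφU, hmaps, hφ, hφψ, ?_,
    by simp [h.map_zero], ‖deriv ψ 0‖, norm_pos_iff.2 hd0, ?_⟩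
  · intro w hw
    have hz := hφU w hw
    have hne := mul_ne_zero hc0 (h.deriv_ne_zero _ hz)
    have h1 := (hψd _ hz).to_localInverse hne
    rw [hφ w hw] at h1
    refine (h1.hasDerivAt.congr_of_eventuallyEq ?_).differentiableAt.differentiableWithinAt
    have h2 : ∀ᶠ x in 𝓝 (φ w), (hψd _ hz).localInverse _ _ _ hne (c * ψ x) = x :=
      ((hψd _ hz).hasStrictFDerivAt_equiv hne).eventually_left_inverse
    have h3 := (hψd _ hz).map_nhds_eq hne
    rw [hφ w hw] at h3
    rw [EventuallyEq, ← h3, eventually_map]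
    filter_upwards [h2, hU.mem_nhds hz] with x hx hxU
    rw [hx]
    exact hφψ hxU
  · have := hφψ h0
    simpa [h.map_zero] using this
  · rw [deriv_const_mul _ (h.differentiableOn.differentiableAt (hU.mem_nhds h0)), hc]
    field_simp

/-! ### Radial limits of bounded univalent functions -/

lemma abs_det_restrictScalars_smul_one (a : ℂ) :
    |(a • (1 : ℂ →L[ℝ] ℂ)).det| = ‖a‖ ^ 2 := by
  have h1 : ((a • (1 : ℂ →L[ℝ] ℂ) : ℂ →L[ℝ] ℂ) : ℂ →ₗ[ℝ] ℂ) = LinearMap.mul ℝ ℂ a := by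
    ext; simp
  rw [ContinuousLinearMap.det, h1]
  have := Algebra.norm_apply ℝ a
  rw [Algebra.norm_complex_apply] at this
  have h2 : LinearMap.det (LinearMap.mul ℝ ℂ a) = normSq a := this.symm
  rw [h2, abs_of_nonneg (normSq_nonneg _), normSq_eq_norm_sq]

/-- The area of the image of an injective holomorphic map. -/
lemma lintegral_norm_deriv_sq_eq_volume_image {φ : ℂ → ℂ} {U : Set ℂ} (hU : IsOpen U)
    (hφ : DifferentiableOn ℂ φ U) (hinj : InjOn φ U) :
    ∫⁻ z in U, ENNReal.ofReal (‖deriv φ z‖ ^ 2) = volume (φ '' U) := by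
  have h := lintegral_abs_det_fderiv_eq_addHaar_image volume hU.measurableSet
    (f := φ) (f' := fun z => deriv φ z • (1 : ℂ →L[ℝ] ℂ))
    (fun z hz => ((hφ.differentiableAt (hU.mem_nhds hz)).hasDerivAt.complexToReal_fderiv).hasFDerivWithinAt)
    hinj
  simpa only [abs_det_restrictScalars_smul_one] using h

/-- By `x ≤ 1 + x²` the derivative is integrable along the radius, so `φ` is a primitive that
extends continuously to the endpoint. -/
lemma tendsto_of_lintegral_norm_deriv_sq {φ : ℂ → ℂ} (hφ : DifferentiableOn ℂ φ (ball 0 1))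
    {e : ℂ} (he : ‖e‖ = 1)
    (h : ∫⁻ r in Ioo (1 / 2 : ℝ) 1, ENNReal.ofReal (‖deriv φ (r * e)‖ ^ 2) ≠ ∞) :
    ∃ y, Tendsto (fun r : ℝ => φ (r * e)) (𝓝[<] 1) (𝓝 y) := by
  have hmem : ∀ r ∈ Ioo (1 / 4 : ℝ) 1, (r : ℂ) * e ∈ ball (0 : ℂ) 1 := by
    intro r hr
    rw [mem_ball_zero_iff, norm_mul, he, mul_one, norm_real, Real.norm_of_nonneg (by linarith [hr.1])]
    exact hr.2
  set g : ℝ → ℂ := fun r => deriv φ (r * e) * e with hg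
  have hder : ∀ r ∈ Ioo (1 / 4 : ℝ) 1, HasDerivAt (fun r : ℝ => φ (r * e)) (g r) r := by
    intro r hr
    have h1 := (hφ.differentiableAt (isOpen_ball.mem_nhds (hmem r hr))).hasDerivAt
    have h2 : HasDerivAt (fun r : ℝ => (r : ℂ) * e) e r := by
      simpa using (Complex.ofRealCLM.hasDerivAt (x := r)).mul_const e
    exact h1.comp r h2
  have hmeas : Measurable g := by
    refine Measurable.mul_const ((measurable_deriv φ).comp ?_) e
    fun_prop
  have hint : IntegrableOn g (Ioo (1 / 2 : ℝ) 1) := by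
    refine ⟨hmeas.aestronglyMeasurable, ?_⟩
    rw [hasFiniteIntegral_iff_norm]
    calc ∫⁻ r in Ioo (1 / 2 : ℝ) 1, ENNReal.ofReal ‖g r‖
        ≤ ∫⁻ r in Ioo (1 / 2 : ℝ) 1, (1 + ENNReal.ofReal (‖deriv φ (r * e)‖ ^ 2)) := by
          refine lintegral_mono fun r => ?_
          rw [hg, ← ENNReal.ofReal_one, ← ENNReal.ofReal_add zero_le_one (by positivity)]
          refine ENNReal.ofReal_le_ofReal ?_
          simp only [norm_mul, he, mul_one]
          nlinarith [sq_nonneg (‖deriv φ (r * e)‖ - 1)]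
      _ = (∫⁻ r in Ioo (1 / 2 : ℝ) 1, (1 : ℝ≥0∞))
          + ∫⁻ r in Ioo (1 / 2 : ℝ) 1, ENNReal.ofReal (‖deriv φ (r * e)‖ ^ 2) :=
          lintegral_add_left measurable_const _
      _ < ∞ := by
          refine ENNReal.add_lt_top.2 ⟨?_, h.lt_top⟩
          simp
  have hii : IntervalIntegrable g volume (1 / 2) 1 := by
    rw [intervalIntegrable_iff_integrableOn_Ioo_of_le (by norm_num)]
    exact hint
  have hcont := intervalIntegral.continuousOn_primitive_interval' hii (a := 1 / 2) left_mem_uIcc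
  rw [uIcc_of_le (by norm_num)] at hcont
  refine ⟨φ (((1 / 2 : ℝ) : ℂ) * e) + ∫ x in (1 / 2 : ℝ)..1, g x, ?_⟩
  have h3 : Tendsto (fun r => ∫ x in (1 / 2 : ℝ)..r, g x) (𝓝[<] 1)
      (𝓝 (∫ x in (1 / 2 : ℝ)..1, g x)) := by
    have := hcont 1 (by norm_num)
    refine this.tendsto.mono_left ?_
    rw [← nhdsWithin_Ioo_eq_nhdsLT (show (1 / 2 : ℝ) < 1 by norm_num)]
    exact nhdsWithin_mono _ Ioo_subset_Icc_self
  refine (h3.const_add _).congr' ?_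
  filter_upwards [Ioo_mem_nhdsLT (show (1 / 2 : ℝ) < 1 by norm_num)] with r hr
  have : ∫ x in (1 / 2 : ℝ)..r, g x = φ (r * e) - φ (((1 / 2 : ℝ) : ℂ) * e) := by
    refine intervalIntegral.integral_eq_sub_of_hasDerivAt (f := fun r : ℝ => φ (r * e))
      (fun x hx => hder x ?_) (hii.mono_set ?_)
    · rw [uIcc_of_le hr.1.le] at hx
      constructor <;> [linarith [hx.1]; linarith [hx.2, hr.2]]
    · rw [uIcc_of_le hr.1.le, uIcc_of_le (by norm_num)]
      exact Icc_subset_Icc_right hr.2.le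
  rw [this]; ring

/-- Radial limits of a bounded injective holomorphic map exist almost everywhere. -/
lemma ae_exists_radial_limit_Ioo {φ : ℂ → ℂ} (hφ : DifferentiableOn ℂ φ (ball 0 1))
    (hinj : InjOn φ (ball 0 1)) (hb : MapsTo φ (ball 0 1) (ball 0 1)) :
    ∀ᵐ (t : ℝ) ∂(volume.restrict (Ioo (-Real.pi) Real.pi)),
      ∃ y, Tendsto (fun r : ℝ => φ (r * exp (t * I))) (𝓝[<] 1) (𝓝 y) := by
  -- The image lies in the disk, so its area `∫ |φ'|²` is finite. In polar coordinates Fubini makes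
  -- almost every radial integral finite, and for `r > 1/2` the weight `r` costs at most a factor
  -- `2`.
  have harea : ∫⁻ z in ball (0 : ℂ) 1, ENNReal.ofReal (‖deriv φ z‖ ^ 2) ≠ ∞ := by
    rw [lintegral_norm_deriv_sq_eq_volume_image isOpen_ball hφ hinj]
    exact (lt_of_le_of_lt (measure_mono hb.image_subset) measure_ball_lt_top).ne
  rw [← lintegral_indicator isOpen_ball.measurableSet, ← Complex.lintegral_comp_polarCoord_symm] at harea
  set G : ℂ → ℝ≥0∞ := (ball (0 : ℂ) 1).indicator fun z => ENNReal.ofReal (‖deriv φ z‖ ^ 2) with hG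
  have hGm : Measurable G :=
    ((measurable_deriv φ).norm.pow_const 2).ennreal_ofReal.indicator isOpen_ball.measurableSet
  have hPm : Measurable fun p : ℝ × ℝ => ENNReal.ofReal p.1 • G (Complex.polarCoord.symm p) := by
    refine (measurable_fst.ennreal_ofReal).smul (hGm.comp ?_)
    have h1 : (Complex.polarCoord.symm : ℝ × ℝ → ℂ) =
        fun p => p.1 * (Real.cos p.2 + Real.sin p.2 * I) := funext Complex.polarCoord_symm_apply
    rw [h1]
    fun_prop
  rw [show polarCoord.target = Ioi (0 : ℝ) ×ˢ Ioo (-Real.pi) Real.pi from rfl,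
    Measure.volume_eq_prod, ← Measure.prod_restrict, lintegral_prod_symm _ hPm.aemeasurable] at harea
  have hae := ae_lt_top (Measurable.lintegral_prod_left' hPm) harea
  filter_upwards [hae] with t ht
  refine tendsto_of_lintegral_norm_deriv_sq hφ (norm_exp_ofReal_mul_I t) ?_
  have hle : ∫⁻ r in Ioo (1 / 2 : ℝ) 1, ENNReal.ofReal (‖deriv φ (r * exp (t * I))‖ ^ 2)
      ≤ 2 * ∫⁻ r in Ioi (0 : ℝ), ENNReal.ofReal r • G (Complex.polarCoord.symm (r, t)) := by
    have hm : Measurable fun r : ℝ => ENNReal.ofReal r • G (Complex.polarCoord.symm (r, t)) :=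
      hPm.comp (measurable_id.prodMk measurable_const : Measurable fun r : ℝ => (r, t))
    rw [← lintegral_const_mul _ hm]
    refine (setLIntegral_mono' measurableSet_Ioo fun r hr => ?_).trans
      (lintegral_mono_set (fun r hr => lt_trans (by norm_num) hr.1))
    have hz : Complex.polarCoord.symm (r, t) = r * exp (t * I) := by
      rw [Complex.polarCoord_symm_apply, exp_mul_I, ofReal_cos, ofReal_sin]
    have hmem : (r : ℂ) * exp (t * I) ∈ ball (0 : ℂ) 1 := by
      rw [mem_ball_zero_iff, norm_mul, norm_exp_ofReal_mul_I, mul_one, norm_real,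
        Real.norm_of_nonneg (by linarith [hr.1])]
      exact hr.2
    rw [hz, hG, indicator_of_mem hmem, smul_eq_mul, ← mul_assoc]
    refine le_mul_of_one_le_left zero_le ?_
    rw [← ENNReal.ofReal_ofNat, ← ENNReal.ofReal_mul (by norm_num), ENNReal.one_le_ofReal]
    linarith [hr.1]
  exact (hle.trans_lt (ENNReal.mul_lt_top (by simp) ht)).ne

/-- Polar coordinates give the angles in `(-π, π)` only; rotating by every integer angle covers the
line by countably many translates. -/
theorem ae_exists_radial_limit {φ : ℂ → ℂ} (hφ : DifferentiableOn ℂ φ (ball 0 1))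
    (hinj : InjOn φ (ball 0 1)) (hb : MapsTo φ (ball 0 1) (ball 0 1)) :
    ∀ᵐ t : ℝ, ∃ y, Tendsto (fun r : ℝ => φ (r * exp (t * I))) (𝓝[<] 1) (𝓝 y) := by
  have hrot : ∀ τ : ℝ, ∀ᵐ (t : ℝ) ∂(volume.restrict (Ioo (-Real.pi + τ) (Real.pi + τ))),
      ∃ y, Tendsto (fun r : ℝ => φ (r * exp (t * I))) (𝓝[<] 1) (𝓝 y) := by
    intro τ
    have hm : MapsTo (fun z => exp (τ * I) * z) (ball (0 : ℂ) 1) (ball 0 1) := fun z hz => by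
      simpa [norm_exp_ofReal_mul_I] using hz
    have h := ae_exists_radial_limit_Ioo (φ := fun z => φ (exp (τ * I) * z))
      (hφ.comp (by fun_prop) hm) (hinj.comp (fun x _ y _ hxy => by
        simpa [exp_ne_zero] using hxy) hm) (hb.comp hm)
    have hmp : MeasurePreserving (fun t : ℝ => t - τ) := measurePreserving_sub_right volume τ
    have h2 := (hmp.restrict_preimage (measurableSet_Ioo (a := -Real.pi) (b := Real.pi))).quasiMeasurePreserving.ae h
    rw [show (fun t : ℝ => t - τ) ⁻¹' Ioo (-Real.pi) Real.pi = Ioo (-Real.pi + τ) (Real.pi + τ) by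
      simp] at h2
    filter_upwards [h2] with t ht
    obtain ⟨y, hy⟩ := ht
    refine ⟨y, hy.congr fun r => ?_⟩
    congr 1
    rw [mul_left_comm, ← exp_add]
    congr 2
    push_cast
    ring
  have hcov : (⋃ k : ℤ, Ioo (-Real.pi + (k : ℝ)) (Real.pi + k)) = univ := by
    refine eq_univ_of_forall fun t => mem_iUnion.2 ⟨⌊t⌋, ?_, ?_⟩
    · linarith [Int.floor_le t, Real.pi_pos]
    · linarith [Int.lt_floor_add_one t, Real.pi_gt_three]
  rw [← Measure.restrict_univ (μ := (volume : Measure ℝ)), ← hcov, ae_restrict_iUnion_iff]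
  exact fun k => hrot k

/-! ### Interlaced radii and unimodal sequences -/

lemma exp_I_ne_exp_I {a b : ℝ} (hab : a < b) (hab' : b < a + 2 * Real.pi) :
    exp (a * I) ≠ exp (b * I) := by
  rw [Ne, ← sub_eq_zero, exp_I_sub_exp_I]
  have := Real.sin_pos_of_pos_of_lt_pi (x := (b - a) / 2) (by linarith) (by linarith)
  refine mul_ne_zero ?_ (exp_ne_zero _)
  rw [ofReal_ne_zero]
  linarith

lemma joinedIn_radial {A : Set ℂ} {t : ℝ}
    (h : ∀ᶠ r : ℝ in 𝓝[<] 1, (r : ℂ) * exp (t * I) ∈ A) :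
    ∃ x ∈ A, JoinedIn (insert (exp (t * I)) A) (exp (t * I)) x := by
  obtain ⟨r₀, hr₀, hr⟩ := (mem_nhdsLT_iff_exists_Ioo_subset).1 h
  have hr₀1 : r₀ < 1 := hr₀
  have hmem : ∀ r ∈ Ioo r₀ 1, (r : ℂ) * exp (t * I) ∈ A := fun r h => hr h
  set r₁ := (r₀ + 1) / 2 with hr₁
  refine ⟨r₁ * exp (t * I), hmem r₁ ⟨by linarith, by linarith⟩, JoinedIn.of_segment_subset ?_⟩
  rintro _ ⟨a, b, ha, hb, hab, rfl⟩
  rcases eq_or_lt_of_le hb with h0 | h0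
  · left
    rw [← h0, add_zero] at hab
    simp [hab, ← h0]
  · right
    have : a • exp (t * I) + b • ((r₁ : ℂ) * exp (t * I)) = ((a + b * r₁ : ℝ) : ℂ) * exp (t * I) := by
      simp only [real_smul]; push_cast; ring
    rw [this]
    refine hmem _ ⟨?_, ?_⟩
    · have : a = 1 - b := by linarith
      nlinarith
    · nlinarith

/-- Two disjoint path connected subsets of the disk cannot contain interlaced pairs of radii. -/
theorem false_of_interlaced_radii {A B : Set ℂ} (hA : A ⊆ ball 0 1) (hB : B ⊆ ball 0 1)
    (hAB : Disjoint A B) (hAj : ∀ x ∈ A, ∀ y ∈ A, JoinedIn A x y)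
    (hBj : ∀ x ∈ B, ∀ y ∈ B, JoinedIn B x y) {t₁ t₂ t₃ t₄ : ℝ} (h₁₂ : t₁ < t₂) (h₂₃ : t₂ < t₃)
    (h₃₄ : t₃ < t₄) (h₄₁ : t₄ < t₁ + 2 * Real.pi)
    (h₁ : ∀ᶠ r : ℝ in 𝓝[<] 1, (r : ℂ) * exp (t₁ * I) ∈ A)
    (h₂ : ∀ᶠ r : ℝ in 𝓝[<] 1, (r : ℂ) * exp (t₂ * I) ∈ B)
    (h₃ : ∀ᶠ r : ℝ in 𝓝[<] 1, (r : ℂ) * exp (t₃ * I) ∈ A)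
    (h₄ : ∀ᶠ r : ℝ in 𝓝[<] 1, (r : ℂ) * exp (t₄ * I) ∈ B) : False := by
  have key : ∀ {A : Set ℂ}, A ⊆ ball 0 1 → (∀ x ∈ A, ∀ y ∈ A, JoinedIn A x y) → ∀ {s t : ℝ},
      (∀ᶠ r : ℝ in 𝓝[<] 1, (r : ℂ) * exp (s * I) ∈ A) →
      (∀ᶠ r : ℝ in 𝓝[<] 1, (r : ℂ) * exp (t * I) ∈ A) →
      ∃ γ : ℝ → ℂ, Continuous γ ∧ γ 0 = exp (s * I) ∧ γ 1 = exp (t * I) ∧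
        ∀ x, γ x ∈ insert (exp (s * I)) (insert (exp (t * I)) A) := by
    intro A hA hAj s t hs ht
    obtain ⟨x, hx, hxs⟩ := joinedIn_radial hs
    obtain ⟨y, hy, hyt⟩ := joinedIn_radial ht
    have hj : JoinedIn (insert (exp (s * I)) (insert (exp (t * I)) A)) (exp (s * I)) (exp (t * I)) :=
      ((hxs.mono (insert_subset_insert (subset_insert _ _))).trans ((hAj x hx y hy).mono
        ((subset_insert _ _).trans (subset_insert _ _)))).trans (hyt.symm.mono (subset_insert _ _))
    refine ⟨hj.somePath.extend, hj.somePath.continuous_extend, hj.somePath.extend_zero,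
      hj.somePath.extend_one, fun x => ?_⟩
    have : hj.somePath.extend x ∈ range hj.somePath.extend := mem_range_self x
    rw [hj.somePath.extend_range] at this
    obtain ⟨u, hu⟩ := this
    rw [← hu]
    exact hj.somePath_mem u
  obtain ⟨γ, hγ, hγ0, hγ1, hγA⟩ := key hA hAj h₁ h₃
  obtain ⟨β, hβ, hβ0, hβ1, hβB⟩ := key hB hBj h₂ h₄
  have hnorm : ∀ {A : Set ℂ}, A ⊆ ball 0 1 → ∀ {s t : ℝ} {z : ℂ},
      z ∈ insert (exp (s * I)) (insert (exp (t * I)) A) → ‖z‖ ≤ 1 := by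
    intro A hA s t z hz
    rcases hz with rfl | rfl | hz
    · rw [norm_exp_ofReal_mul_I]
    · rw [norm_exp_ofReal_mul_I]
    · simpa using ball_subset_closedBall (hA hz)
  -- Both curves touch the circle only at their ends, which are four distinct points, so a meeting
  -- point would lie in both `A` and `B`.
  obtain ⟨s, t, hst⟩ := exists_mem_of_interlaced h₁₂ h₂₃ h₃₄ h₄₁ hγ hβ (fun x => hnorm hA (hγA x))
    (fun x => hnorm hB (hβB x)) hγ0 hγ1 hβ0 hβ1
  have hout : ∀ {A : Set ℂ}, A ⊆ ball 0 1 → ∀ x : ℝ, exp (x * I) ∉ A := by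
    intro A hA x hx
    have := hA hx
    rw [mem_ball_zero_iff, norm_exp_ofReal_mul_I] at this
    exact lt_irrefl _ this
  have h1 := hγA s
  have h2 := hβB t
  rw [← hst] at h2
  rcases h1 with h1 | h1 | h1
  · rw [h1] at h2
    rcases h2 with h2 | h2 | h2
    · exact exp_I_ne_exp_I h₁₂ (by linarith) h2
    · exact exp_I_ne_exp_I (by linarith) h₄₁ h2
    · exact hout hB _ h2
  · rw [h1] at h2
    rcases h2 with h2 | h2 | h2
    · exact exp_I_ne_exp_I h₂₃ (by linarith) h2.symm
    · exact exp_I_ne_exp_I h₃₄ (by linarith) h2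
    · exact hout hB _ h2
  · rcases h2 with h2 | h2 | h2
    · exact hout hA _ (h2 ▸ h1)
    · exact hout hA _ (h2 ▸ h1)
    · exact disjoint_left.1 hAB h1 h2

/-- A periodic sequence that does not alternate around any level rises from its minimum to its
maximum and then falls. -/
lemma exists_unimodal_of_not_alternating {x : ℕ → ℝ} {N : ℕ} (hN : 0 < N)
    (hper : ∀ j, x (j + N) = x j)
    (h₁ : ∀ c i j k l, i < j → j < k → k < l → l < i + N →
      x i < c → c < x j → x k < c → c < x l → False)
    (h₂ : ∀ c i j k l, i < j → j < k → k < l → l < i + N →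
      c < x i → x j < c → c < x k → x l < c → False) :
    ∃ a b, a < N ∧ a ≤ b ∧ b ≤ a + N ∧ (∀ k, a ≤ k → k < b → x k ≤ x (k + 1)) ∧
      ∀ k, b ≤ k → k < a + N → x (k + 1) ≤ x k := by
  obtain ⟨a, ha, hamin⟩ := Finset.exists_min_image (Finset.range N) x ⟨0, by simpa using hN⟩
  have hmod : ∀ j, x (j % N) = x j := by
    intro j
    have : ∀ m r, x (r + m * N) = x r := by
      intro m r
      induction m with
      | zero => simp
      | succ m ih => rw [Nat.succ_mul, ← add_assoc, hper, ih]
    conv_rhs => rw [← Nat.mod_add_div j N, mul_comm N, this]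
  have hmin : ∀ j, x a ≤ x j := fun j => by
    rw [← hmod j]; exact hamin _ (by simpa using Nat.mod_lt j hN)
  obtain ⟨b, hb, hbmax⟩ := Finset.exists_max_image (Finset.Ico a (a + N)) x ⟨a, by simp; omega⟩
  rw [Finset.mem_Ico] at hb
  have hmax : ∀ j, a ≤ j → j ≤ a + N → x j ≤ x b := by
    intro j h1 h2
    rcases Nat.lt_or_ge j (a + N) with h3 | h3
    · exact hbmax j (by simp; omega)
    · have : j = a + N := by omega
      rw [this, hper]
      exact hbmax a (by simp; omega)
  refine ⟨a, b, by simpa using ha, hb.1, hb.2.le, fun k h1 h2 => ?_, fun k h1 h2 => ?_⟩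
  -- A descent between the minimum at `a` and the maximum at `b` gives low, high, low, high around
  -- some level `c`. In the second half the minimum is used again, at index `a + N`.
  · by_contra! hlt
    obtain ⟨c, hc1, hc2⟩ := exists_between hlt
    have hak : a < k := lt_of_le_of_ne h1 (by rintro rfl; linarith [hmin (a + 1)])
    have hkb : k + 1 < b := lt_of_le_of_ne h2 (by rintro rfl; linarith [hmax k h1 (by omega)])
    exact h₁ c a k (k + 1) b hak (by omega) hkb hb.2 (by linarith [hmin (k + 1)]) hc2 hc1
      (by linarith [hmax k h1 (by omega)])
  · by_contra! hlt
    obtain ⟨c, hc1, hc2⟩ := exists_between hlt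
    have hbk : b < k := lt_of_le_of_ne h1 (by rintro rfl; linarith [hmax (b + 1) (by omega) (by omega)])
    have hkN : k + 1 < a + N := lt_of_le_of_ne h2 (by
      intro h; rw [h, hper] at hlt; linarith [hmin k])
    have hab : a < b := lt_of_le_of_ne hb.1 (by
      rintro rfl; linarith [hmin k, hmax (k + 1) (by omega) (by omega)])
    refine h₂ c b k (k + 1) (a + N) hbk (by omega) hkN (by omega) ?_ hc1 hc2 ?_
    · linarith [hmax (k + 1) (by omega) (by omega)]
    · rw [hper]; linarith [hmin k]

/-! ### The derivative from boundary values of the real part -/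

/-- The kernel that recovers the derivative of a holomorphic function from the boundary values of
its real part. -/
noncomputable def derivKernel (z : ℂ) (t : ℝ) : ℂ := exp (t * I) / (exp (t * I) - z) ^ 2

lemma exp_I_sub_ne_zero {z : ℂ} (hz : z ∈ ball (0 : ℂ) 1) (t : ℝ) : exp (t * I) - z ≠ 0 := by
  intro h
  rw [← sub_eq_zero.1 h, mem_ball_zero_iff, norm_exp_ofReal_mul_I] at hz
  exact lt_irrefl _ hz

lemma continuous_derivKernel {z : ℂ} (hz : z ∈ ball (0 : ℂ) 1) : Continuous (derivKernel z) := by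
  unfold derivKernel
  exact Continuous.div (by fun_prop) (by fun_prop) fun t => pow_ne_zero _ (exp_I_sub_ne_zero hz t)

lemma exp_I_add_two_pi (t : ℝ) : exp ((t + 2 * Real.pi : ℝ) * I) = exp (t * I) := by
  push_cast
  rw [add_mul, exp_add, exp_two_pi_mul_I, mul_one]

lemma hasDerivAt_inv_exp_sub {z : ℂ} (hz : z ∈ ball (0 : ℂ) 1) (t : ℝ) :
    HasDerivAt (fun t : ℝ => (exp (t * I) - z)⁻¹) (-I * derivKernel z t) t := by
  have h1 : HasDerivAt (fun t : ℝ => exp (t * I) - z) (exp (t * I) * I) t := by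
    have : HasDerivAt (fun t : ℝ => (t : ℂ) * I) I t := by
      simpa using (Complex.ofRealCLM.hasDerivAt (x := t)).mul_const I
    exact this.cexp.sub_const z
  have := h1.inv (exp_I_sub_ne_zero hz t)
  convert! this using 1
  rw [derivKernel]
  ring

lemma integral_derivKernel {z : ℂ} (hz : z ∈ ball (0 : ℂ) 1) (a b : ℝ) :
    ∫ t in a..b, derivKernel z t = I * ((exp (b * I) - z)⁻¹ - (exp (a * I) - z)⁻¹) := by
  have h := intervalIntegral.integral_eq_sub_of_hasDerivAt
    (fun t _ => hasDerivAt_inv_exp_sub hz t) (a := a) (b := b)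
    ((continuous_const.mul (continuous_derivKernel hz)).intervalIntegrable _ _)
  rw [intervalIntegral.integral_const_mul] at h
  rw [← h, ← mul_assoc]
  simp

/-- Cauchy's formula represents the derivative of `w ↦ q (r w)`, and the same kernel integrates the
conjugate boundary values to zero; half the sum leaves the real part. -/
lemma deriv_eq_integral_of_lt_one {q : ℂ → ℂ} (hq : DifferentiableOn ℂ q (ball 0 1)) {z : ℂ}
    (hz : z ∈ ball (0 : ℂ) 1) {r : ℝ} (hr : r ∈ Ioo (0 : ℝ) 1) :
    (r : ℂ) * deriv q (r * z) = (1 / Real.pi : ℂ) *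
      ∫ t in (0 : ℝ)..2 * Real.pi, derivKernel z t * ((q (r * exp (t * I))).re : ℂ) := by
  have hz1 : ‖z‖ < 1 := by simpa using hz
  set f : ℂ → ℂ := fun w => q (r * w) with hf
  have hUo : IsOpen (ball (0 : ℂ) (1 / r)) := isOpen_ball
  have hfd : DifferentiableOn ℂ f (ball 0 (1 / r)) := by
    refine hq.comp (by fun_prop) fun w hw => ?_
    rw [mem_ball_zero_iff] at hw ⊢
    rw [norm_mul, norm_real, Real.norm_of_nonneg hr.1.le]
    rwa [lt_div_iff₀ hr.1, mul_comm] at hw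
  have hcb : closedBall (0 : ℂ) 1 ⊆ ball 0 (1 / r) :=
    closedBall_subset_ball (by rw [lt_div_iff₀ hr.1]; linarith [hr.2])
  have hfc : Continuous fun t : ℝ => f (exp (t * I)) := by
    refine hfd.continuousOn.comp_continuous (by fun_prop) fun t => hcb ?_
    rw [mem_closedBall_zero_iff, norm_exp_ofReal_mul_I]
  have hderiv : deriv f z = r * deriv q (r * z) := by
    have h1 : DifferentiableAt ℂ q (r * z) := by
      refine hq.differentiableAt (isOpen_ball.mem_nhds ?_)
      rw [mem_ball_zero_iff, norm_mul, norm_real, Real.norm_of_nonneg hr.1.le]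
      nlinarith [hr.1, hr.2, norm_nonneg z]
    have h2 : HasDerivAt (fun w : ℂ => (r : ℂ) * w) r z := by
      simpa using (hasDerivAt_id z).const_mul (r : ℂ)
    have := h1.hasDerivAt.comp z h2
    rw [hf, mul_comm]
    exact this.deriv
  have hk := continuous_derivKernel hz
  have h1 : ∫ t in (0 : ℝ)..2 * Real.pi, derivKernel z t * f (exp (t * I))
      = 2 * Real.pi * deriv f z := by
    have h := two_pi_I_inv_smul_circleIntegral_sub_sq_inv_smul_of_differentiable hUo hcb hfd hz
    rw [← h, circleIntegral]
    have h2 : ∀ t : ℝ, deriv (circleMap 0 1) t • ((circleMap 0 1 t - z) ^ 2)⁻¹ • f (circleMap 0 1 t)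
        = I * (derivKernel z t * f (exp (t * I))) := fun t => by
      simp only [deriv_circleMap, circleMap, smul_eq_mul, derivKernel]
      simp
      ring
    simp only [h2]
    rw [intervalIntegral.integral_const_mul, smul_eq_mul]
    generalize (∫ t in (0 : ℝ)..2 * Real.pi, derivKernel z t * f (exp (t * I))) = J
    have : (Real.pi : ℂ) ≠ 0 := by exact_mod_cast Real.pi_ne_zero
    have := I_ne_zero
    field_simp
  have h2 : ∫ t in (0 : ℝ)..2 * Real.pi, derivKernel z t * (starRingEnd ℂ) (f (exp (t * I))) = 0 := by
    -- On the circle `conj ζ = 1/ζ`, so the conjugate of the integrand is, up to the factor `I`, the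
    -- pullback of `k dζ` with `k` holomorphic, and Cauchy's theorem applies.
    set k : ℂ → ℂ := fun w => (1 - (starRingEnd ℂ) z * w)⁻¹ ^ 2 * f w with hkdef
    have hne : ∀ w ∈ closedBall (0 : ℂ) 1, 1 - (starRingEnd ℂ) z * w ≠ 0 := by
      intro w hw h
      have h3 : ‖(starRingEnd ℂ) z * w‖ = 1 := by rw [← sub_eq_zero.1 h]; simp
      rw [norm_mul, RCLike.norm_conj] at h3
      have h4 : ‖w‖ ≤ 1 := by simpa using hw
      nlinarith [norm_nonneg z, norm_nonneg w]
    have hkd : DifferentiableOn ℂ k (closedBall 0 1) := by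
      refine DifferentiableOn.mul ((DifferentiableOn.inv ?_ hne).pow 2) (hfd.mono hcb)
      fun_prop
    have h := circleIntegral_eq_zero_of_differentiable_on_off_countable zero_le_one
      (countable_empty) hkd.continuousOn (fun w hw =>
        (hkd.mono ball_subset_closedBall).differentiableAt (isOpen_ball.mem_nhds hw.1))
    rw [circleIntegral] at h
    have h5 : ∀ t : ℝ, deriv (circleMap 0 1) t • k (circleMap 0 1 t)
        = I * (starRingEnd ℂ) (derivKernel z t * (starRingEnd ℂ) (f (exp (t * I)))) := fun t => by
      have h6 : exp (t * I) * (starRingEnd ℂ) (exp (t * I)) = 1 := by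
        rw [mul_conj, normSq_eq_norm_sq, norm_exp_ofReal_mul_I]; simp
      have h7 : (starRingEnd ℂ) (exp (t * I)) - (starRingEnd ℂ) z ≠ 0 := by
        rw [← map_sub]; exact (map_ne_zero _).2 (exp_I_sub_ne_zero hz t)
      have h8 : 1 - (starRingEnd ℂ) z * exp (t * I) =
          exp (t * I) * ((starRingEnd ℂ) (exp (t * I)) - (starRingEnd ℂ) z) := by
        rw [mul_sub, h6]; ring
      simp only [deriv_circleMap, circleMap, smul_eq_mul, derivKernel, hkdef, zero_add, ofReal_one,
        one_mul, map_mul, map_div₀, map_pow, map_sub, conj_conj]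
      rw [h8]
      have h9 := exp_ne_zero (t * I)
      field_simp
      linear_combination (-f (exp (t * I))) * h6
    simp only [h5] at h
    rw [intervalIntegral.integral_const_mul] at h
    have h10 := (mul_eq_zero.1 h).resolve_left I_ne_zero
    rw [intervalIntegral.integral_of_le Real.two_pi_pos.le, integral_conj,
      ← intervalIntegral.integral_of_le Real.two_pi_pos.le] at h10
    exact (map_eq_zero _).1 h10
  have h3 : ∀ t : ℝ, derivKernel z t * ((q (r * exp (t * I))).re : ℂ) =
      (1 / 2) * (derivKernel z t * f (exp (t * I))
        + derivKernel z t * (starRingEnd ℂ) (f (exp (t * I)))) := fun t => by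
    have := Complex.re_eq_add_conj (q (r * exp (t * I)))
    rw [this]
    simp only [hf]
    ring
  have hc1 : Continuous fun t : ℝ => derivKernel z t * f (exp (t * I)) := hk.mul hfc
  have hc2 : Continuous fun t : ℝ => derivKernel z t * (starRingEnd ℂ) (f (exp (t * I))) :=
    hk.mul (continuous_conj.comp hfc)
  simp only [h3]
  rw [intervalIntegral.integral_const_mul, intervalIntegral.integral_add
    (hc1.intervalIntegrable _ _) (hc2.intervalIntegrable _ _), h1, h2, ← hderiv]
  have := Real.pi_ne_zero
  have h4 : (Real.pi : ℂ) ≠ 0 := by exact_mod_cast this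
  field_simp
  ring

/-- The real part of the radial boundary values of `q`. -/
noncomputable def boundaryRe (q : ℂ → ℂ) (t : ℝ) : ℝ :=
  limUnder (𝓝[<] (1 : ℝ)) fun r : ℝ => (q (r * exp (t * I))).re

lemma boundaryRe_periodic (q : ℂ → ℂ) : Function.Periodic (boundaryRe q) (2 * Real.pi) := by
  intro t
  simp only [boundaryRe, exp_I_add_two_pi]

lemma radial_mem_ball {r : ℝ} (hr : r ∈ Ioo (0 : ℝ) 1) (t : ℝ) :
    (r : ℂ) * exp (t * I) ∈ ball (0 : ℂ) 1 := by
  rw [mem_ball_zero_iff, norm_mul, norm_exp_ofReal_mul_I, mul_one, norm_real,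
    Real.norm_of_nonneg hr.1.le]
  exact hr.2

lemma Ioo_zero_one_mem_nhdsLT : Ioo (0 : ℝ) 1 ∈ 𝓝[<] (1 : ℝ) := Ioo_mem_nhdsLT zero_lt_one

section Boundary

variable {q : ℂ → ℂ} {M : ℝ}

/-- At an angle without a radial limit `boundaryRe` is an arbitrary value; such angles form a null
set. -/
lemma ae_tendsto_boundaryRe
    (hlim : ∀ᵐ t : ℝ, ∃ y, Tendsto (fun r : ℝ => q (r * exp (t * I))) (𝓝[<] 1) (𝓝 y)) :
    ∀ᵐ t : ℝ, Tendsto (fun r : ℝ => (q (r * exp (t * I))).re) (𝓝[<] 1) (𝓝 (boundaryRe q t)) := by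
  filter_upwards [hlim] with t ⟨y, hy⟩
  have h := (continuous_re.tendsto y).comp hy
  have h2 : boundaryRe q t = y.re := h.limUnder_eq
  rw [h2]
  exact h

lemma continuous_radial (hq : DifferentiableOn ℂ q (ball 0 1)) {r : ℝ} (hr : r ∈ Ioo (0 : ℝ) 1) :
    Continuous fun t : ℝ => (q (r * exp (t * I))).re :=
  continuous_re.comp (hq.continuousOn.comp_continuous (by fun_prop) (radial_mem_ball hr))

lemma aestronglyMeasurable_boundaryRe (hq : DifferentiableOn ℂ q (ball 0 1))
    (hlim : ∀ᵐ t : ℝ, ∃ y, Tendsto (fun r : ℝ => q (r * exp (t * I))) (𝓝[<] 1) (𝓝 y)) :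
    AEStronglyMeasurable (boundaryRe q) volume := by
  have hu : Tendsto (fun n : ℕ => 1 - 1 / ((n : ℝ) + 2)) atTop (𝓝[<] 1) := by
    refine tendsto_nhdsWithin_iff.2 ⟨?_, Eventually.of_forall fun n => ?_⟩
    · have h1 : Tendsto (fun n : ℕ => 1 / ((n : ℝ) + 2)) atTop (𝓝 0) :=
        tendsto_const_nhds.div_atTop
          (tendsto_atTop_add_const_right _ _ tendsto_natCast_atTop_atTop)
      simpa using tendsto_const_nhds.sub h1
    · have : 0 < 1 / ((n : ℝ) + 2) := by positivity
      simp only [mem_Iio]; linarith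
  refine aestronglyMeasurable_of_tendsto_ae atTop
    (f := fun (n : ℕ) (t : ℝ) => (q (((1 - 1 / ((n : ℝ) + 2) : ℝ) : ℂ) * exp (t * I))).re)
    (fun n => ?_) ?_
  · refine (continuous_radial hq ⟨?_, ?_⟩).aestronglyMeasurable
    · have : 1 / ((n : ℝ) + 2) < 1 := by rw [div_lt_one (by positivity)]; linarith [n.cast_nonneg (α := ℝ)]
      linarith
    · have : 0 < 1 / ((n : ℝ) + 2) := by positivity
      linarith
  · filter_upwards [ae_tendsto_boundaryRe hlim] with t ht
    exact ht.comp hu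

lemma ae_abs_boundaryRe_le (hM : ∀ z ∈ ball (0 : ℂ) 1, ‖q z‖ ≤ M)
    (hlim : ∀ᵐ t : ℝ, ∃ y, Tendsto (fun r : ℝ => q (r * exp (t * I))) (𝓝[<] 1) (𝓝 y)) :
    ∀ᵐ t : ℝ, |boundaryRe q t| ≤ M := by
  filter_upwards [ae_tendsto_boundaryRe hlim] with t ht
  refine le_of_tendsto ht.abs ?_
  filter_upwards [Ioo_zero_one_mem_nhdsLT] with r hr
  exact (abs_re_le_norm _).trans (hM _ (radial_mem_ball hr t))

lemma integrableOn_boundaryRe (hq : DifferentiableOn ℂ q (ball 0 1))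
    (hM : ∀ z ∈ ball (0 : ℂ) 1, ‖q z‖ ≤ M)
    (hlim : ∀ᵐ t : ℝ, ∃ y, Tendsto (fun r : ℝ => q (r * exp (t * I))) (𝓝[<] 1) (𝓝 y))
    {s : Set ℝ} (hs : volume s < ∞) : IntegrableOn (boundaryRe q) s := by
  have : IsFiniteMeasure (volume.restrict s) := ⟨by simpa using hs⟩
  exact Integrable.of_bound (aestronglyMeasurable_boundaryRe hq hlim).restrict M
    (ae_restrict_of_ae (ae_abs_boundaryRe_le hM hlim))

/-- Let `r → 1` in the formula on smaller circles; `M` times the kernel is a dominating function. -/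
lemma deriv_eq_integral_boundaryRe (hq : DifferentiableOn ℂ q (ball 0 1))
    (hM : ∀ z ∈ ball (0 : ℂ) 1, ‖q z‖ ≤ M)
    (hlim : ∀ᵐ t : ℝ, ∃ y, Tendsto (fun r : ℝ => q (r * exp (t * I))) (𝓝[<] 1) (𝓝 y))
    {z : ℂ} (hz : z ∈ ball (0 : ℂ) 1) :
    deriv q z = (1 / Real.pi : ℂ) *
      ∫ t in (0 : ℝ)..2 * Real.pi, derivKernel z t * (boundaryRe q t : ℂ) := by
  have hk := continuous_derivKernel hz
  have h1 : Tendsto (fun r : ℝ => (r : ℂ) * deriv q (r * z)) (𝓝[<] 1) (𝓝 (deriv q z)) := by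
    have hc : ContinuousAt (fun r : ℝ => (r : ℂ) * deriv q (r * z)) 1 := by
      refine ContinuousAt.mul (by fun_prop) ?_
      have : ContinuousAt (deriv q) (((1 : ℝ) : ℂ) * z) := by
        rw [ofReal_one, one_mul]
        exact (hq.deriv isOpen_ball).continuousOn.continuousAt (isOpen_ball.mem_nhds hz)
      exact ContinuousAt.comp (f := fun r : ℝ => (r : ℂ) * z) (g := deriv q) this (by fun_prop)
    have := hc.tendsto.mono_left (nhdsWithin_le_nhds (s := Iio 1))
    simpa using this
  have h2 : Tendsto (fun r : ℝ => (1 / Real.pi : ℂ) *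
      ∫ t in (0 : ℝ)..2 * Real.pi, derivKernel z t * ((q (r * exp (t * I))).re : ℂ)) (𝓝[<] 1)
      (𝓝 ((1 / Real.pi : ℂ) *
      ∫ t in (0 : ℝ)..2 * Real.pi, derivKernel z t * (boundaryRe q t : ℂ))) := by
    refine Tendsto.const_mul _ ?_
    refine intervalIntegral.tendsto_integral_filter_of_dominated_convergence
      (fun t => ‖derivKernel z t‖ * M) ?_ ?_ ?_ ?_
    · filter_upwards [Ioo_zero_one_mem_nhdsLT] with r hr
      exact (hk.mul (continuous_ofReal.comp (continuous_radial hq hr))).aestronglyMeasurable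
    · filter_upwards [Ioo_zero_one_mem_nhdsLT] with r hr
      refine Eventually.of_forall fun t _ => ?_
      rw [norm_mul, norm_real]
      exact mul_le_mul_of_nonneg_left ((abs_re_le_norm _).trans (hM _ (radial_mem_ball hr t)))
        (norm_nonneg _)
    · exact (hk.norm.mul continuous_const).intervalIntegrable _ _
    · filter_upwards [ae_tendsto_boundaryRe hlim] with t ht _
      exact (((continuous_ofReal.tendsto _).comp ht)).const_mul _
  refine tendsto_nhds_unique h1 (h2.congr' ?_)
  filter_upwards [Ioo_zero_one_mem_nhdsLT] with r hr
  exact (deriv_eq_integral_of_lt_one hq hz hr).symm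

/-- The average of the boundary values over the `j`-th arc of length `τ`. -/
noncomputable def arcAverage (q : ℂ → ℂ) (τ : ℝ) (j : ℕ) : ℝ :=
  ⨍ t in Ioo (j * τ) ((j + 1) * τ), boundaryRe q t

lemma volume_arc (τ : ℝ) (j : ℕ) :
    volume (Ioo (j * τ) ((j + 1) * τ)) = ENNReal.ofReal τ := by
  rw [Real.volume_Ioo]; congr 1; ring

lemma arcAverage_periodic (q : ℂ → ℂ) {τ : ℝ} {N : ℕ} (hN : N * τ = 2 * Real.pi) (j : ℕ) :
    arcAverage q τ (j + N) = arcAverage q τ j := by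
  have hmp : MeasurePreserving (fun t : ℝ => t + 2 * Real.pi) := measurePreserving_add_right volume _
  have hpre : (fun t : ℝ => t + 2 * Real.pi) ⁻¹'
      Ioo (((j + N : ℕ) : ℝ) * τ) ((((j + N : ℕ) : ℝ) + 1) * τ) = Ioo (j * τ) ((j + 1) * τ) := by
    rw [preimage_add_const_Ioo]
    push_cast
    congr 1 <;> rw [← hN] <;> ring
  have h := hmp.setIntegral_preimage_emb (measurableEmbedding_addRight _) (boundaryRe q)
    (Ioo (((j + N : ℕ) : ℝ) * τ) ((((j + N : ℕ) : ℝ) + 1) * τ))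
  rw [hpre] at h
  simp only [(boundaryRe_periodic q) _] at h
  have hv := hmp.measure_preimage_emb (measurableEmbedding_addRight _)
    (Ioo (((j + N : ℕ) : ℝ) * τ) ((((j + N : ℕ) : ℝ) + 1) * τ))
  rw [hpre] at hv
  rw [arcAverage, arcAverage, setAverage_eq, setAverage_eq, ← h, measureReal_def, measureReal_def, hv]

/-- An average is reached or exceeded, in either direction, off any null set. The angles can thus be
chosen with an actual radial limit, so that statements about radii apply to averages. -/
lemma exists_boundaryRe_ge_and_le_arcAverage (hq : DifferentiableOn ℂ q (ball 0 1))
    (hM : ∀ z ∈ ball (0 : ℂ) 1, ‖q z‖ ≤ M)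
    (hlim : ∀ᵐ t : ℝ, ∃ y, Tendsto (fun r : ℝ => q (r * exp (t * I))) (𝓝[<] 1) (𝓝 y))
    {τ : ℝ} (hτ : 0 < τ) (j : ℕ) :
    (∃ t ∈ Ioo (j * τ) ((j + 1) * τ),
      Tendsto (fun r : ℝ => (q (r * exp (t * I))).re) (𝓝[<] 1) (𝓝 (boundaryRe q t)) ∧
      arcAverage q τ j ≤ boundaryRe q t) ∧
    ∃ t ∈ Ioo (j * τ) ((j + 1) * τ),
      Tendsto (fun r : ℝ => (q (r * exp (t * I))).re) (𝓝[<] 1) (𝓝 (boundaryRe q t)) ∧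
      boundaryRe q t ≤ arcAverage q τ j := by
  have hint := integrableOn_boundaryRe hq hM hlim (s := Ioo (j * τ) ((j + 1) * τ))
    (by rw [volume_arc]; exact ENNReal.ofReal_lt_top)
  have hae : ∀ᵐ t ∂(volume.restrict (Ioo (j * τ) ((j + 1) * τ))), t ∈ Ioo (j * τ) ((j + 1) * τ) ∧
      Tendsto (fun r : ℝ => (q (r * exp (t * I))).re) (𝓝[<] 1) (𝓝 (boundaryRe q t)) := by
    filter_upwards [ae_restrict_mem measurableSet_Ioo,
      ae_restrict_of_ae (ae_tendsto_boundaryRe hlim)] with t h1 h2 using ⟨h1, h2⟩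
  have : IsFiniteMeasure (volume.restrict (Ioo (j * τ) ((j + 1) * τ))) :=
    ⟨by simp⟩
  have hne : volume.restrict (Ioo (j * τ) ((j + 1) * τ)) ≠ 0 := by
    rw [Ne, Measure.restrict_eq_zero, volume_arc]; simpa using hτ
  constructor
  · obtain ⟨t, ht, hle⟩ := exists_notMem_null_average_le hne hint (ae_iff.1 hae)
    rw [mem_ofPred_eq, not_not] at ht
    exact ⟨t, ht.1, ht.2, hle⟩
  · obtain ⟨t, ht, hle⟩ := exists_notMem_null_le_average hne hint (ae_iff.1 hae)
    rw [mem_ofPred_eq, not_not] at ht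
    exact ⟨t, ht.1, ht.2, hle⟩

end Boundary

/-! ### Step functions and automorphism fields -/

/-- The infinitesimal generators of one-parameter groups of automorphisms of the disk. -/
noncomputable def diskField (c₀ : ℝ) (c z : ℂ) : ℂ := c + c₀ * z + (starRingEnd ℂ) c * z ^ 2

/-- On the circle `V ζ / ζ` is the real number `c₀ + 2 Re (conj c ζ)`, and it multiplies a Poisson
kernel. The remaining terms do not depend on `ζ`, so they cancel in sums whose weights add up to
zero. -/
lemma re_inv_sub_mul_diskField {ζ z c : ℂ} (hζ : ‖ζ‖ = 1) (hz : ζ - z ≠ 0) (c₀ : ℝ) :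
    ((ζ - z)⁻¹ * diskField c₀ c z).re =
      (c₀ + 2 * ((starRingEnd ℂ) c * ζ).re) * (((ζ + z) / (ζ - z)).re / 2)
        - c₀ / 2 - ((starRingEnd ℂ) c * z).re := by
  have h1 : ζ * (starRingEnd ℂ) ζ = 1 := by
    rw [mul_conj, normSq_eq_norm_sq, hζ]; simp
  have h2 : ((2 * ((starRingEnd ℂ) c * ζ).re : ℝ) : ℂ)
      = (starRingEnd ℂ) c * ζ + c * (starRingEnd ℂ) ζ := by
    have := Complex.add_conj ((starRingEnd ℂ) c * ζ)
    rw [map_mul, conj_conj] at this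
    rw [this]
  set S : ℝ := c₀ + 2 * ((starRingEnd ℂ) c * ζ).re with hS
  have h3 : (S : ℂ) = c₀ + ((starRingEnd ℂ) c * ζ + c * (starRingEnd ℂ) ζ) := by
    rw [← h2, hS]; push_cast; ring
  have h4 : (ζ - z)⁻¹ * diskField c₀ c z =
      S * ((1 + (ζ + z) / (ζ - z)) / 2) - c₀ - (starRingEnd ℂ) c * (z + ζ) := by
    have h5 : (1 + (ζ + z) / (ζ - z)) / 2 = ζ / (ζ - z) := by
      field_simp; ring
    rw [h5, h3, diskField]
    field_simp
    linear_combination (-c) * h1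
  have h6 : ((S : ℂ) * ((1 + (ζ + z) / (ζ - z)) / 2)).re
      = S * ((1 + ((ζ + z) / (ζ - z)).re) / 2) := by
    rw [re_ofReal_mul]
    congr 1
    have : ((1 + (ζ + z) / (ζ - z)) / 2 : ℂ) = (((1 : ℝ) / 2 : ℝ) : ℂ) * (1 + (ζ + z) / (ζ - z)) := by
      push_cast; ring
    rw [this, re_ofReal_mul, add_re, one_re]; ring
  rw [h4, sub_re, sub_re, h6, ofReal_re, mul_add, add_re]
  rw [hS]
  ring

lemma re_add_div_sub_nonneg {ζ z : ℂ} (hζ : ‖ζ‖ = 1) (hz : z ∈ ball (0 : ℂ) 1) :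
    0 ≤ ((ζ + z) / (ζ - z)).re := by
  have hz1 : ‖z‖ < 1 := by simpa using hz
  have h := le_re_herglotzRieszKernel (R := 1) (c := 0) (z := ζ) (w := z) (by simpa using hζ) hz
  simp only [sub_zero] at h
  refine le_trans ?_ h
  have : 0 ≤ ‖z‖ := norm_nonneg z
  exact div_nonneg (by linarith) (by linarith)

/-- The limit of half-plane valued functions of the form `p * diskField` is of the same form. -/
lemma exists_diskField_of_tendsto {ι : Type*} {l : Filter ι} [l.NeBot] {p : ι → ℂ → ℂ}
    {p₀ : ℂ → ℂ} (hp : ∀ z ∈ ball (0 : ℂ) 1, Tendsto (fun i => p i z) l (𝓝 (p₀ z))) {C : Set ℝ}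
    (hC : IsCompact C) (h : ∀ i, ∃ c₀ ∈ C, ∃ c : ℂ, ‖c‖ = 1 ∧
      ∀ z ∈ ball (0 : ℂ) 1, 0 ≤ (p i z * diskField c₀ c z).re) :
    ∃ c₀ ∈ C, ∃ c : ℂ, ‖c‖ = 1 ∧ ∀ z ∈ ball (0 : ℂ) 1, 0 ≤ (p₀ z * diskField c₀ c z).re := by
  choose a ha c hc hpos using h
  set 𝒰 := Ultrafilter.of l
  -- The parameters of the fields stay in a compact set, hence converge along an ultrafilter finer
  -- than `l`.
  have hK : IsCompact (C ×ˢ sphere (0 : ℂ) 1) := hC.prod (isCompact_sphere _ _)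
  obtain ⟨⟨a₀, c₀⟩, hmem, hle⟩ := hK.ultrafilter_le_nhds (𝒰.map fun i => (a i, c i)) (by
    rw [le_principal_iff, Ultrafilter.mem_coe, Ultrafilter.mem_map]
    exact Filter.univ_mem' fun i => ⟨ha i, by simpa using hc i⟩)
  have hlim : Tendsto (fun i => (a i, c i)) 𝒰 (𝓝 (a₀, c₀)) := hle
  rw [nhds_prod_eq, tendsto_prod_iff'] at hlim
  refine ⟨a₀, hmem.1, c₀, by simpa using hmem.2, fun z hz => ?_⟩
  have hl1 : Tendsto (fun i => diskField (a i) (c i) z) 𝒰 (𝓝 (diskField a₀ c₀ z)) := by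
    have h1 : Tendsto (fun i => ((a i : ℝ) : ℂ)) 𝒰 (𝓝 (a₀ : ℂ)) :=
      (continuous_ofReal.tendsto a₀).comp hlim.1
    have h2 : Tendsto (fun i => (starRingEnd ℂ) (c i)) 𝒰 (𝓝 ((starRingEnd ℂ) c₀)) :=
      (continuous_conj.tendsto c₀).comp hlim.2
    exact (hlim.2.add (h1.mul_const z)).add (h2.mul_const _)
  have hl2 := ((hp z hz).mono_left (Ultrafilter.of_le l)).mul hl1
  exact ge_of_tendsto ((continuous_re.tendsto _).comp hl2) (Eventually.of_forall fun i => hpos i z hz)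

/-- The derivative of the holomorphic function whose real part has the boundary values `x j` on the
arcs `(j τ, (j + 1) τ)`, `a ≤ j < a + n`. -/
noncomputable def stepDeriv (x : ℕ → ℝ) (τ : ℝ) (a n : ℕ) (z : ℂ) : ℂ :=
  (1 / Real.pi : ℂ) * ∑ j ∈ Finset.range n,
    x (a + j) * ∫ t in ((a + j : ℕ) * τ)..((a + j + 1 : ℕ) * τ), derivKernel z t

/-- Summation by parts: each jump contributes a simple pole weighted by its height, and `hx`, `hn`
close the sum around the circle. -/
lemma I_mul_stepDeriv {x : ℕ → ℝ} {τ : ℝ} {a n : ℕ} (hx : x (a + n) = x a)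
    (hn : n * τ = 2 * Real.pi) {z : ℂ} (hz : z ∈ ball (0 : ℂ) 1) :
    I * stepDeriv x τ a n z = (1 / Real.pi : ℂ) * ∑ j ∈ Finset.range n,
      ((x (a + (j + 1)) - x (a + j) : ℝ) : ℂ) * (exp (((a + (j + 1) : ℕ) * τ : ℝ) * I) - z)⁻¹ := by
  set k : ℕ → ℂ := fun j => (exp (((a + j : ℕ) * τ : ℝ) * I) - z)⁻¹ with hk
  have h1 : ∑ j ∈ Finset.range n, ((x (a + (j + 1)) : ℂ) * k (j + 1) - x (a + j) * k j) = 0 := by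
    rw [Finset.sum_range_sub (fun j => (x (a + j) : ℂ) * k j)]
    have : k n = k 0 := by
      simp only [hk]
      rw [← exp_I_add_two_pi ((a + 0 : ℕ) * τ), ← hn]
      congr 5
      push_cast; ring
    rw [this, hx]; simp
  rw [stepDeriv, mul_left_comm]
  congr 1
  rw [← sub_eq_zero, Finset.mul_sum, ← Finset.sum_sub_distrib, ← neg_eq_zero, ← h1,
    ← Finset.sum_neg_distrib]
  refine Finset.sum_congr rfl fun j _ => ?_
  rw [integral_derivKernel hz]
  simp only [hk, ← add_assoc]
  push_cast
  linear_combination (-(x (a + j) : ℂ) * ((exp ((a + j + 1) * τ * I) - z)⁻¹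
    - (exp ((a + j) * τ * I) - z)⁻¹)) * I_sq

/-- The left side is the boundary value `V ζ / ζ` at `ζ = e^{it}` of the field chosen next; the
factorization shows its zeros at `s` and `u` and its sign on the two arcs. -/
lemma sum_cos_sub_cos (t s u : ℝ) : -2 * Real.cos ((u - s) / 2) + 2 * Real.cos (t - (s + u) / 2)
    = 4 * (Real.sin ((t - s) / 2) * Real.sin ((u - t) / 2)) := by
  have h1 : (u - s) / 2 = (t - s) / 2 + (u - t) / 2 := by ring
  have h2 : t - (s + u) / 2 = (t - s) / 2 - (u - t) / 2 := by ring
  rw [h1, h2, Real.cos_add, Real.cos_sub]; ring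

/-- A step function that rises on one arc and falls on the complementary arc is increasing along a
one-parameter group of automorphisms of the disk. -/
lemma exists_diskField_stepDeriv {x : ℕ → ℝ} {τ : ℝ} (hτ : 0 < τ) {a b n : ℕ}
    (hx : x (a + n) = x a) (hn : n * τ = 2 * Real.pi) (hab : a ≤ b) (hbn : b ≤ a + n)
    (hup : ∀ k, a ≤ k → k < b → x k ≤ x (k + 1))
    (hdown : ∀ k, b ≤ k → k < a + n → x (k + 1) ≤ x k) :
    ∃ c₀ ∈ Icc (-2 : ℝ) 2, ∃ c : ℂ, ‖c‖ = 1 ∧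
      ∀ z ∈ ball (0 : ℂ) 1, 0 ≤ (I * stepDeriv x τ a n z * diskField c₀ c z).re := by
  set s : ℝ := a * τ with hs
  set u : ℝ := b * τ with hu
  have hsu : s ≤ u := mul_le_mul_of_nonneg_right (by exact_mod_cast hab) hτ.le
  -- The field must vanish at the turning points `e^{is}` and `e^{iu}`: `c` is the midpoint of the
  -- rising arc and `c₀` is fixed by its half-length.
  refine ⟨-2 * Real.cos ((u - s) / 2), ⟨?_, ?_⟩, exp (((s + u) / 2 : ℝ) * I),
    norm_exp_ofReal_mul_I _, fun z hz => ?_⟩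
  · linarith [Real.cos_le_one ((u - s) / 2)]
  · linarith [Real.neg_one_le_cos ((u - s) / 2)]
  set c₀ := -2 * Real.cos ((u - s) / 2) with hc₀
  set c := exp (((s + u) / 2 : ℝ) * I) with hc
  rw [I_mul_stepDeriv hx hn hz, mul_assoc, Finset.sum_mul,
    show (1 / Real.pi : ℂ) = ((1 / Real.pi : ℝ) : ℂ) by push_cast; rfl, re_ofReal_mul]
  refine mul_nonneg (by positivity) ?_
  rw [re_sum]
  have hterm : ∀ j, (((x (a + (j + 1)) - x (a + j) : ℝ) : ℂ) *
      (exp (((a + (j + 1) : ℕ) * τ : ℝ) * I) - z)⁻¹ * diskField c₀ c z).re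
      = (x (a + (j + 1)) - x (a + j)) * (4 * (Real.sin (((a + (j + 1) : ℕ) * τ - s) / 2) *
          Real.sin ((u - (a + (j + 1) : ℕ) * τ) / 2)) *
          (((exp (((a + (j + 1) : ℕ) * τ : ℝ) * I) + z) /
            (exp (((a + (j + 1) : ℕ) * τ : ℝ) * I) - z)).re / 2))
        - (x (a + (j + 1)) - x (a + j)) * (c₀ / 2 + ((starRingEnd ℂ) c * z).re) := by
    intro j
    rw [mul_assoc, re_ofReal_mul, re_inv_sub_mul_diskField (norm_exp_ofReal_mul_I _)
      (exp_I_sub_ne_zero hz _), ← sum_cos_sub_cos]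
    have : ((starRingEnd ℂ) c * exp (((a + (j + 1) : ℕ) * τ : ℝ) * I)).re
        = Real.cos ((a + (j + 1) : ℕ) * τ - (s + u) / 2) := by
      rw [hc, ← exp_conj, ← exp_add, map_mul, conj_ofReal, conj_I,
        show (((s + u) / 2 : ℝ) : ℂ) * -I + (((a + (j + 1) : ℕ) * τ : ℝ) : ℂ) * I
          = (((a + (j + 1) : ℕ) * τ - (s + u) / 2 : ℝ) : ℂ) * I by push_cast; ring,
        exp_ofReal_mul_I_re]
    rw [this]
    ring
  simp only [hterm]
  -- The jumps sum to zero by periodicity, which removes the part independent of the pole.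
  rw [Finset.sum_sub_distrib, ← Finset.sum_mul, Finset.sum_range_sub (fun j => x (a + j)), hx]
  simp only [add_zero, sub_self, zero_mul, sub_zero]
  refine Finset.sum_nonneg fun j hj => ?_
  rw [Finset.mem_range] at hj
  have hP := re_add_div_sub_nonneg (norm_exp_ofReal_mul_I ((a + (j + 1) : ℕ) * τ)) hz
  have h1 : 0 ≤ (a + (j + 1) : ℕ) * τ - s := by
    rw [hs, ← sub_mul]; push_cast; refine mul_nonneg ?_ hτ.le; linarith [j.cast_nonneg (α := ℝ)]
  have h2 : (a + (j + 1) : ℕ) * τ - s ≤ 2 * Real.pi := by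
    rw [hs, ← hn, ← sub_mul]
    refine mul_le_mul_of_nonneg_right ?_ hτ.le
    have : ((j + 1 : ℕ) : ℝ) ≤ n := by exact_mod_cast hj
    push_cast at this ⊢; linarith
  have hsin1 : 0 ≤ Real.sin (((a + (j + 1) : ℕ) * τ - s) / 2) :=
    Real.sin_nonneg_of_nonneg_of_le_pi (by linarith) (by linarith)
  -- Each jump has the sign of its sine product: upward jumps sit on the arc from `s` to `u`,
  -- downward ones on the rest.
  rcases Nat.lt_or_ge (a + j) b with h3 | h3
  · have h4 : 0 ≤ u - (a + (j + 1) : ℕ) * τ := by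
      rw [hu, ← sub_mul]
      refine mul_nonneg (sub_nonneg.2 ?_) hτ.le
      exact_mod_cast h3
    have h5 : u - (a + (j + 1) : ℕ) * τ ≤ 2 * Real.pi := by
      have : u ≤ s + 2 * Real.pi := by
        rw [hs, hu, ← hn, ← add_mul]
        exact mul_le_mul_of_nonneg_right (by exact_mod_cast hbn) hτ.le
      linarith
    have hsin2 : 0 ≤ Real.sin ((u - (a + (j + 1) : ℕ) * τ) / 2) :=
      Real.sin_nonneg_of_nonneg_of_le_pi (by linarith) (by linarith)
    have h6 := hup (a + j) (by omega) h3
    exact mul_nonneg (sub_nonneg.2 h6) (by positivity)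
  · have h4 : u - (a + (j + 1) : ℕ) * τ ≤ 0 := by
      rw [hu, ← sub_mul]
      refine mul_nonpos_of_nonpos_of_nonneg (sub_nonpos.2 ?_) hτ.le
      exact_mod_cast (by omega : b ≤ a + (j + 1))
    have hsin2 : Real.sin ((u - (a + (j + 1) : ℕ) * τ) / 2) ≤ 0 :=
      Real.sin_nonpos_of_nonpos_of_neg_pi_le (by linarith) (by linarith)
    have h6 := hdown (a + j) h3 (by omega)
    refine mul_nonneg_of_nonpos_of_nonpos (sub_nonpos.2 h6) ?_
    refine mul_nonpos_of_nonpos_of_nonneg ?_ (by positivity)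
    nlinarith

/-! ### Convergence of the step approximations -/

section Averages

variable {q : ℂ → ℂ} {M : ℝ}

lemma arcAverage_mul (q : ℂ → ℂ) {τ : ℝ} (hτ : 0 < τ) (j : ℕ) :
    ∫ t in (j * τ : ℝ)..((j + 1 : ℕ) * τ), boundaryRe q t = τ * arcAverage q τ j := by
  have hle : (j * τ : ℝ) ≤ ((j + 1 : ℕ) * τ) :=
    mul_le_mul_of_nonneg_right (by push_cast; linarith) hτ.le
  rw [intervalIntegral.integral_of_le hle, integral_Ioc_eq_integral_Ioo, arcAverage, setAverage_eq,
    measureReal_def]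
  push_cast
  rw [volume_arc, ENNReal.toReal_ofReal hτ.le, smul_eq_mul, ← mul_assoc, mul_inv_cancel₀ hτ.ne',
    one_mul]

lemma abs_arcAverage_le (hq : DifferentiableOn ℂ q (ball 0 1))
    (hM : ∀ z ∈ ball (0 : ℂ) 1, ‖q z‖ ≤ M)
    (hlim : ∀ᵐ t : ℝ, ∃ y, Tendsto (fun r : ℝ => q (r * exp (t * I))) (𝓝[<] 1) (𝓝 y))
    {τ : ℝ} (hτ : 0 < τ) (j : ℕ) : |arcAverage q τ j| ≤ M := by
  have hb : ∀ {t : ℝ}, Tendsto (fun r : ℝ => (q (r * exp (t * I))).re) (𝓝[<] 1)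
      (𝓝 (boundaryRe q t)) → |boundaryRe q t| ≤ M := by
    intro t ht
    refine le_of_tendsto ht.abs ?_
    filter_upwards [Ioo_zero_one_mem_nhdsLT] with r hr
    exact (abs_re_le_norm _).trans (hM _ (radial_mem_ball hr t))
  obtain ⟨⟨t, -, h1, h2⟩, s, -, h3, h4⟩ := exists_boundaryRe_ge_and_le_arcAverage hq hM hlim hτ j
  rw [abs_le]
  constructor
  · linarith [(abs_le.1 (hb h3)).1]
  · linarith [(abs_le.1 (hb h1)).2]

/-- The boundary function minus its average integrates to zero over the arc, so only the oscillation
of `k` about its left endpoint value counts. -/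
lemma norm_arcAverage_mul_integral_sub_le (hq : DifferentiableOn ℂ q (ball 0 1))
    (hM : ∀ z ∈ ball (0 : ℂ) 1, ‖q z‖ ≤ M)
    (hlim : ∀ᵐ t : ℝ, ∃ y, Tendsto (fun r : ℝ => q (r * exp (t * I))) (𝓝[<] 1) (𝓝 y))
    {τ : ℝ} (hτ : 0 < τ) (j : ℕ) {k : ℝ → ℂ} (hk : Continuous k) {ε : ℝ}
    (hkε : ∀ t ∈ Icc (j * τ : ℝ) ((j + 1 : ℕ) * τ), ‖k t - k (j * τ)‖ ≤ ε) :
    ‖arcAverage q τ j * (∫ t in (j * τ : ℝ)..((j + 1 : ℕ) * τ), k t) -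
      ∫ t in (j * τ : ℝ)..((j + 1 : ℕ) * τ), k t * (boundaryRe q t : ℂ)‖ ≤ 2 * M * ε * τ := by
  have hle : (j * τ : ℝ) ≤ ((j + 1 : ℕ) * τ) :=
    mul_le_mul_of_nonneg_right (by push_cast; linarith) hτ.le
  set x := arcAverage q τ j with hx
  have hF : IntervalIntegrable (fun t => (boundaryRe q t : ℂ)) volume (j * τ : ℝ) ((j + 1 : ℕ) * τ) := by
    rw [intervalIntegrable_iff_integrableOn_Ioc_of_le hle]
    exact (integrableOn_boundaryRe hq hM hlim (by simp)).ofReal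
  have hkF := hF.continuousOn_mul hk.continuousOn
  have hkc := hk.intervalIntegrable (μ := volume) (j * τ : ℝ) ((j + 1 : ℕ) * τ)
  have h0 : ∫ t in (j * τ : ℝ)..((j + 1 : ℕ) * τ), ((x : ℂ) - boundaryRe q t) = 0 := by
    rw [intervalIntegral.integral_sub (by simp) hF, intervalIntegral.integral_const,
      intervalIntegral.integral_ofReal, arcAverage_mul q hτ, ← hx, real_smul]
    push_cast; ring
  have h1 : x * (∫ t in (j * τ : ℝ)..((j + 1 : ℕ) * τ), k t) -
      ∫ t in (j * τ : ℝ)..((j + 1 : ℕ) * τ), k t * (boundaryRe q t : ℂ) =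
      ∫ t in (j * τ : ℝ)..((j + 1 : ℕ) * τ), (k t - k (j * τ)) * ((x : ℂ) - boundaryRe q t) := by
    have h2 : ∀ t, (k t - k (j * τ)) * ((x : ℂ) - boundaryRe q t)
        = (x * k t - k t * boundaryRe q t) - k (j * τ) * ((x : ℂ) - boundaryRe q t) := fun t => by ring
    simp only [h2]
    rw [intervalIntegral.integral_sub ((hkc.const_mul _).sub hkF)
      (((intervalIntegrable_const).sub hF).const_mul _), intervalIntegral.integral_const_mul, h0,
      intervalIntegral.integral_sub (hkc.const_mul _) hkF, intervalIntegral.integral_const_mul]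
    simp
  have hM0 : 0 ≤ M := (norm_nonneg _).trans (hM 0 (by simp))
  rw [h1]
  have hlen : 2 * M * ε * τ = ε * (2 * M) * |((j + 1 : ℕ) * τ) - (j * τ : ℝ)| := by
    have : ((j + 1 : ℕ) * τ) - (j * τ : ℝ) = τ := by push_cast; ring
    rw [this, abs_of_pos hτ]; ring
  rw [hlen]
  refine intervalIntegral.norm_integral_le_of_norm_le_const_ae ?_
  filter_upwards [ae_abs_boundaryRe_le hM hlim] with t ht htm
  rw [uIoc_of_le hle] at htm
  rw [norm_mul]
  have hε := hkε t (Ioc_subset_Icc_self htm)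
  refine mul_le_mul hε ?_ (norm_nonneg _) ((norm_nonneg _).trans hε)
  rw [← ofReal_sub, norm_real, Real.norm_eq_abs]
  have := abs_arcAverage_le hq hM hlim hτ j
  have h3 := abs_sub x (boundaryRe q t)
  linarith

lemma tendsto_stepDeriv (hq : DifferentiableOn ℂ q (ball 0 1))
    (hM : ∀ z ∈ ball (0 : ℂ) 1, ‖q z‖ ≤ M)
    (hlim : ∀ᵐ t : ℝ, ∃ y, Tendsto (fun r : ℝ => q (r * exp (t * I))) (𝓝[<] 1) (𝓝 y))
    {z : ℂ} (hz : z ∈ ball (0 : ℂ) 1) {a : ℕ → ℕ} (ha : ∀ N, a N < N + 1) :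
    Tendsto (fun N : ℕ => stepDeriv (arcAverage q (2 * Real.pi / (N + 1 : ℕ)))
      (2 * Real.pi / (N + 1 : ℕ)) (a N) (N + 1) z) atTop (𝓝 (deriv q z)) := by
  have hM0 : 0 ≤ M := (norm_nonneg _).trans (hM 0 (by simp))
  have hπ := Real.pi_pos
  have hk := continuous_derivKernel hz
  rw [Metric.tendsto_atTop]
  intro ε hε
  set ε' := ε / (4 * M + 1) with hε'
  have hε'0 : 0 < ε' := by positivity
  -- The starting arc varies with `N` but has index below `N + 1`, so one full turn from it stays
  -- within `[0, 4π]`.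
  have huc := isCompact_Icc.uniformContinuousOn_of_continuous (hk.continuousOn (s := Icc 0 (4 * Real.pi)))
  rw [Metric.uniformContinuousOn_iff] at huc
  obtain ⟨δ, hδ, hδk⟩ := huc ε' hε'0
  obtain ⟨N₀, hN₀⟩ := exists_nat_gt (2 * Real.pi / δ)
  refine ⟨N₀, fun N hN => ?_⟩
  set τ := 2 * Real.pi / (N + 1 : ℕ) with hτdef
  have hNpos : (0 : ℝ) < (N + 1 : ℕ) := by positivity
  have hτ : 0 < τ := by positivity
  have hNτ : (N + 1 : ℕ) * τ = 2 * Real.pi := by rw [hτdef]; field_simp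
  have hτδ : τ < δ := by
    rw [hτdef, div_lt_iff₀ hNpos]
    rw [div_lt_iff₀ hδ] at hN₀
    have : (N₀ : ℝ) ≤ (N + 1 : ℕ) := by exact_mod_cast (by omega : N₀ ≤ N + 1)
    nlinarith
  have hderiv : deriv q z = (1 / Real.pi : ℂ) * ∑ j ∈ Finset.range (N + 1),
      ∫ t in ((a N + j : ℕ) * τ : ℝ)..((a N + j + 1 : ℕ) * τ), derivKernel z t * (boundaryRe q t : ℂ) := by
    rw [deriv_eq_integral_boundaryRe hq hM hlim hz]
    congr 1
    have hper : Function.Periodic (fun t => derivKernel z t * (boundaryRe q t : ℂ)) (2 * Real.pi) := by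
      intro t
      simp only [derivKernel, exp_I_add_two_pi, (boundaryRe_periodic q) t]
    have h1 := hper.intervalIntegral_add_eq 0 (a N * τ)
    rw [zero_add] at h1
    rw [h1]
    have hii : ∀ s u : ℝ, IntervalIntegrable (fun t => derivKernel z t * (boundaryRe q t : ℂ)) volume s u := by
      intro s u
      refine IntervalIntegrable.continuousOn_mul ?_ hk.continuousOn
      rw [intervalIntegrable_iff]
      exact (integrableOn_boundaryRe hq hM hlim (by simp [uIoc])).ofReal
    have h2 := intervalIntegral.sum_integral_adjacent_intervals (n := N + 1)
      (a := fun j : ℕ => ((a N + j : ℕ) * τ : ℝ)) (fun j _ => hii _ _)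
    simp only [add_zero] at h2
    rw [show ((a N + (N + 1) : ℕ) * τ : ℝ) = a N * τ + 2 * Real.pi by
      rw [← hNτ]; push_cast; ring] at h2
    rw [← h2]
    simp only [add_assoc]
  rw [dist_eq_norm, hderiv, stepDeriv, ← mul_sub, ← Finset.sum_sub_distrib, norm_mul]
  have hbound : ∀ j ∈ Finset.range (N + 1), ‖(arcAverage q τ (a N + j) : ℂ) *
      (∫ t in ((a N + j : ℕ) * τ : ℝ)..((a N + j + 1 : ℕ) * τ), derivKernel z t) -
      ∫ t in ((a N + j : ℕ) * τ : ℝ)..((a N + j + 1 : ℕ) * τ),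
        derivKernel z t * (boundaryRe q t : ℂ)‖ ≤ 2 * M * ε' * τ := by
    intro j hj
    refine norm_arcAverage_mul_integral_sub_le hq hM hlim hτ (a N + j) hk fun t ht => ?_
    have h1 : (0 : ℝ) ≤ (a N + j : ℕ) * τ := by positivity
    have h2 : ((a N + j + 1 : ℕ) * τ : ℝ) ≤ 4 * Real.pi := by
      rw [show 4 * Real.pi = ((2 * (N + 1) : ℕ) : ℝ) * τ by
        push_cast; push_cast at hNτ; linarith]
      refine mul_le_mul_of_nonneg_right ?_ hτ.le
      have := ha N
      rw [Finset.mem_range] at hj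
      exact_mod_cast (by omega : a N + j + 1 ≤ 2 * (N + 1))
    have h3 : ((a N + j + 1 : ℕ) * τ : ℝ) = (a N + j : ℕ) * τ + τ := by push_cast; ring
    rw [← dist_eq_norm]
    refine (hδk t ⟨h1.trans ht.1, ht.2.trans h2⟩ _ ⟨h1, by linarith⟩ ?_).le
    rw [Real.dist_eq, abs_of_nonneg (by linarith [ht.1])]
    linarith [ht.2]
  have hsum := norm_sum_le_of_le _ hbound
  rw [Finset.sum_const, Finset.card_range, nsmul_eq_mul] at hsum
  have h4 : ‖(1 / Real.pi : ℂ)‖ = 1 / Real.pi := by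
    rw [norm_div, norm_one, norm_real, Real.norm_of_nonneg hπ.le]
  rw [h4]
  calc _ ≤ 1 / Real.pi * ((N + 1 : ℕ) * (2 * M * ε' * τ)) :=
        mul_le_mul_of_nonneg_left hsum (by positivity)
    _ = 1 / Real.pi * (2 * M * ε' * ((N + 1 : ℕ) * τ)) := by ring
    _ = 4 * M * ε' := by rw [hNτ]; field_simp; ring
    _ < ε := by
        rw [hε', mul_div_assoc', div_lt_iff₀ (by positivity)]
        nlinarith

end Averages

/-- A bounded holomorphic function with radial limits such that the level domains of its real part
are path connected has a real part that increases along a one-parameter group of automorphisms. -/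
theorem exists_diskField_of_joinedIn_levels {q : ℂ → ℂ} {M : ℝ}
    (hq : DifferentiableOn ℂ q (ball 0 1)) (hM : ∀ z ∈ ball (0 : ℂ) 1, ‖q z‖ ≤ M)
    (hlim : ∀ᵐ t : ℝ, ∃ y, Tendsto (fun r : ℝ => q (r * exp (t * I))) (𝓝[<] 1) (𝓝 y))
    (hup : ∀ c : ℝ, ∀ x ∈ ball (0 : ℂ) 1 ∩ {z | c < (q z).re}, ∀ y ∈ ball (0 : ℂ) 1 ∩ {z | c < (q z).re},
      JoinedIn (ball (0 : ℂ) 1 ∩ {z | c < (q z).re}) x y)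
    (hdown : ∀ c : ℝ, ∀ x ∈ ball (0 : ℂ) 1 ∩ {z | (q z).re < c}, ∀ y ∈ ball (0 : ℂ) 1 ∩ {z | (q z).re < c},
      JoinedIn (ball (0 : ℂ) 1 ∩ {z | (q z).re < c}) x y) :
    ∃ c₀ ∈ Icc (-2 : ℝ) 2, ∃ c : ℂ, ‖c‖ = 1 ∧
      ∀ z ∈ ball (0 : ℂ) 1, 0 ≤ (I * deriv q z * diskField c₀ c z).re := by
  have hmemA : ∀ {c t : ℝ}, Tendsto (fun r : ℝ => (q (r * exp (t * I))).re) (𝓝[<] 1)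
      (𝓝 (boundaryRe q t)) → c < boundaryRe q t → ∀ᶠ r : ℝ in 𝓝[<] 1,
      (r : ℂ) * exp (t * I) ∈ ball (0 : ℂ) 1 ∩ {z | c < (q z).re} := by
    intro c t ht hc
    filter_upwards [ht.eventually_const_lt hc, Ioo_zero_one_mem_nhdsLT] with r h1 h2
      using ⟨radial_mem_ball h2 t, h1⟩
  have hmemB : ∀ {c t : ℝ}, Tendsto (fun r : ℝ => (q (r * exp (t * I))).re) (𝓝[<] 1)
      (𝓝 (boundaryRe q t)) → boundaryRe q t < c → ∀ᶠ r : ℝ in 𝓝[<] 1,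
      (r : ℂ) * exp (t * I) ∈ ball (0 : ℂ) 1 ∩ {z | (q z).re < c} := by
    intro c t ht hc
    filter_upwards [ht.eventually_lt_const hc, Ioo_zero_one_mem_nhdsLT] with r h1 h2
      using ⟨radial_mem_ball h2 t, h1⟩
  have hdisj : ∀ c : ℝ, Disjoint (ball (0 : ℂ) 1 ∩ {z | c < (q z).re})
      (ball (0 : ℂ) 1 ∩ {z | (q z).re < c}) := fun c =>
    disjoint_left.2 fun z h1 h2 => lt_asymm (show c < (q z).re from h1.2) h2.2
  -- Averages alternating around a level `c` would give four interlaced radii ending in the two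
  -- disjoint level domains.
  have hstep : ∀ N : ℕ, ∃ a b : ℕ, a < N + 1 ∧ a ≤ b ∧ b ≤ a + (N + 1) ∧
      (∀ k, a ≤ k → k < b → arcAverage q (2 * Real.pi / (N + 1 : ℕ)) k
        ≤ arcAverage q (2 * Real.pi / (N + 1 : ℕ)) (k + 1)) ∧
      ∀ k, b ≤ k → k < a + (N + 1) → arcAverage q (2 * Real.pi / (N + 1 : ℕ)) (k + 1)
        ≤ arcAverage q (2 * Real.pi / (N + 1 : ℕ)) k := by
    intro N
    set τ := 2 * Real.pi / (N + 1 : ℕ) with hτdef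
    have hτ : 0 < τ := by have := Real.pi_pos; positivity
    have hNτ : (N + 1 : ℕ) * τ = 2 * Real.pi := by rw [hτdef]; field_simp
    have hstepτ : ∀ {i j : ℕ}, i < j → ((i : ℝ) + 1) * τ ≤ j * τ := fun {i j} h =>
      mul_le_mul_of_nonneg_right (by exact_mod_cast h) hτ.le
    have hwrap : ∀ {i l : ℕ}, l < i + (N + 1) → ((l : ℝ) + 1) * τ ≤ i * τ + 2 * Real.pi := by
      intro i l h
      rw [← hNτ, ← add_mul]
      exact mul_le_mul_of_nonneg_right (by exact_mod_cast h) hτ.le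
    have hex := fun j => exists_boundaryRe_ge_and_le_arcAverage hq hM hlim hτ j
    refine exists_unimodal_of_not_alternating (Nat.succ_pos N) (arcAverage_periodic q hNτ) ?_ ?_
    · intro c i j k l hij hjk hkl hli h1 h2 h3 h4
      obtain ⟨t₁, m₁, l₁, e₁⟩ := (hex i).2
      obtain ⟨t₂, m₂, l₂, e₂⟩ := (hex j).1
      obtain ⟨t₃, m₃, l₃, e₃⟩ := (hex k).2
      obtain ⟨t₄, m₄, l₄, e₄⟩ := (hex l).1
      exact false_of_interlaced_radii inter_subset_left inter_subset_left (hdisj c).symm (hdown c)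
        (hup c) (t₁ := t₁) (t₂ := t₂) (t₃ := t₃) (t₄ := t₄)
        (by linarith [m₁.2, m₂.1, hstepτ hij]) (by linarith [m₂.2, m₃.1, hstepτ hjk])
        (by linarith [m₃.2, m₄.1, hstepτ hkl]) (by linarith [m₄.2, m₁.1, hwrap hli])
        (hmemB l₁ (by linarith)) (hmemA l₂ (by linarith)) (hmemB l₃ (by linarith))
        (hmemA l₄ (by linarith))
    · intro c i j k l hij hjk hkl hli h1 h2 h3 h4
      obtain ⟨t₁, m₁, l₁, e₁⟩ := (hex i).1
      obtain ⟨t₂, m₂, l₂, e₂⟩ := (hex j).2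
      obtain ⟨t₃, m₃, l₃, e₃⟩ := (hex k).1
      obtain ⟨t₄, m₄, l₄, e₄⟩ := (hex l).2
      exact false_of_interlaced_radii inter_subset_left inter_subset_left (hdisj c) (hup c)
        (hdown c) (t₁ := t₁) (t₂ := t₂) (t₃ := t₃) (t₄ := t₄)
        (by linarith [m₁.2, m₂.1, hstepτ hij]) (by linarith [m₂.2, m₃.1, hstepτ hjk])
        (by linarith [m₃.2, m₄.1, hstepτ hkl]) (by linarith [m₄.2, m₁.1, hwrap hli])
        (hmemA l₁ (by linarith)) (hmemB l₂ (by linarith)) (hmemA l₃ (by linarith))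
        (hmemB l₄ (by linarith))
  choose a b haN hab hbN hinc hdec using hstep
  refine exists_diskField_of_tendsto (l := atTop)
    (p := fun N z => I * stepDeriv (arcAverage q (2 * Real.pi / (N + 1 : ℕ)))
      (2 * Real.pi / (N + 1 : ℕ)) (a N) (N + 1) z)
    (fun z hz => (tendsto_stepDeriv hq hM hlim hz haN).const_mul I) isCompact_Icc fun N => ?_
  have hτ : 0 < 2 * Real.pi / (N + 1 : ℕ) := by have := Real.pi_pos; positivity
  have hNτ : (N + 1 : ℕ) * (2 * Real.pi / (N + 1 : ℕ)) = 2 * Real.pi := by field_simp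
  exact exists_diskField_stepDeriv hτ (arcAverage_periodic q hNτ _) hNτ (hab N) (hbN N) (hinc N)
    (hdec N)

/-! ### Components of convex harmonic mappings -/

/-- A Montel limit fixes `0` with derivative `1`, so the equality case of the Schwarz lemma makes it
the identity. -/
lemma tendsto_id_of_tendsto_deriv_zero {ι : Type*} (𝒰 : Ultrafilter ι) {F : ι → ℂ → ℂ}
    (hF : ∀ i, DifferentiableOn ℂ (F i) (ball 0 1)) (hm : ∀ i, MapsTo (F i) (ball 0 1) (ball 0 1))
    (h0 : ∀ i, F i 0 = 0) (hd : Tendsto (fun i => deriv (F i) 0) 𝒰 (𝓝 1)) :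
    ∀ z ∈ ball (0 : ℂ) 1, Tendsto (fun i => F i z) 𝒰 (𝓝 z) ∧
      Tendsto (fun i => deriv (F i) z) 𝒰 (𝓝 1) := by
  obtain ⟨Φ, hlim, hΦ, hΦ1⟩ := exists_tendstoLocallyUniformlyOn_of_norm_le 𝒰 isOpen_ball hF (M := 1)
    (fun i z hz => by simpa using ball_subset_closedBall (hm i hz))
  have hlimd := hlim.deriv (Eventually.of_forall hF) isOpen_ball
  have h00 : (0 : ℂ) ∈ ball (0 : ℂ) 1 := by simp
  have hΦ0 : Φ 0 = 0 := by
    refine tendsto_nhds_unique (hlim.tendsto_at h00) ?_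
    simp only [h0]
    exact tendsto_const_nhds
  have hΦd : deriv Φ 0 = 1 := tendsto_nhds_unique (hlimd.tendsto_at h00) hd
  have haff := affine_of_mapsTo_ball_of_norm_dslope_eq_div (R₂ := 1) hΦ
    (fun z hz => by simpa [hΦ0] using hΦ1 z hz) h00 (by simp [dslope_same, hΦd])
  have hid : EqOn Φ id (ball 0 1) := fun z hz => by
    have := haff hz
    simpa [hΦ0, dslope_same, hΦd] using this
  intro z hz
  have h1 := hlim.tendsto_at hz
  have h2 := hlimd.tendsto_at hz
  rw [hid hz] at h1
  rw [(hid.eventuallyEq_of_mem (isOpen_ball.mem_nhds hz)).deriv_eq, deriv_id] at h2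
  exact ⟨h1, h2⟩

section HarmonicMap

variable {h g : ℂ → ℂ}

lemma continuousOn_harmonicMap (hh : DifferentiableOn ℂ h (ball 0 1))
    (hg : DifferentiableOn ℂ g (ball 0 1)) : ContinuousOn (harmonicMap h g) (ball 0 1) :=
  hh.continuousOn.add (continuous_conj.comp_continuousOn hg.continuousOn)

/-- A sense-preserving harmonic mapping is a local homeomorphism. -/
lemma map_nhds_harmonicMap (hh : DifferentiableOn ℂ h (ball 0 1))
    (hg : DifferentiableOn ℂ g (ball 0 1))
    (hsp : ∀ z ∈ ball (0 : ℂ) 1, ‖deriv g z‖ < ‖deriv h z‖) {z : ℂ} (hz : z ∈ ball (0 : ℂ) 1) :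
    map (harmonicMap h g) (𝓝 z) = 𝓝 (harmonicMap h g z) := by
  have h1 := ((hh.analyticOnNhd isOpen_ball z hz).hasStrictDerivAt).complexToReal_fderiv
  have h2 := ((hg.analyticOnNhd isOpen_ball z hz).hasStrictDerivAt).complexToReal_fderiv
  have h3 : HasStrictFDerivAt (harmonicMap h g) (deriv h z • (1 : ℂ →L[ℝ] ℂ) +
      (conjCLE : ℂ →L[ℝ] ℂ).comp (deriv g z • (1 : ℂ →L[ℝ] ℂ))) z :=
    h1.add ((conjCLE : ℂ →L[ℝ] ℂ).hasStrictFDerivAt.comp z h2)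
  refine h3.map_nhds_eq_of_surj ?_
  rw [LinearMap.range_eq_top]
  refine LinearMap.surjective_of_injective ?_
  rw [injective_iff_map_eq_zero]
  intro v hv
  by_contra hv0
  have h4 : deriv h z * v = -(starRingEnd ℂ) (deriv g z * v) := by
    rw [eq_neg_iff_add_eq_zero]
    simpa using hv
  have h5 : ‖deriv h z‖ * ‖v‖ = ‖deriv g z‖ * ‖v‖ := by
    rw [← norm_mul, h4, norm_neg, RCLike.norm_conj, norm_mul]
  have := mul_right_cancel₀ (norm_ne_zero_iff.2 hv0) h5
  exact absurd this (hsp z hz).ne'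

lemma exists_inverse_harmonicMap (hh : DifferentiableOn ℂ h (ball 0 1))
    (hg : DifferentiableOn ℂ g (ball 0 1))
    (hsp : ∀ z ∈ ball (0 : ℂ) 1, ‖deriv g z‖ < ‖deriv h z‖)
    (hinj : InjOn (harmonicMap h g) (ball 0 1)) :
    ∃ k : ℂ → ℂ, (∀ z ∈ ball (0 : ℂ) 1, k (harmonicMap h g z) = z) ∧
      ContinuousOn k (harmonicMap h g '' ball 0 1) := by
  refine ⟨Function.invFunOn (harmonicMap h g) (ball 0 1), fun z hz => hinj.leftInvOn_invFunOn hz, ?_⟩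
  rintro _ ⟨z, hz, rfl⟩
  refine ContinuousAt.continuousWithinAt ?_
  rw [ContinuousAt, hinj.leftInvOn_invFunOn hz, ← map_nhds_harmonicMap hh hg hsp hz, tendsto_map'_iff]
  refine tendsto_id.congr' ?_
  filter_upwards [isOpen_ball.mem_nhds hz] with w hw
  exact (hinj.leftInvOn_invFunOn hw).symm

lemma isSimplyConnected_of_leftInverse {f k : ℂ → ℂ} {O U : Set ℂ} (hO : Convex ℝ O)
    (hne : O.Nonempty) (hk : ContinuousOn k O) (hkm : MapsTo k O U) (hf : ContinuousOn f U)
    (hfm : MapsTo f U O) (hfk : LeftInvOn f k O) (hkf : LeftInvOn k f U) : IsSimplyConnected U := by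
  have e : O ≃ₜ U :=
    { toFun := fun x => ⟨k x, hkm x.2⟩
      invFun := fun x => ⟨f x, hfm x.2⟩
      left_inv := fun x => Subtype.ext (hfk x.2)
      right_inv := fun x => Subtype.ext (hkf x.2)
      continuous_toFun := (continuousOn_iff_continuous_domRestrict.1 hk).subtype_mk _
      continuous_invFun := (continuousOn_iff_continuous_domRestrict.1 hf).subtype_mk _ }
  have h1 : ContractibleSpace O := hO.contractibleSpace hne
  have h2 : ContractibleSpace U := e.symm.contractibleSpace
  exact SimplyConnectedSpace.ofContractible _

/-- The holomorphic function whose real part is the component of `h + conj g` in the direction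
`exp (i ν)`. -/
noncomputable def directionalPart (h g : ℂ → ℂ) (ν : ℝ) (z : ℂ) : ℂ :=
  exp ((-ν : ℝ) * I) * h z + exp (ν * I) * g z

lemma re_directionalPart (h g : ℂ → ℂ) (ν : ℝ) (z : ℂ) :
    (directionalPart h g ν z).re = (exp ((-ν : ℝ) * I) * harmonicMap h g z).re := by
  have h1 : exp ((-ν : ℝ) * I) = (starRingEnd ℂ) (exp (ν * I)) := by
    rw [← exp_conj, map_mul, conj_ofReal, conj_I]; push_cast; ring_nf
  rw [directionalPart, harmonicMap, mul_add, add_re, add_re, add_right_inj]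
  conv_rhs => rw [h1, ← map_mul, conj_re]

lemma differentiableOn_directionalPart (hh : DifferentiableOn ℂ h (ball 0 1))
    (hg : DifferentiableOn ℂ g (ball 0 1)) (ν : ℝ) :
    DifferentiableOn ℂ (directionalPart h g ν) (ball 0 1) :=
  (hh.const_mul _).add (hg.const_mul _)

lemma convex_re_mul_gt (e : ℂ) (c : ℝ) : Convex ℝ {w : ℂ | c < (e * w).re} :=
  convex_halfSpace_gt (f := fun w : ℂ => (e * w).re)
    ⟨fun x y => by simp [mul_add], fun a x => by simp; ring⟩ c

lemma convex_re_mul_lt (e : ℂ) (c : ℝ) : Convex ℝ {w : ℂ | (e * w).re < c} :=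
  convex_halfSpace_lt (f := fun w : ℂ => (e * w).re)
    ⟨fun x y => by simp [mul_add], fun a x => by simp; ring⟩ c

/-- Inserts a compact convex set between a compact and an open convex set: hulls of finite sets are
compact, and local ones combine by compactness. -/
lemma exists_finite_subset_interior_convexHull {Ω L : Set ℂ} (hΩ : IsOpen Ω) (hL : IsCompact L)
    (hLΩ : L ⊆ Ω) : ∃ t : Set ℂ, t.Finite ∧ t ⊆ Ω ∧ L ⊆ interior (convexHull ℝ t) := by
  refine hL.induction_on (p := fun L => ∃ t : Set ℂ, t.Finite ∧ t ⊆ Ω ∧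
    L ⊆ interior (convexHull ℝ t)) ⟨∅, by simp⟩ ?_ ?_ ?_
  · rintro s s' hs ⟨t, h1, h2, h3⟩
    exact ⟨t, h1, h2, hs.trans h3⟩
  · rintro s s' ⟨t, h1, h2, h3⟩ ⟨t', h1', h2', h3'⟩
    exact ⟨t ∪ t', h1.union h1', union_subset h2 h2', union_subset
      (h3.trans (interior_mono (convexHull_mono subset_union_left)))
      (h3'.trans (interior_mono (convexHull_mono subset_union_right)))⟩
  · intro w hw
    obtain ⟨u, hu1, hu2⟩ := (convex_singleton w).exists_subset_interior_convexHull_finset_of_isCompact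
      isCompact_singleton (t := Ω) (by simpa using hΩ.mem_nhds (hLΩ hw))
    exact ⟨_, mem_nhdsWithin_of_mem_nhds (isOpen_interior.mem_nhds (hu1 rfl)), u, u.finite_toSet,
      (subset_convexHull ℝ _).trans hu2, Subset.rfl⟩

/-- Restriction of a convex harmonic mapping to the preimage of a smaller convex domain,
parametrized by the disk. -/
lemma exists_riemannMap_diskField (hh : DifferentiableOn ℂ h (ball 0 1))
    (hg : DifferentiableOn ℂ g (ball 0 1))
    (hsp : ∀ z ∈ ball (0 : ℂ) 1, ‖deriv g z‖ < ‖deriv h z‖)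
    (hinj : InjOn (harmonicMap h g) (ball 0 1))
    (hconv : Convex ℝ (harmonicMap h g '' ball 0 1)) (ν : ℝ) {r : ℝ} (hr : r ∈ Ioo (0 : ℝ) 1) :
    ∃ φ : ℂ → ℂ, DifferentiableOn ℂ φ (ball 0 1) ∧ MapsTo φ (ball 0 1) (ball 0 1) ∧ φ 0 = 0 ∧
      (∃ ρ : ℝ, ρ ∈ Icc r 1 ∧ deriv φ 0 = ρ) ∧ ∃ c₀ ∈ Icc (-2 : ℝ) 2, ∃ c : ℂ, ‖c‖ = 1 ∧
        ∀ z ∈ ball (0 : ℂ) 1,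
          0 ≤ (I * (deriv (directionalPart h g ν) (φ z) * deriv φ z) * diskField c₀ c z).re := by
  set f := harmonicMap h g with hf
  have hfc : ContinuousOn f (ball 0 1) := continuousOn_harmonicMap hh hg
  obtain ⟨k, hkf, hkc⟩ := exists_inverse_harmonicMap hh hg hsp hinj
  have hcb : closedBall (0 : ℂ) r ⊆ ball 0 1 := closedBall_subset_ball hr.2
  have hΩo : IsOpen (f '' ball 0 1) := by
    refine isOpen_iff_mem_nhds.2 ?_
    rintro _ ⟨z, hz, rfl⟩
    rw [← map_nhds_harmonicMap hh hg hsp hz]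
    exact image_mem_map (isOpen_ball.mem_nhds hz)
  -- The image may be unbounded. The polygon `K` lies compactly inside it, so the preimage of `K` is
  -- compact in the disk; there `q₀` is bounded, and radial limits of `φ` give radial limits of `q`.
  obtain ⟨t, htf, htΩ, htO⟩ := exists_finite_subset_interior_convexHull hΩo
    ((isCompact_closedBall (0 : ℂ) r).image_of_continuousOn (hfc.mono hcb)) (image_mono hcb)
  set K := convexHull ℝ t with hKdef
  have hKc : IsCompact K := htf.isCompact_convexHull ℝ
  have hKΩ : K ⊆ f '' ball 0 1 := convexHull_min htΩ hconv
  have hkK : ∀ w ∈ f '' ball 0 1, k w ∈ ball (0 : ℂ) 1 ∧ f (k w) = w := by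
    rintro _ ⟨z, hz, rfl⟩
    rw [hkf z hz]; exact ⟨hz, rfl⟩
  set O := interior K with hO
  have hOK : O ⊆ K := interior_subset
  have hOc : Convex ℝ O := (convex_convexHull ℝ _).interior
  set U := ball (0 : ℂ) 1 ∩ f ⁻¹' O with hU
  have hUo : IsOpen U := hfc.isOpen_inter_preimage isOpen_ball isOpen_interior
  have hrU : ball 0 r ⊆ U := by
    intro z hz
    have hz1 : z ∈ ball (0 : ℂ) 1 := hcb (ball_subset_closedBall hz)
    exact ⟨hz1, htO (mem_image_of_mem f (ball_subset_closedBall hz))⟩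
  have h0U : (0 : ℂ) ∈ U := hrU (by simpa using hr.1)
  have hkO : MapsTo k O U := fun w hw =>
    ⟨(hkK w (hKΩ (hOK hw))).1, by rw [mem_preimage, (hkK w (hKΩ (hOK hw))).2]; exact hw⟩
  have hUs : IsSimplyConnected U := isSimplyConnected_of_leftInverse (f := f) (k := k) hOc
    ⟨f 0, h0U.2⟩ (hkc.mono (hOK.trans hKΩ)) hkO (hfc.mono inter_subset_left) (fun z hz => hz.2)
    (fun w hw => (hkK w (hKΩ (hOK hw))).2) (fun z hz => hkf z hz.1)
  obtain ⟨φ, ψ, hφ, hψ, hφU, hψm, hψφ, hφψ, hφ0, hψ0, ρ, hρ, hψρ⟩ :=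
    exists_riemannMap hUo hUs h0U inter_subset_left
  have hφm : MapsTo φ (ball 0 1) (ball 0 1) := fun z hz => (hφU hz).1
  have hφinj : InjOn φ (ball 0 1) := hψφ.injOn
  have h0b : (0 : ℂ) ∈ ball (0 : ℂ) 1 := by simp
  have hφd : ∀ z ∈ ball (0 : ℂ) 1, HasDerivAt φ (deriv φ z) z := fun z hz =>
    (hφ.differentiableAt (isOpen_ball.mem_nhds hz)).hasDerivAt
  have hchain : deriv ψ 0 * deriv φ 0 = 1 := by
    have h1 : HasDerivAt ψ (deriv ψ 0) (φ 0) := by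
      rw [hφ0]; exact (hψ.differentiableAt (hUo.mem_nhds h0U)).hasDerivAt
    have h2 := (h1.comp 0 (hφd 0 h0b)).deriv
    have h3 : deriv (ψ ∘ φ) 0 = 1 := by
      have : ψ ∘ φ =ᶠ[𝓝 0] id := by
        filter_upwards [isOpen_ball.mem_nhds h0b] with z hz using hψφ hz
      rw [this.deriv_eq, deriv_id]
    rw [← h2, h3]
  have hderiv0 : deriv φ 0 = ((ρ⁻¹ : ℝ) : ℂ) := by
    rw [hψρ] at hchain
    have : (ρ : ℂ) ≠ 0 := by exact_mod_cast hρ.ne'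
    push_cast
    field_simp
    linear_combination hchain
  -- The Schwarz lemma for `ψ` on the ball of radius `r` and for `φ` on the disk squeezes `φ' 0`
  -- between `r` and `1`.
  have hρ1 : ρ ≤ 1 / r := by
    have := norm_deriv_le_div_of_mapsTo_ball (hψ.mono hrU) (fun z hz => by
      rw [hψ0]; exact ball_subset_closedBall (hψm (hrU hz))) hr.1
    rwa [hψρ, norm_real, Real.norm_of_nonneg hρ.le] at this
  have hρ2 : ρ⁻¹ ≤ 1 := by
    have := norm_deriv_le_one_of_mapsTo_ball hφ (fun z hz => by
      rw [hφ0]; exact ball_subset_closedBall (hφm hz)) one_pos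
    rwa [hderiv0, norm_real, Real.norm_of_nonneg (inv_nonneg.2 hρ.le)] at this
  have hρ3 : r ≤ ρ⁻¹ := by
    rw [le_inv_comm₀ hr.1 hρ]; simpa using hρ1
  set q₀ := directionalPart h g ν with hq₀
  have hq₀d : DifferentiableOn ℂ q₀ (ball 0 1) := differentiableOn_directionalPart hh hg ν
  set q : ℂ → ℂ := fun z => q₀ (φ z) with hq
  have hqd : DifferentiableOn ℂ q (ball 0 1) := hq₀d.comp hφ hφm
  have hkKc : IsCompact (k '' K) := hKc.image_of_continuousOn (hkc.mono hKΩ)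
  have hkKb : k '' K ⊆ ball 0 1 := by
    rintro _ ⟨w, hw, rfl⟩
    exact (hkK w (hKΩ hw)).1
  have hφK : ∀ z ∈ ball (0 : ℂ) 1, φ z ∈ k '' K := fun z hz =>
    ⟨f (φ z), hOK (hφU hz).2, hkf _ (hφm hz)⟩
  obtain ⟨M, hM⟩ := hkKc.exists_bound_of_continuousOn (hq₀d.continuousOn.mono hkKb)
  have hlim : ∀ᵐ t : ℝ, ∃ y, Tendsto (fun r : ℝ => q (r * exp (t * I))) (𝓝[<] 1) (𝓝 y) := by
    filter_upwards [ae_exists_radial_limit hφ hφinj hφm] with t ⟨y, hy⟩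
    have hyK : y ∈ k '' K := by
      refine hkKc.isClosed.mem_of_tendsto hy ?_
      filter_upwards [Ioo_zero_one_mem_nhdsLT] with r hr using hφK _ (radial_mem_ball hr t)
    exact ⟨q₀ y, ((hq₀d.continuousOn.continuousAt (isOpen_ball.mem_nhds (hkKb hyK))).tendsto).comp hy⟩
  -- Segments in the convex set `O ∩ H` pull back through `k` and `ψ` to paths in the level domains.
  have hjoin : ∀ H : Set ℂ, Convex ℝ H → ∀ x ∈ ball (0 : ℂ) 1 ∩ (fun z => f (φ z)) ⁻¹' H,
      ∀ y ∈ ball (0 : ℂ) 1 ∩ (fun z => f (φ z)) ⁻¹' H,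
      JoinedIn (ball (0 : ℂ) 1 ∩ (fun z => f (φ z)) ⁻¹' H) x y := by
    intro H hH x hx y hy
    have h1 : JoinedIn (O ∩ H) (f (φ x)) (f (φ y)) := JoinedIn.of_segment_subset
      ((hOc.inter hH).segment_subset ⟨(hφU hx.1).2, hx.2⟩ ⟨(hφU hy.1).2, hy.2⟩)
    have hc : ContinuousOn (fun w => ψ (k w)) (O ∩ H) :=
      hψ.continuousOn.comp ((hkc.mono (hOK.trans hKΩ)).mono inter_subset_left)
        (fun w hw => hkO hw.1)
    have h2 := h1.map_continuousOn hc
    rw [hkf _ (hφm hx.1), hkf _ (hφm hy.1), hψφ hx.1, hψφ hy.1] at h2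
    refine h2.mono ?_
    rintro _ ⟨w, hw, rfl⟩
    refine ⟨hψm (hkO hw.1), ?_⟩
    simp only [mem_preimage]
    rw [hφψ (hkO hw.1), (hkK w (hKΩ (hOK hw.1))).2]
    exact hw.2
  have hre : ∀ z, (q z).re = (exp ((-ν : ℝ) * I) * f (φ z)).re := fun z => re_directionalPart h g ν _
  obtain ⟨c₀, hc₀, c, hc, hpos⟩ := exists_diskField_of_joinedIn_levels hqd
    (fun z hz => hM _ (hφK z hz)) hlim
    (fun c => by simp only [hre]; exact hjoin _ (convex_re_mul_gt _ c))
    (fun c => by simp only [hre]; exact hjoin _ (convex_re_mul_lt _ c))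
  refine ⟨φ, hφ, hφm, hφ0, ⟨ρ⁻¹, ⟨hρ3, hρ2⟩, hderiv0⟩, c₀, hc₀, c, hc, fun z hz => ?_⟩
  have hqz : deriv q z = deriv q₀ (φ z) * deriv φ z :=
    ((hq₀d.differentiableAt (isOpen_ball.mem_nhds (hφm hz))).hasDerivAt.comp z (hφd z hz)).deriv
  rw [← hqz]
  exact hpos z hz

/-- Every component of a convex harmonic mapping increases along a one-parameter group of
automorphisms of the disk. -/
theorem exists_diskField_directionalPart (hh : DifferentiableOn ℂ h (ball 0 1))
    (hg : DifferentiableOn ℂ g (ball 0 1))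
    (hsp : ∀ z ∈ ball (0 : ℂ) 1, ‖deriv g z‖ < ‖deriv h z‖)
    (hinj : InjOn (harmonicMap h g) (ball 0 1))
    (hconv : Convex ℝ (harmonicMap h g '' ball 0 1)) (ν : ℝ) :
    ∃ c₀ ∈ Icc (-2 : ℝ) 2, ∃ c : ℂ, ‖c‖ = 1 ∧ ∀ z ∈ ball (0 : ℂ) 1,
      0 ≤ (I * deriv (directionalPart h g ν) z * diskField c₀ c z).re := by
  have hu : Tendsto (fun n : ℕ => 1 - 1 / ((n : ℝ) + 2)) atTop (𝓝 1) := by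
    have h1 : Tendsto (fun n : ℕ => 1 / ((n : ℝ) + 2)) atTop (𝓝 0) :=
      tendsto_const_nhds.div_atTop (tendsto_atTop_add_const_right _ _ tendsto_natCast_atTop_atTop)
    simpa using tendsto_const_nhds.sub h1
  have hr : ∀ n : ℕ, 1 - 1 / ((n : ℝ) + 2) ∈ Ioo (0 : ℝ) 1 := fun n => by
    have h1 : 1 / ((n : ℝ) + 2) < 1 := by
      rw [div_lt_one (by positivity)]; linarith [n.cast_nonneg (α := ℝ)]
    have h2 : 0 < 1 / ((n : ℝ) + 2) := by positivity
    constructor <;> linarith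
  choose φ hφ hφm hφ0 ρ hfield using fun n =>
    exists_riemannMap_diskField hh hg hsp hinj hconv ν (hr n)
  choose ρ hρ hφd using ρ
  set 𝒰 : Ultrafilter ℕ := Filter.hyperfilter ℕ
  have hρ1 : Tendsto ρ atTop (𝓝 1) := tendsto_of_tendsto_of_tendsto_of_le_of_le hu
    tendsto_const_nhds (fun n => (hρ n).1) (fun n => (hρ n).2)
  have hlim := tendsto_id_of_tendsto_deriv_zero 𝒰 hφ hφm hφ0 (by
    simp only [hφd]
    have := (continuous_ofReal.tendsto 1).comp hρ1
    rw [ofReal_one] at this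
    exact this.mono_left Nat.hyperfilter_le_atTop)
  have hqd := (differentiableOn_directionalPart hh hg ν).deriv isOpen_ball
  -- The Riemann maps tend to the identity with derivative `1`, so the inequality survives in the
  -- limit for `directionalPart` itself.
  refine exists_diskField_of_tendsto (l := (𝒰 : Filter ℕ)) (fun z hz => ?_) isCompact_Icc hfield
  refine Tendsto.const_mul I ?_
  have h1 := ((hqd.continuousOn.continuousAt (isOpen_ball.mem_nhds hz)).tendsto.comp (hlim z hz).1).mul
    (hlim z hz).2
  rwa [mul_one] at h1

end HarmonicMap

/-! ### Elimination of the rotational part -/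

lemma diskField_combination (s t c₀ c₁ : ℝ) (c d z : ℂ) :
    diskField (s * c₀ + t * c₁) (s * c + t * d) z = s * diskField c₀ c z + t * diskField c₁ d z := by
  simp only [diskField, map_add, map_mul, conj_ofReal]; push_cast; ring

lemma exists_diskField_zero_of_ne_zero {p : ℂ → ℂ} {d : ℂ} (hd : d ≠ 0)
    (h : ∀ z ∈ ball (0 : ℂ) 1, 0 ≤ (p z * diskField 0 d z).re) :
    ∃ c : ℂ, ‖c‖ = 1 ∧ ∀ z ∈ ball (0 : ℂ) 1, 0 ≤ (p z * diskField 0 c z).re := by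
  have hd' : 0 < ‖d‖ := norm_pos_iff.2 hd
  refine ⟨((‖d‖⁻¹ : ℝ) : ℂ) * d, ?_, fun z hz => ?_⟩
  · rw [norm_mul, norm_real, Real.norm_of_nonneg (by positivity), inv_mul_cancel₀ hd'.ne']
  · have h1 := diskField_combination ‖d‖⁻¹ 0 0 0 d 0 z
    simp only [mul_zero, add_zero, ofReal_zero, zero_mul] at h1
    rw [h1, mul_left_comm, re_ofReal_mul]
    exact mul_nonneg (by positivity) (h z hz)

lemma eqOn_const_of_re_eq_zero {F : ℂ → ℂ} (hF : DifferentiableOn ℂ F (ball 0 1))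
    (h : ∀ z ∈ ball (0 : ℂ) 1, (F z).re = 0) : ∀ z ∈ ball (0 : ℂ) 1, F z = F 0 := by
  rcases (hF.analyticOnNhd isOpen_ball).is_constant_or_isOpen
    (convex_ball (0 : ℂ) 1).isPreconnected with ⟨w, hw⟩ | ho
  · intro z hz
    rw [hw z hz, hw 0 (by simp)]
  · exfalso
    have h0 : F 0 ∈ F '' ball 0 1 := mem_image_of_mem _ (by simp)
    have h1 : F '' ball 0 1 ⊆ {z : ℂ | z.re ≤ 0} := by
      rintro _ ⟨z, hz, rfl⟩
      exact (h z hz).le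
    have h2 := (ho _ Subset.rfl isOpen_ball).subset_interior_iff.2 h1 h0
    rw [interior_setOfPred_re_le] at h2
    exact absurd (h 0 (by simp)) (ne_of_lt h2)

/-- A field with a nonzero rotational part along which the real part is stationary can be replaced
by one without rotational part. -/
lemma exists_diskField_zero_of_re_eq_zero {p : ℂ → ℂ} (hp : DifferentiableOn ℂ p (ball 0 1))
    (hp0 : p 0 ≠ 0) {c₀ : ℝ} (hc₀ : c₀ ≠ 0) {c : ℂ} (hc : ‖c‖ = 1)
    (h : ∀ z ∈ ball (0 : ℂ) 1, (p z * diskField c₀ c z).re = 0) :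
    ∃ d : ℂ, ‖d‖ = 1 ∧ ∀ z ∈ ball (0 : ℂ) 1, 0 ≤ (p z * diskField 0 d z).re := by
  have hc1 : c ≠ 0 := norm_ne_zero_iff.1 (by rw [hc]; exact one_ne_zero)
  have hcc : c * (starRingEnd ℂ) c = 1 := by
    rw [mul_conj, normSq_eq_norm_sq, hc]; simp
  have hcn : ‖(starRingEnd ℂ) c‖ = 1 := by rw [norm_conj, hc]
  have hcc0 : (starRingEnd ℂ) c ≠ 0 := norm_ne_zero_iff.1 (by rw [hcn]; exact one_ne_zero)
  -- The product `p V` has zero real part, so it is constant, and it is nonzero at `0`. Thus `V` has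
  -- no zero in the disk; its roots have product of modulus one, so both lie on the circle.
  have hconst := eqOn_const_of_re_eq_zero (F := fun z => p z * diskField c₀ c z)
    (hp.mul (by unfold diskField; fun_prop)) h
  have hF0 : p 0 * diskField c₀ c 0 ≠ 0 := mul_ne_zero hp0 (by simpa [diskField] using hc1)
  have hQ : ∀ z, diskField c₀ c z = 0 → 1 ≤ ‖z‖ := by
    intro z hz
    by_contra! hlt
    have := hconst z (by simpa using hlt)
    rw [hz, mul_zero] at this
    exact hF0 this.symm
  obtain ⟨a, ha⟩ : ∃ a, diskField c₀ c a = 0 := by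
    obtain ⟨s, hs⟩ := IsAlgClosed.exists_pow_nat_eq ((c₀ : ℂ) ^ 2 - 4) (n := 2) two_pos
    refine ⟨c * ((s - c₀) / 2), ?_⟩
    rw [diskField]
    linear_combination (c * ((s - c₀) / 2) ^ 2) * hcc + c / 4 * hs
  have ha1 := hQ a ha
  have ha0 : a ≠ 0 := norm_pos_iff.1 (by linarith)
  set b := c ^ 2 / a with hb
  have hab : a * b = c ^ 2 := by rw [hb]; field_simp
  have hsum : a + b = -c₀ * c := by
    have h1 : (starRingEnd ℂ) c * a * (a + b + c₀ * c) = 0 := by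
      rw [diskField] at ha
      linear_combination ha + (c₀ * a + c) * hcc + (starRingEnd ℂ) c * hab
    have h2 := (mul_eq_zero.1 h1).resolve_left (mul_ne_zero hcc0 ha0)
    linear_combination h2
  have hfac : ∀ z, diskField c₀ c z = (starRingEnd ℂ) c * ((z - a) * (z - b)) := by
    intro z
    rw [diskField]
    linear_combination (-c - c₀ * z) * hcc - (starRingEnd ℂ) c * hab
      + (starRingEnd ℂ) c * z * hsum
  have hb1 := hQ b (by rw [hfac]; ring)
  have hnab : ‖a‖ * ‖b‖ = 1 := by rw [← norm_mul, hab, norm_pow, hc, one_pow]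
  have ha2 : ‖a‖ = 1 := by nlinarith
  have hb2 : ‖b‖ = 1 := by rw [ha2, one_mul] at hnab; exact hnab
  have haa : a * (starRingEnd ℂ) a = 1 := by
    rw [mul_conj, normSq_eq_norm_sq, ha2]; simp
  have hbb : b * (starRingEnd ℂ) b = 1 := by
    rw [mul_conj, normSq_eq_norm_sq, hb2]; simp
  set κ : ℝ := (p 0 * diskField c₀ c 0).im
  have hκ : ∀ z ∈ ball (0 : ℂ) 1, p z * diskField c₀ c z = κ * I := by
    intro z hz
    rw [hconst z hz]
    exact Complex.ext (by simpa using h 0 (by simp)) (by simp [κ])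
  -- Multiplying `V` by `i s (a + z)/(a - z)` cancels the root `a` and gives another field of the
  -- family, since `e` is real. Its product with `p` is `-sκ` times the Herglotz kernel at `a`, and
  -- `s` is chosen to make the factor nonnegative.
  obtain ⟨s, hs, hsκ⟩ : ∃ s : ℝ, s ≠ 0 ∧ 0 ≤ -s * κ := by
    rcases le_total 0 κ with hk | hk
    · exact ⟨-1, by norm_num, by linarith⟩
    · exact ⟨1, one_ne_zero, by linarith⟩
  obtain ⟨e, he⟩ : ∃ e : ℝ, -I * s * (starRingEnd ℂ) c * (a - b) = e := by
    refine conj_eq_iff_real.1 ?_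
    simp only [map_mul, map_sub, map_neg, conj_I, conj_ofReal, conj_conj]
    have h1 : c * ((starRingEnd ℂ) a - (starRingEnd ℂ) b) = (starRingEnd ℂ) c * (b - a) := by
      have h2 : a * b * (c * ((starRingEnd ℂ) a - (starRingEnd ℂ) b)
          - (starRingEnd ℂ) c * (b - a)) = 0 := by
        linear_combination b * c * haa - a * c * hbb - (starRingEnd ℂ) c * (b - a) * hab
          - c * (b - a) * hcc
      exact sub_eq_zero.1 ((mul_eq_zero.1 h2).resolve_left
        (by rw [hab]; exact pow_ne_zero 2 hc1))
    linear_combination I * s * h1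
  have hT : ∀ z, ‖z‖ < 1 →
      diskField e (I * s * c) z = I * s * (diskField c₀ c z * ((a + z) / (a - z))) := by
    intro z hz
    have hne : a - z ≠ 0 := sub_ne_zero.2 fun h' => by rw [← h', ha2] at hz; exact lt_irrefl _ hz
    rw [hfac, diskField, ← he]
    simp only [map_mul, conj_I, conj_ofReal]
    field_simp
    linear_combination (-s * (a - z) * c) * hcc - s * (starRingEnd ℂ) c * (a - z) * hab
  -- Adding `-e/c₀` times the stationary field leaves the real part unchanged and removes the
  -- rotational part; the remaining coefficient is nonzero because `s ≠ 0`.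
  have hcoef : ((-e / c₀ : ℝ) : ℂ) * c + (1 : ℝ) * (I * s * c) ≠ 0 := by
    have h1 : ((-e / c₀ : ℝ) : ℂ) * c + (1 : ℝ) * (I * s * c) = (((-e / c₀ : ℝ) : ℂ) + s * I) * c := by
      push_cast; ring
    rw [h1]
    refine mul_ne_zero (fun h2 => hs ?_) hc1
    simpa using congrArg im h2
  refine exists_diskField_zero_of_ne_zero hcoef fun z hz => ?_
  have h1 := diskField_combination (-e / c₀) 1 c₀ e c (I * s * c) z
  rw [show -e / c₀ * c₀ + 1 * e = 0 by field_simp; ring] at h1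
  rw [h1, mul_add, mul_left_comm, add_re, re_ofReal_mul, h z hz, mul_zero, zero_add, ofReal_one,
    one_mul, hT z (by simpa using hz)]
  have h2 : p z * (I * s * (diskField c₀ c z * ((a + z) / (a - z))))
      = ((-s * κ : ℝ) : ℂ) * ((a + z) / (a - z)) := by
    have := hκ z hz
    push_cast
    linear_combination I * s * ((a + z) / (a - z)) * this + s * κ * ((a + z) / (a - z)) * I_sq
  rw [h2, re_ofReal_mul]
  exact mul_nonneg hsκ (re_add_div_sub_nonneg ha2 hz)

/-- Two fields with rotational parts of opposite signs can be combined into one without rotational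
part. -/
lemma exists_diskField_zero {p : ℂ → ℂ} (hp : DifferentiableOn ℂ p (ball 0 1))
    (hp0 : p 0 ≠ 0) {c₀ c₁ : ℝ} (hc₀ : 0 ≤ c₀) (hc₁ : c₁ ≤ 0) {c d : ℂ} (hc : ‖c‖ = 1)
    (hd : ‖d‖ = 1) (h : ∀ z ∈ ball (0 : ℂ) 1, 0 ≤ (p z * diskField c₀ c z).re)
    (h' : ∀ z ∈ ball (0 : ℂ) 1, 0 ≤ (p z * diskField c₁ d z).re) :
    ∃ c : ℂ, ‖c‖ = 1 ∧ ∀ z ∈ ball (0 : ℂ) 1, 0 ≤ (p z * diskField 0 c z).re := by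
  rcases hc₀.eq_or_lt with rfl | hc₀
  · exact ⟨c, hc, h⟩
  rcases hc₁.eq_or_lt with rfl | hc₁
  · exact ⟨d, hd, h'⟩
  -- The weights `-c₁` and `c₀` cancel the rotational parts. If everything cancels, the second field
  -- is the negative of the first, so the real part vanishes along both.
  by_cases he : ((-c₁ : ℝ) : ℂ) * c + c₀ * d = 0
  · have h1 : ((-c₁ : ℝ) : ℂ) * c = -(c₀ * d) := eq_neg_of_add_eq_zero_left he
    have h2 := congrArg norm h1
    rw [norm_neg, norm_mul, norm_mul, hc, hd, norm_real, norm_real, Real.norm_of_nonneg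
      (by linarith), Real.norm_of_nonneg hc₀.le, mul_one, mul_one] at h2
    rw [h2, ← mul_neg] at h1
    have h3 := mul_left_cancel₀ (by exact_mod_cast hc₀.ne') h1
    refine exists_diskField_zero_of_re_eq_zero hp hp0 hc₀.ne' hc fun z hz =>
      le_antisymm ?_ (h z hz)
    have h4 := h' z hz
    have h5 : diskField c₁ d z = -diskField c₀ c z := by
      rw [h3, ← h2, diskField, diskField]; push_cast; simp only [map_neg]; ring
    rw [h5, mul_neg, neg_re] at h4
    linarith
  · refine exists_diskField_zero_of_ne_zero he fun z hz => ?_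
    have h1 := diskField_combination (-c₁) c₀ c₀ c₁ c d z
    rw [show -c₁ * c₀ + c₀ * c₁ = 0 by ring] at h1
    rw [h1, mul_add, mul_left_comm, mul_left_comm (p z), add_re, re_ofReal_mul, re_ofReal_mul]
    exact add_nonneg (mul_nonneg (by linarith) (h z hz)) (mul_nonneg hc₀.le (h' z hz))

section DirectionalPart

variable {h g : ℂ → ℂ}

lemma deriv_directionalPart (hh : DifferentiableOn ℂ h (ball 0 1))
    (hg : DifferentiableOn ℂ g (ball 0 1)) (ν : ℝ) {z : ℂ} (hz : z ∈ ball (0 : ℂ) 1) :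
    deriv (directionalPart h g ν) z =
      exp ((-ν : ℝ) * I) * deriv h z + exp (ν * I) * deriv g z := by
  have h1 := (hh.differentiableAt (isOpen_ball.mem_nhds hz)).hasDerivAt
  have h2 := (hg.differentiableAt (isOpen_ball.mem_nhds hz)).hasDerivAt
  exact ((h1.const_mul _).add (h2.const_mul _)).deriv

lemma isClosed_diskField_directionalPart (hh : DifferentiableOn ℂ h (ball 0 1))
    (hg : DifferentiableOn ℂ g (ball 0 1)) {C : Set ℝ} (hC : IsCompact C) :
    IsClosed {ν : ℝ | ∃ c₀ ∈ C, ∃ c : ℂ, ‖c‖ = 1 ∧ ∀ z ∈ ball (0 : ℂ) 1,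
      0 ≤ (I * deriv (directionalPart h g ν) z * diskField c₀ c z).re} := by
  refine IsSeqClosed.isClosed fun u ν hu hlim => ?_
  refine exists_diskField_of_tendsto (l := (Filter.hyperfilter ℕ : Filter ℕ))
    (p := fun n z => I * deriv (directionalPart h g (u n)) z) (fun z hz => ?_) hC hu
  simp only [deriv_directionalPart hh hg _ hz]
  have hc : Continuous fun ν : ℝ =>
      I * (exp ((-ν : ℝ) * I) * deriv h z + exp (ν * I) * deriv g z) := by fun_prop
  exact ((hc.tendsto ν).comp hlim).mono_left Nat.hyperfilter_le_atTop

/-- Some component of a convex harmonic mapping increases along a one-parameter group of hyperbolic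
automorphisms of the disk whose axis passes through the origin. -/
theorem exists_diskField_zero_directionalPart (hh : DifferentiableOn ℂ h (ball 0 1))
    (hg : DifferentiableOn ℂ g (ball 0 1))
    (hsp : ∀ z ∈ ball (0 : ℂ) 1, ‖deriv g z‖ < ‖deriv h z‖)
    (hinj : InjOn (harmonicMap h g) (ball 0 1))
    (hconv : Convex ℝ (harmonicMap h g '' ball 0 1)) :
    ∃ ν : ℝ, ∃ c : ℂ, ‖c‖ = 1 ∧ ∀ z ∈ ball (0 : ℂ) 1,
      0 ≤ (I * deriv (directionalPart h g ν) z * diskField 0 c z).re := by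
  -- The directions with `c₀ ≥ 0` and those with `c₀ ≤ 0` form two closed sets covering `ℝ`. The
  -- shift `ν ↦ ν + π` negates the component and hence swaps them, so both are nonempty and, `ℝ`
  -- being connected, they meet.
  set E : Set ℝ → Set ℝ := fun C => {ν : ℝ | ∃ c₀ ∈ C, ∃ c : ℂ, ‖c‖ = 1 ∧ ∀ z ∈ ball (0 : ℂ) 1,
      0 ≤ (I * deriv (directionalPart h g ν) z * diskField c₀ c z).re} with hE
  have hcov : ∀ ν, ν ∈ E (Icc 0 2) ∪ E (Icc (-2) 0) := by
    intro ν
    obtain ⟨c₀, hc₀, c, hc, hpos⟩ := exists_diskField_directionalPart hh hg hsp hinj hconv ν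
    rcases le_total 0 c₀ with h0 | h0
    · exact Or.inl ⟨c₀, ⟨h0, hc₀.2⟩, c, hc, hpos⟩
    · exact Or.inr ⟨c₀, ⟨hc₀.1, h0⟩, c, hc, hpos⟩
  have hshift : ∀ ν, ν ∈ E (Icc (-2) 0) → ν + Real.pi ∈ E (Icc 0 2) := by
    rintro ν ⟨c₀, hc₀, c, hc, hpos⟩
    refine ⟨-c₀, ⟨by linarith [hc₀.2], by linarith [hc₀.1]⟩, -c, by rwa [norm_neg], fun z hz => ?_⟩
    have := hpos z hz
    rw [deriv_directionalPart hh hg _ hz] at this ⊢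
    have e1 : exp ((-(ν + Real.pi) : ℝ) * I) = -exp ((-ν : ℝ) * I) := by
      rw [← exp_sub_pi_mul_I]; congr 1; push_cast; ring
    have e2 : exp ((ν + Real.pi : ℝ) * I) = -exp (ν * I) := by
      rw [← exp_add_pi_mul_I]; congr 1; push_cast; ring
    rw [e1, e2]
    convert this using 2
    simp only [diskField, map_neg]; push_cast; ring
  have hshift' : ∀ ν, ν ∈ E (Icc 0 2) → ν + Real.pi ∈ E (Icc (-2) 0) := by
    rintro ν ⟨c₀, hc₀, c, hc, hpos⟩
    refine ⟨-c₀, ⟨by linarith [hc₀.2], by linarith [hc₀.1]⟩, -c, by rwa [norm_neg], fun z hz => ?_⟩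
    have := hpos z hz
    rw [deriv_directionalPart hh hg _ hz] at this ⊢
    have e1 : exp ((-(ν + Real.pi) : ℝ) * I) = -exp ((-ν : ℝ) * I) := by
      rw [← exp_sub_pi_mul_I]; congr 1; push_cast; ring
    have e2 : exp ((ν + Real.pi : ℝ) * I) = -exp (ν * I) := by
      rw [← exp_add_pi_mul_I]; congr 1; push_cast; ring
    rw [e1, e2]
    convert this using 2
    simp only [diskField, map_neg]; push_cast; ring
  have hne : (univ ∩ E (Icc 0 2)).Nonempty ∧ (univ ∩ E (Icc (-2) 0)).Nonempty := by
    simp only [univ_inter]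
    rcases hcov 0 with h0 | h0
    · exact ⟨⟨_, h0⟩, ⟨_, hshift' _ h0⟩⟩
    · exact ⟨⟨_, hshift _ h0⟩, ⟨_, h0⟩⟩
  obtain ⟨ν, -, ⟨c₀, hc₀, c, hc, hpos⟩, c₁, hc₁, d, hd, hpos'⟩ :=
    isPreconnected_closed_iff.1 isPreconnected_univ _ _
      (isClosed_diskField_directionalPart hh hg isCompact_Icc)
      (isClosed_diskField_directionalPart hh hg isCompact_Icc) (fun ν _ => hcov ν) hne.1 hne.2
  have h0b : (0 : ℂ) ∈ ball (0 : ℂ) 1 := by simp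
  refine ⟨ν, exists_diskField_zero
    (((differentiableOn_directionalPart hh hg ν).deriv isOpen_ball).const_mul I) ?_ hc₀.1 hc₁.2
    hc hd hpos hpos'⟩
  refine mul_ne_zero I_ne_zero ?_
  rw [deriv_directionalPart hh hg _ h0b]
  intro h0
  have h1 := congrArg norm (eq_neg_of_add_eq_zero_left h0)
  rw [norm_neg, norm_mul, norm_mul, norm_exp_ofReal_mul_I, norm_exp_ofReal_mul_I, one_mul,
    one_mul] at h1
  exact absurd h1 (hsp 0 h0b).ne'

end DirectionalPart

/-! ### Taylor coefficients and Carathéodory's inequality -/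

lemma analyticAt_zero_of_differentiableOn {u : ℂ → ℂ} (hu : DifferentiableOn ℂ u (ball 0 1)) :
    AnalyticAt ℂ u 0 :=
  hu.analyticAt (isOpen_ball.mem_nhds (by simp))

lemma hasSum_taylorCoeffZero {u : ℂ → ℂ} {R : ℝ} (hu : DifferentiableOn ℂ u (ball 0 R)) {z : ℂ}
    (hz : z ∈ ball (0 : ℂ) R) : HasSum (fun n => taylorCoeffZero u n * z ^ n) (u z) := by
  have h1 : (fun n => taylorCoeffZero u n * z ^ n) =
      fun n : ℕ => (n.factorial : ℂ)⁻¹ • (z - 0) ^ n • iteratedDeriv n u 0 := by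
    funext n
    rw [taylorCoeffZero, sub_zero, smul_eq_mul, smul_eq_mul]
    ring
  rw [h1]
  exact hasSum_taylorSeries_on_ball hu hz

lemma taylorCoeffZero_eq_of_hasSum {u : ℂ → ℂ} {a : ℕ → ℂ}
    (h : ∀ z ∈ ball (0 : ℂ) 1, HasSum (fun n => a n * z ^ n) (u z)) (n : ℕ) :
    taylorCoeffZero u n = a n := by
  have h1 : HasFPowerSeriesAt u (FormalMultilinearSeries.ofScalars ℂ a) 0 := by
    rw [hasFPowerSeriesAt_iff]
    filter_upwards [isOpen_ball.mem_nhds (show (0 : ℂ) ∈ ball (0 : ℂ) 1 by simp)] with z hz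
    simpa [FormalMultilinearSeries.coeff_ofScalars, mul_comm] using h z hz
  have h2 := h1.analyticAt.hasFPowerSeriesAt.eq_formalMultilinearSeries h1
  have h3 := congrArg (fun p => p.coeff n) h2
  simp only [FormalMultilinearSeries.coeff_ofScalars] at h3
  exact h3

lemma taylorCoeffZero_zero (u : ℂ → ℂ) : taylorCoeffZero u 0 = u 0 := by
  simp [taylorCoeffZero]

lemma taylorCoeffZero_one (u : ℂ → ℂ) : taylorCoeffZero u 1 = deriv u 0 := by
  simp [taylorCoeffZero]

lemma taylorCoeffZero_const_mul (u : ℂ → ℂ) (c : ℂ) (n : ℕ) :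
    taylorCoeffZero (fun z => c * u z) n = c * taylorCoeffZero u n := by
  rw [taylorCoeffZero, iteratedDeriv_const_mul_field, taylorCoeffZero, mul_div_assoc]

lemma taylorCoeffZero_deriv (u : ℂ → ℂ) (n : ℕ) :
    taylorCoeffZero (deriv u) n = (n + 1) * taylorCoeffZero u (n + 1) := by
  rw [taylorCoeffZero, taylorCoeffZero, iteratedDeriv_succ', Nat.factorial_succ]
  have h1 : ((n : ℂ) + 1) ≠ 0 := by exact_mod_cast n.succ_ne_zero
  have h2 : (n.factorial : ℂ) ≠ 0 := by exact_mod_cast n.factorial_ne_zero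
  push_cast
  field_simp

lemma taylorCoeffZero_const_sub {c : ℂ} {u : ℂ → ℂ} {n : ℕ} (hn : 0 < n) :
    taylorCoeffZero (fun z => c - u z) n = -taylorCoeffZero u n := by
  rw [taylorCoeffZero, iteratedDeriv_const_sub hn, taylorCoeffZero, iteratedDeriv_neg, neg_div]

lemma taylorCoeffZero_add {u v : ℂ → ℂ} (hu : DifferentiableOn ℂ u (ball 0 1))
    (hv : DifferentiableOn ℂ v (ball 0 1)) (n : ℕ) :
    taylorCoeffZero (fun z => u z + v z) n = taylorCoeffZero u n + taylorCoeffZero v n := by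
  rw [taylorCoeffZero, iteratedDeriv_fun_add (analyticAt_zero_of_differentiableOn hu).contDiffAt
    (analyticAt_zero_of_differentiableOn hv).contDiffAt, add_div]
  rfl

lemma taylorCoeffZero_mul {u v : ℂ → ℂ} (hu : DifferentiableOn ℂ u (ball 0 1))
    (hv : DifferentiableOn ℂ v (ball 0 1)) (n : ℕ) :
    taylorCoeffZero (fun z => u z * v z) n =
      ∑ i ∈ Finset.range (n + 1), taylorCoeffZero u i * taylorCoeffZero v (n - i) := by
  rw [taylorCoeffZero, iteratedDeriv_fun_mul (analyticAt_zero_of_differentiableOn hu).contDiffAt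
    (analyticAt_zero_of_differentiableOn hv).contDiffAt, Finset.sum_div]
  refine Finset.sum_congr rfl fun i hi => ?_
  have hi' : i ≤ n := Nat.lt_succ_iff.1 (Finset.mem_range.1 hi)
  have h1 : (n.factorial : ℂ) = n.choose i * i.factorial * (n - i).factorial := by
    exact_mod_cast (Nat.choose_mul_factorial_mul_factorial hi').symm
  have h2 : (i.factorial : ℂ) ≠ 0 := by exact_mod_cast i.factorial_ne_zero
  have h3 : ((n - i).factorial : ℂ) ≠ 0 := by exact_mod_cast (n - i).factorial_ne_zero
  have h4 : (n.choose i : ℂ) ≠ 0 := by exact_mod_cast (Nat.choose_pos hi').ne'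
  rw [taylorCoeffZero, taylorCoeffZero, h1]
  field_simp

lemma taylorCoeffZero_sq_mul {u : ℂ → ℂ} (hu : DifferentiableOn ℂ u (ball 0 1)) (n : ℕ) :
    taylorCoeffZero (fun z => z ^ 2 * u z) n = if 2 ≤ n then taylorCoeffZero u (n - 2) else 0 := by
  rw [taylorCoeffZero_mul (by fun_prop) hu]
  have h1 : ∀ i, taylorCoeffZero (fun z => z ^ 2) i = if i = 2 then 1 else 0 := by
    intro i
    refine taylorCoeffZero_eq_of_hasSum (a := fun i => if i = 2 then 1 else 0) (fun z _ => ?_) i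
    convert hasSum_ite_eq 2 (z ^ 2) using 2 with k
    split_ifs with hk <;> simp [hk]
  simp only [h1, ite_mul, one_mul, zero_mul, Finset.sum_ite_eq', Finset.mem_range]
  congr 1
  simp only [Order.lt_add_one_iff]

/-- Fourier coefficients of a holomorphic function on a circle. -/
lemma integral_mul_exp_neg_eq {u : ℂ → ℂ} (hu : DifferentiableOn ℂ u (ball 0 1)) {r : ℝ}
    (hr : r ∈ Ioo (0 : ℝ) 1) (k : ℕ) :
    ∫ θ in (0 : ℝ)..2 * Real.pi, u (circleMap 0 r θ) * exp (-(k * θ * I)) =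
      2 * Real.pi * r ^ k * taylorCoeffZero u k := by
  have h1 := DifferentiableOn.circleIntegral_one_div_sub_center_pow_smul (E := ℂ) hr.1 k
    (hu.mono (closedBall_subset_ball hr.2))
  have hr0 : (r : ℂ) ≠ 0 := by exact_mod_cast hr.1.ne'
  rw [circleIntegral] at h1
  have h2 : ∀ θ : ℝ, deriv (circleMap 0 r) θ • (1 / (circleMap 0 r θ - 0) ^ (k + 1)) •
      u (circleMap 0 r θ) = (I / r ^ k) * (u (circleMap 0 r θ) * exp (-(k * θ * I))) := by
    intro θ
    have h3 : circleMap 0 r θ ≠ 0 := by simpa using hr0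
    have h4 : (circleMap 0 r θ) ^ k = r ^ k * exp (k * θ * I) := by
      rw [circleMap, zero_add, mul_pow, ← exp_nat_mul]; ring_nf
    rw [deriv_circleMap, smul_eq_mul, smul_eq_mul, sub_zero, pow_succ, exp_neg]
    rw [h4]
    field_simp
  simp_rw [h2] at h1
  rw [intervalIntegral.integral_const_mul] at h1
  rw [taylorCoeffZero]
  rw [smul_eq_mul] at h1
  have h5 : (k.factorial : ℂ) ≠ 0 := by exact_mod_cast k.factorial_ne_zero
  field_simp at h1 ⊢
  linear_combination h1

/-- **Carathéodory's inequality** for holomorphic functions with nonnegative real part. -/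
lemma norm_taylorCoeffZero_le_of_re_nonneg {u : ℂ → ℂ} (hu : DifferentiableOn ℂ u (ball 0 1))
    (hre : ∀ z ∈ ball (0 : ℂ) 1, 0 ≤ (u z).re) {k : ℕ} (hk : 0 < k) :
    ‖taylorCoeffZero u k‖ ≤ 2 * (u 0).re := by
  have key : ∀ r ∈ Ioo (0 : ℝ) 1, r ^ k * ‖taylorCoeffZero u k‖ ≤ 2 * (u 0).re := by
    intro r hr
    have hmem : ∀ θ : ℝ, circleMap 0 r θ ∈ ball (0 : ℂ) 1 := fun θ => by
      simp [circleMap, abs_of_pos hr.1, hr.2]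
    have hcont : Continuous fun θ : ℝ => u (circleMap 0 r θ) :=
      hu.continuousOn.comp_continuous (continuous_circleMap 0 r) hmem
    have h0 : ∫ θ in (0 : ℝ)..2 * Real.pi, u (circleMap 0 r θ) = 2 * Real.pi * u 0 := by
      have := integral_mul_exp_neg_eq hu hr 0
      simpa [taylorCoeffZero_zero] using this
    have h1 := integral_mul_exp_neg_eq hu hr k
    -- A holomorphic function has no negative frequencies. The conjugate therefore adds nothing, and
    -- the coefficient becomes a Fourier coefficient of the nonnegative function `2 Re u`.
    have h2 : ∫ θ in (0 : ℝ)..2 * Real.pi, u (circleMap 0 r θ) * exp (k * θ * I) = 0 := by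
      have h3 := integral_mul_exp_neg_eq (u := fun z => z ^ k * u z)
        ((differentiableOn_pow k).mul hu) hr 0
      rw [taylorCoeffZero_zero, zero_pow hk.ne', zero_mul, mul_zero] at h3
      have h4 : ∀ θ : ℝ, circleMap 0 r θ ^ k * u (circleMap 0 r θ) * exp (-((0 : ℕ) * θ * I))
          = r ^ k * (u (circleMap 0 r θ) * exp (k * θ * I)) := by
        intro θ
        have : (circleMap 0 r θ) ^ k = r ^ k * exp (k * θ * I) := by
          rw [circleMap, zero_add, mul_pow, ← exp_nat_mul]; ring_nf
        rw [this]; simp; ring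
      simp_rw [h4] at h3
      rw [intervalIntegral.integral_const_mul] at h3
      exact (mul_eq_zero.1 h3).resolve_left (pow_ne_zero _ (by exact_mod_cast hr.1.ne'))
    have h5 : ∫ θ in (0 : ℝ)..2 * Real.pi,
        (starRingEnd ℂ) (u (circleMap 0 r θ)) * exp (-(k * θ * I)) = 0 := by
      have h6 : ∀ θ : ℝ, (starRingEnd ℂ) (u (circleMap 0 r θ)) * exp (-(k * θ * I)) =
          (starRingEnd ℂ) (u (circleMap 0 r θ) * exp (k * θ * I)) := by
        intro θ
        rw [map_mul, ← exp_conj]; simp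
      simp_rw [h6]
      rw [intervalIntegral.integral_of_le Real.two_pi_pos.le] at h2 ⊢
      rw [integral_conj, h2, map_zero]
    have h7 : ∫ θ in (0 : ℝ)..2 * Real.pi,
        ((2 * (u (circleMap 0 r θ)).re : ℝ) : ℂ) * exp (-(k * θ * I))
        = 2 * Real.pi * r ^ k * taylorCoeffZero u k := by
      have hadd := intervalIntegral.integral_add (μ := volume)
        (Continuous.intervalIntegrable (μ := volume) (show Continuous fun θ : ℝ =>
          u (circleMap 0 r θ) * exp (-(k * θ * I)) from hcont.mul (by fun_prop)) 0 (2 * Real.pi))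
        (Continuous.intervalIntegrable (μ := volume) (show Continuous fun θ : ℝ =>
          (starRingEnd ℂ) (u (circleMap 0 r θ)) * exp (-(k * θ * I)) from
          (continuous_conj.comp hcont).mul (by fun_prop)) 0 (2 * Real.pi))
      rw [h1, h5, add_zero] at hadd
      rw [← hadd]
      refine intervalIntegral.integral_congr fun θ _ => ?_
      rw [← add_mul, add_conj]
    have h8 : ‖∫ θ in (0 : ℝ)..2 * Real.pi,
        ((2 * (u (circleMap 0 r θ)).re : ℝ) : ℂ) * exp (-(k * θ * I))‖
        ≤ ∫ θ in (0 : ℝ)..2 * Real.pi, 2 * (u (circleMap 0 r θ)).re := by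
      refine (intervalIntegral.norm_integral_le_integral_norm Real.two_pi_pos.le).trans_eq ?_
      refine intervalIntegral.integral_congr fun θ _ => ?_
      have : -((k : ℂ) * θ * I) = ((-(k * θ) : ℝ) : ℂ) * I := by push_cast; ring
      rw [norm_mul, this, norm_exp_ofReal_mul_I, mul_one, norm_real, Real.norm_of_nonneg]
      exact mul_nonneg two_pos.le (hre _ (hmem θ))
    have h9 : ∫ θ in (0 : ℝ)..2 * Real.pi, 2 * (u (circleMap 0 r θ)).re
        = 2 * (2 * Real.pi * (u 0).re) := by
      rw [intervalIntegral.integral_const_mul]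
      congr 1
      have h10 := congrArg re h0
      rw [intervalIntegral.integral_of_le Real.two_pi_pos.le] at h10 ⊢
      have h11 := integral_re (𝕜 := ℂ) (μ := volume.restrict (Ioc 0 (2 * Real.pi)))
        (f := fun θ : ℝ => u (circleMap 0 r θ))
        ((intervalIntegrable_iff_integrableOn_Ioc_of_le Real.two_pi_pos.le).1
          (hcont.intervalIntegrable _ _))
      simp only [RCLike.re_eq_complex_re] at h11
      rw [h11, h10]
      simp
    rw [h7, h9, norm_mul, norm_mul, norm_mul, norm_pow, norm_real, norm_real,
      Real.norm_of_nonneg Real.pi_pos.le, Real.norm_of_nonneg hr.1.le] at h8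
    simp only [Complex.norm_ofNat] at h8
    nlinarith [Real.pi_pos]
  have hlim : Tendsto (fun r : ℝ => r ^ k * ‖taylorCoeffZero u k‖) (𝓝[<] 1)
      (𝓝 (1 ^ k * ‖taylorCoeffZero u k‖)) :=
    ((continuous_id.pow k).mul continuous_const).continuousWithinAt
  rw [one_pow, one_mul] at hlim
  refine le_of_tendsto hlim ?_
  filter_upwards [Ioo_zero_one_mem_nhdsLT] with r hr using key r hr

lemma sum_range_add_one_cast (n : ℕ) :
    ∑ i ∈ Finset.range n, ((i : ℝ) + 1) = n * (n + 1) / 2 := by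
  induction n with
  | zero => simp
  | succ n ih => rw [Finset.sum_range_succ, ih]; push_cast; ring

lemma norm_taylorCoeffZero_mul_le {u v : ℂ → ℂ} (hu : DifferentiableOn ℂ u (ball 0 1))
    (hv : DifferentiableOn ℂ v (ball 0 1)) (hu' : ∀ n, ‖taylorCoeffZero u n‖ ≤ n + 1)
    (hv' : ∀ n, ‖taylorCoeffZero v n‖ ≤ 1) (n : ℕ) :
    ‖taylorCoeffZero (fun z => u z * v z) n‖ ≤ (n + 1) * (n + 2) / 2 := by
  rw [taylorCoeffZero_mul hu hv]
  refine (norm_sum_le _ _).trans ?_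
  have h1 : ∑ i ∈ Finset.range (n + 1), ((i : ℝ) + 1) = (n + 1) * (n + 2) / 2 := by
    rw [sum_range_add_one_cast]; push_cast; ring
  rw [← h1]
  refine Finset.sum_le_sum fun i _ => ?_
  rw [norm_mul]
  calc _ ≤ ((i : ℝ) + 1) * 1 := mul_le_mul (hu' i) (hv' _) (norm_nonneg _) (by positivity)
    _ = _ := mul_one _

lemma norm_taylorCoeffZero_mul_le_of_zero {u v : ℂ → ℂ} (hu : DifferentiableOn ℂ u (ball 0 1))
    (hv : DifferentiableOn ℂ v (ball 0 1)) (hu' : ∀ n, ‖taylorCoeffZero u n‖ ≤ n + 1)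
    (hv' : ∀ n, ‖taylorCoeffZero v n‖ ≤ 1) (hv0 : v 0 = 0) (n : ℕ) :
    ‖taylorCoeffZero (fun z => u z * v z) n‖ ≤ n * (n + 1) / 2 := by
  rw [taylorCoeffZero_mul hu hv, Finset.sum_range_succ, Nat.sub_self, taylorCoeffZero_zero v, hv0,
    mul_zero, add_zero, ← sum_range_add_one_cast]
  refine (norm_sum_le _ _).trans (Finset.sum_le_sum fun i _ => ?_)
  rw [norm_mul]
  calc _ ≤ ((i : ℝ) + 1) * 1 := mul_le_mul (hu' i) (hv' _) (norm_nonneg _) (by positivity)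
    _ = _ := mul_one _

/-- Coefficient bounds for the derivative of a function increasing along a group of hyperbolic
automorphisms. -/
lemma norm_taylorCoeffZero_le_of_diskField {R : ℂ → ℂ} (hR : DifferentiableOn ℂ R (ball 0 1))
    (hR0 : ‖R 0‖ = 1) {c : ℂ} (hc : ‖c‖ = 1)
    (hre : ∀ z ∈ ball (0 : ℂ) 1, 0 ≤ (I * R z * diskField 0 c z).re) (n : ℕ) :
    ‖taylorCoeffZero R n‖ ≤ n + 1 := by
  have hP : DifferentiableOn ℂ (fun z => I * R z * diskField 0 c z) (ball 0 1) :=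
    (hR.const_mul I).mul (by unfold diskField; fun_prop)
  have hP0 : (I * R 0 * diskField 0 c 0).re ≤ 1 := by
    refine (re_le_norm _).trans_eq ?_
    simp [diskField, hR0, hc]
  have hcoef : ∀ k, taylorCoeffZero (fun z => I * R z * diskField 0 c z) k =
      I * (c * taylorCoeffZero R k) + (I * (starRingEnd ℂ) c) *
        (if 2 ≤ k then taylorCoeffZero R (k - 2) else 0) := by
    intro k
    have h1 : (fun z => I * R z * diskField 0 c z) =
        fun z => I * c * R z + I * (starRingEnd ℂ) c * (z ^ 2 * R z) := by
      funext z; rw [diskField]; push_cast; ring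
    have h2 : DifferentiableOn ℂ (fun z => z ^ 2 * R z) (ball 0 1) := (differentiableOn_pow 2).mul hR
    rw [h1, taylorCoeffZero_add (hR.const_mul _) (h2.const_mul _), taylorCoeffZero_const_mul,
      taylorCoeffZero_const_mul, taylorCoeffZero_sq_mul hR, mul_assoc]
  -- Carathéodory gives `|c Rₙ + conj c Rₙ₋₂| ≤ 2`, so the bound grows by two every two steps, from
  -- `|R₀| = 1` and `|R₁| ≤ 2`.
  induction n using Nat.strong_induction_on with
  | _ n ih =>
    rcases Nat.eq_zero_or_pos n with rfl | hn
    · rw [taylorCoeffZero_zero, hR0]; simp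
    have h1 := norm_taylorCoeffZero_le_of_re_nonneg hP hre hn
    rw [hcoef] at h1
    have h2 : ‖taylorCoeffZero R n‖ = ‖I * (c * taylorCoeffZero R n)‖ := by
      rw [norm_mul, norm_mul, hc, norm_I, one_mul, one_mul]
    by_cases h3 : 2 ≤ n
    · rw [if_pos h3] at h1
      have h4 := ih (n - 2) (by omega)
      have h5 : ‖I * (starRingEnd ℂ) c * taylorCoeffZero R (n - 2)‖ = ‖taylorCoeffZero R (n - 2)‖ := by
        rw [norm_mul, norm_mul, norm_conj, hc, norm_I, one_mul, one_mul]
      have h6 := norm_sub_le (I * (c * taylorCoeffZero R n) +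
        I * (starRingEnd ℂ) c * taylorCoeffZero R (n - 2))
        (I * (starRingEnd ℂ) c * taylorCoeffZero R (n - 2))
      rw [add_sub_cancel_right, ← h2, h5] at h6
      push_cast [h3] at h4
      linarith
    · rw [if_neg h3, mul_zero, add_zero, ← h2] at h1
      have : n = 1 := by omega
      subst this
      push_cast
      linarith

/-- Carathéodory's inequality for `v - 1/2`, whose value at `0` is `1/2`. -/
lemma norm_taylorCoeffZero_le_one_of_re {v : ℂ → ℂ} (hv : DifferentiableOn ℂ v (ball 0 1))
    (hv0 : v 0 = 1) (hre : ∀ z ∈ ball (0 : ℂ) 1, 1 / 2 ≤ (v z).re) (n : ℕ) :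
    ‖taylorCoeffZero v n‖ ≤ 1 := by
  rcases Nat.eq_zero_or_pos n with rfl | hn
  · rw [taylorCoeffZero_zero, hv0, norm_one]
  · have h1 := norm_taylorCoeffZero_le_of_re_nonneg (u := fun z => (-1 / 2) + v z)
      (hv.const_add _) (fun z hz => by
        have := hre z hz
        have e : ((-1 / 2 : ℂ)).re = -1 / 2 := by norm_num
        rw [add_re, e]; linarith) hn
    have e : ((-1 / 2 : ℂ) + 1).re = 1 / 2 := by norm_num
    rw [taylorCoeffZero_add (differentiableOn_const _) hv, hv0, e] at h1
    have h2 : taylorCoeffZero (fun _ : ℂ => (-1 / 2 : ℂ)) n = 0 := by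
      rw [taylorCoeffZero, iteratedDeriv_const, if_neg hn.ne', zero_div]
    rw [h2, zero_add] at h1
    linarith

/-! ### Coefficient bounds for convex harmonic mappings -/

section CoefficientBounds

variable {h g : ℂ → ℂ}

/-- The sharp coefficient bounds for convex harmonic mappings. -/
theorem IsHarmonicConvexZero.norm_taylorCoeffZero_le (hf : IsHarmonicConvexZero h g) (n : ℕ) :
    ‖taylorCoeffZero h (n + 1)‖ ≤ ((n : ℝ) + 2) / 2 ∧ ‖taylorCoeffZero g (n + 1)‖ ≤ (n : ℝ) / 2 := by
  have hh := hf.holo_h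
  have hg := hf.holo_g
  have hsp := hf.sense_preserving
  obtain ⟨ν, c, hc, hre⟩ := exists_diskField_zero_directionalPart hh hg hsp hf.univalent
    hf.convex_image
  have h0b : (0 : ℂ) ∈ ball (0 : ℂ) 1 := by simp
  set R := deriv (directionalPart h g ν) with hRdef
  have hRd : DifferentiableOn ℂ R (ball 0 1) :=
    (differentiableOn_directionalPart hh hg ν).deriv isOpen_ball
  have hRz : ∀ z ∈ ball (0 : ℂ) 1, R z = exp ((-ν : ℝ) * I) * deriv h z + exp (ν * I) * deriv g z :=
    fun z hz => deriv_directionalPart hh hg ν hz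
  have hexp : exp (ν * I) * exp ((-ν : ℝ) * I) = 1 := by
    rw [← Complex.exp_add]; simp
  have hn1 : ‖exp (ν * I)‖ = 1 := norm_exp_ofReal_mul_I ν
  have hn2 : ‖exp ((-ν : ℝ) * I)‖ = 1 := norm_exp_ofReal_mul_I (-ν)
  have hR0 : ‖R 0‖ = 1 := by
    rw [hRz 0 h0b, hf.deriv_h_zero, hf.deriv_g_zero, mul_one, mul_zero, add_zero, hn2]
  have hRne : ∀ z ∈ ball (0 : ℂ) 1, R z ≠ 0 := by
    intro z hz h0
    rw [hRz z hz] at h0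
    have h1 := congrArg norm (eq_neg_of_add_eq_zero_left h0)
    rw [norm_neg, norm_mul, norm_mul, hn1, hn2, one_mul, one_mul] at h1
    exact absurd h1 (hsp z hz).ne'
  have hRc := norm_taylorCoeffZero_le_of_diskField hRd hR0 hc hre
  have hhd : DifferentiableOn ℂ (deriv h) (ball 0 1) := hh.deriv isOpen_ball
  have hgd : DifferentiableOn ℂ (deriv g) (ball 0 1) := hg.deriv isOpen_ball
  -- `B` and `1 - B` are the shares of `h'` and `g'` in `R`. A quotient `x / (x + y)` with `|y| <
  -- |x|` has real part above `1/2`; and `1 - B` vanishes at `0` because `g' 0 = 0`, which saves one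
  -- term in the bound for `g`.
  set B : ℂ → ℂ := fun z => exp ((-ν : ℝ) * I) * deriv h z / R z with hB
  have hBd : DifferentiableOn ℂ B (ball 0 1) := (hhd.const_mul _).div hRd hRne
  have hB0 : B 0 = 1 := by
    have h1 := hRne 0 h0b
    have h2 := hRz 0 h0b
    rw [hf.deriv_g_zero, mul_zero, add_zero] at h2
    simp only [hB]
    rw [← h2, div_self h1]
  have hBre : ∀ z ∈ ball (0 : ℂ) 1, 1 / 2 ≤ (B z).re := by
    intro z hz
    set x := exp ((-ν : ℝ) * I) * deriv h z with hx
    set y := exp (ν * I) * deriv g z with hy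
    have hxy : ‖y‖ < ‖x‖ := by
      rw [hx, hy, norm_mul, norm_mul, hn1, hn2, one_mul, one_mul]; exact hsp z hz
    have hBz : B z = x / (x + y) := by simp only [hB]; rw [hRz z hz]
    have hne : x + y ≠ 0 := by rw [← hRz z hz]; exact hRne z hz
    have hpos : 0 < normSq (x + y) := normSq_pos.2 hne
    rw [hBz, div_re, ← add_div, div_le_div_iff₀ two_pos hpos]
    have hxy2 : normSq y < normSq x := by
      rw [normSq_eq_norm_sq, normSq_eq_norm_sq]
      exact pow_lt_pow_left₀ hxy (norm_nonneg _) two_ne_zero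
    simp only [normSq_apply, add_re, add_im] at hxy2 ⊢
    nlinarith
  have hBc := norm_taylorCoeffZero_le_one_of_re hBd hB0 hBre
  have hB'd : DifferentiableOn ℂ (fun z => 1 - B z) (ball 0 1) := hBd.const_sub 1
  have hB'c : ∀ k, ‖taylorCoeffZero (fun z => 1 - B z) k‖ ≤ 1 := by
    intro k
    rcases Nat.eq_zero_or_pos k with rfl | hk
    · rw [taylorCoeffZero_zero, hB0]; simp
    · rw [taylorCoeffZero_const_sub hk, norm_neg]; exact hBc k
  have hcongr : ∀ {u v : ℂ → ℂ}, (∀ z ∈ ball (0 : ℂ) 1, u z = v z) →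
      taylorCoeffZero u n = taylorCoeffZero v n := fun {u v} huv => by
    have : u =ᶠ[𝓝 0] v := by
      filter_upwards [isOpen_ball.mem_nhds h0b] with z hz using huv z hz
    rw [taylorCoeffZero, this.iteratedDeriv_eq, taylorCoeffZero]
  have hn0 : (0 : ℝ) < n + 1 := by positivity
  have hnn : ‖((n : ℂ) + 1)‖ = n + 1 := by
    rw [show ((n : ℂ) + 1) = ((n + 1 : ℕ) : ℂ) by push_cast; rfl, norm_natCast]; push_cast; rfl
  constructor
  · have h1 := taylorCoeffZero_deriv h n
    rw [hcongr (v := fun z => exp (ν * I) * (R z * B z)) (fun z hz => by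
      simp only [hB]
      rw [mul_div_cancel₀ _ (hRne z hz), ← mul_assoc, hexp, one_mul]),
      taylorCoeffZero_const_mul] at h1
    have h2 := norm_taylorCoeffZero_mul_le hRd hBd hRc hBc n
    have h3 := congrArg norm h1
    rw [norm_mul, norm_mul, hn1, one_mul, hnn] at h3
    rw [h3] at h2
    refine le_of_mul_le_mul_left (h2.trans_eq ?_) hn0
    ring
  · have h1 := taylorCoeffZero_deriv g n
    rw [hcongr (v := fun z => exp ((-ν : ℝ) * I) * (R z * (1 - B z))) (fun z hz => by
      have h2 := hRne z hz
      have h3 : R z * (1 - B z) = exp (ν * I) * deriv g z := by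
        simp only [hB]
        rw [mul_sub, mul_div_cancel₀ _ h2, hRz z hz]; ring
      rw [h3, ← mul_assoc, mul_comm (exp ((-ν : ℝ) * I)), hexp, one_mul]),
      taylorCoeffZero_const_mul] at h1
    have h2 := norm_taylorCoeffZero_mul_le_of_zero hRd hB'd hRc hB'c (by rw [hB0]; simp) n
    have h3 := congrArg norm h1
    rw [norm_mul, norm_mul, hn2, one_mul, hnn] at h3
    rw [h3] at h2
    refine le_of_mul_le_mul_left (h2.trans_eq ?_) hn0
    ring

end CoefficientBounds

/-! ### A coefficient condition for starlikeness -/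

lemma hasSum_iff_of_forall_eq {E : Type*} [AddCommMonoid E] [TopologicalSpace E] {u v : ℕ → E}
    (h : ∀ n, u n = v n) {s : E} : HasSum u s ↔ HasSum v s := by
  rw [funext h]

lemma differentiableOn_of_hasSum {u : ℂ → ℂ} {a : ℕ → ℂ} {R : ℝ}
    (h : ∀ z ∈ ball (0 : ℂ) R, HasSum (fun n => a n * z ^ n) (u z)) :
    DifferentiableOn ℂ u (ball 0 R) := by
  intro z hz
  obtain ⟨ρ, hρ1, hρ2⟩ := exists_between (mem_ball_zero_iff.1 hz)
  have hρ0 : 0 ≤ ρ := (norm_nonneg z).trans hρ1.le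
  have hs : Summable fun n => ‖a n‖ * ρ ^ n := by
    have := (h (ρ : ℂ) (by simpa [abs_of_nonneg hρ0] using hρ2)).summable.norm
    simpa [abs_of_nonneg hρ0] using this
  have h1 : DifferentiableOn ℂ (fun w => ∑' n, a n * w ^ n) (ball 0 ρ) := by
    refine differentiableOn_tsum_of_summable_norm hs (fun n => by fun_prop) isOpen_ball ?_
    intro n w hw
    rw [norm_mul, norm_pow]
    gcongr
    exact (mem_ball_zero_iff.1 hw).le
  have h2 : DifferentiableOn ℂ u (ball 0 ρ) := h1.congr fun w hw =>
    (h w (ball_subset_ball hρ2.le hw)).tsum_eq.symm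
  exact (h2.differentiableAt (isOpen_ball.mem_nhds (by simpa using hρ1))).differentiableWithinAt

lemma hasSum_mul_deriv {u : ℂ → ℂ} {a : ℕ → ℂ} {R : ℝ} (hR : 1 ≤ R)
    (h : ∀ z ∈ ball (0 : ℂ) R, HasSum (fun n => a n * z ^ n) (u z)) {z : ℂ}
    (hz : z ∈ ball (0 : ℂ) R) : HasSum (fun n : ℕ => (n : ℂ) * a n * z ^ n) (z * deriv u z) := by
  have h1 := hasSum_taylorCoeffZero ((differentiableOn_of_hasSum h).deriv isOpen_ball) hz
  have h2 : ∀ n, taylorCoeffZero u n = a n :=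
    taylorCoeffZero_eq_of_hasSum fun z hz => h z (ball_subset_ball hR hz)
  simp only [taylorCoeffZero_deriv, h2] at h1
  rw [← hasSum_nat_add_iff' 1]
  have h3 : z * deriv u z - ∑ i ∈ Finset.range 1, (i : ℂ) * a i * z ^ i = z * deriv u z := by simp
  rw [h3]
  exact (hasSum_iff_of_forall_eq fun n => by push_cast; ring).1 (h1.mul_left z)

/-- The operator `z d/dz + s` multiplies the `n`-th coefficient by `n + s`, nonnegative for `n ≥ 2`
when `s ≥ -2`; the linear term is split off and `|z|² ` is factored from the tail. -/
lemma norm_mul_deriv_add_le {u : ℂ → ℂ} {a : ℕ → ℂ}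
    (h : ∀ z ∈ ball (0 : ℂ) 1, HasSum (fun n => a n * z ^ n) (u z)) (ha0 : a 0 = 0)
    (h0 : Summable fun n => ‖a (n + 2)‖) (h1 : Summable fun n : ℕ => ((n : ℝ) + 2) * ‖a (n + 2)‖)
    {s : ℝ} (hs : -2 ≤ s) {z : ℂ} (hz : z ∈ ball (0 : ℂ) 1) :
    ‖z * deriv u z + s * u z - (1 + s) * a 1 * z‖ ≤
      ‖z‖ ^ 2 * (∑' n : ℕ, ((n : ℝ) + 2) * ‖a (n + 2)‖ + s * ∑' n, ‖a (n + 2)‖) := by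
  have hsum := (hasSum_mul_deriv le_rfl h hz).add ((h z hz).mul_left (s : ℂ))
  rw [← hasSum_nat_add_iff' 2] at hsum
  have he : z * deriv u z + s * u z - ∑ i ∈ Finset.range 2, ((i : ℂ) * a i * z ^ i + s * (a i * z ^ i))
      = z * deriv u z + s * u z - (1 + s) * a 1 * z := by
    simp [Finset.sum_range_succ, ha0]; ring
  rw [he] at hsum
  have hb := ((h1.hasSum).add (h0.hasSum.mul_left s)).mul_left (‖z‖ ^ 2)
  rw [← hsum.tsum_eq]
  refine tsum_of_norm_bounded hb fun n => ?_
  have h2 : ((n + 2 : ℕ) : ℂ) * a (n + 2) * z ^ (n + 2) + s * (a (n + 2) * z ^ (n + 2))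
      = ((n + 2 + s : ℝ) : ℂ) * a (n + 2) * (z ^ n * z ^ 2) := by push_cast; ring
  have h3 : (0 : ℝ) ≤ n + 2 + s := by linarith [n.cast_nonneg (α := ℝ)]
  rw [h2, norm_mul, norm_mul, norm_mul, norm_real, Real.norm_of_nonneg h3, norm_pow, norm_pow]
  have h4 : ‖z‖ ^ n ≤ 1 := pow_le_one₀ (norm_nonneg _) (mem_ball_zero_iff.1 hz).le
  calc (n + 2 + s) * ‖a (n + 2)‖ * (‖z‖ ^ n * ‖z‖ ^ 2)
      ≤ (n + 2 + s) * ‖a (n + 2)‖ * (1 * ‖z‖ ^ 2) := by gcongr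
    _ = _ := by ring

lemma hasDerivAt_circle_comp {u : ℂ → ℂ} (hu : DifferentiableOn ℂ u (ball 0 1)) {r θ : ℝ}
    (hz : circleMap 0 r θ ∈ ball (0 : ℂ) 1) :
    HasDerivAt (fun θ : ℝ => u (circleMap 0 r θ))
      (I * (circleMap 0 r θ * deriv u (circleMap 0 r θ))) θ := by
  have h1 := (hu.differentiableAt (isOpen_ball.mem_nhds hz)).hasDerivAt
  have h2 := HasDerivAt.scomp θ h1 (hasDerivAt_circleMap 0 r θ)
  exact h2.congr_deriv (by rw [smul_eq_mul]; ring)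

/-- The argument of a curve that stays close to a circle. -/
lemma exists_arg_of_norm_sub_lt {f A : ℝ → ℂ} {r α : ℝ} (hr : 0 < r)
    (hf : ∀ θ, HasDerivAt f (I * A θ) θ) (hfr : ∀ θ, ‖f θ - circleMap 0 r θ‖ < r)
    (hα : ∀ θ, α < (A θ / f θ).re) :
    ∃ φ : ℝ → ℝ, Differentiable ℝ φ ∧ ∀ θ : ℝ, f θ ≠ 0 ∧
      f θ = (‖f θ‖ : ℂ) * exp ((φ θ : ℂ) * I) ∧ α < deriv φ θ := by
  have hz0 : ∀ θ, circleMap 0 r θ ≠ 0 := fun θ => circleMap_ne_center hr.ne'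
  have hzn : ∀ θ, ‖circleMap 0 r θ‖ = r := fun θ => by simp [circleMap, abs_of_pos hr]
  have hre : ∀ θ, 0 < (f θ / circleMap 0 r θ).re := by
    intro θ
    have h1 : ‖f θ / circleMap 0 r θ - 1‖ < 1 := by
      rw [div_sub_one (hz0 θ), norm_div, hzn, div_lt_one hr]; exact hfr θ
    have h2 := (abs_lt.1 ((abs_re_le_norm _).trans_lt h1)).1
    rw [sub_re, one_re] at h2
    linarith
  have hf0 : ∀ θ, f θ ≠ 0 := fun θ h0 => by
    have := hre θ
    rw [h0, zero_div, zero_re] at this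
    exact lt_irrefl _ this
  -- The quotient `f / ζ` stays in the right half-plane, so its principal logarithm is smooth
  -- enough; `θ` plus its imaginary part is an argument of `f`.
  have hlog : ∀ θ, HasDerivAt (fun θ => log (f θ / circleMap 0 r θ)) (I * (A θ / f θ) - I) θ := by
    intro θ
    have h1 := ((hf θ).div (hasDerivAt_circleMap 0 r θ) (hz0 θ)).clog_real (Or.inl (hre θ))
    refine h1.congr_deriv ?_
    have := hz0 θ
    have := hf0 θ
    rw [Pi.div_apply]
    field_simp
  have hφ : ∀ θ, HasDerivAt (fun θ : ℝ => θ + (log (f θ / circleMap 0 r θ)).im) (A θ / f θ).re θ := by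
    intro θ
    have h1 := (hasDerivAt_id θ).add (imCLM.hasFDerivAt.comp_hasDerivAt θ (hlog θ))
    exact h1.congr_deriv (by simp)
  refine ⟨_, fun θ => (hφ θ).differentiableAt, fun θ => ⟨hf0 θ, ?_, by rw [(hφ θ).deriv]; exact hα θ⟩⟩
  have h1 := norm_mul_exp_arg_mul_I (f θ / circleMap 0 r θ)
  rw [eq_div_iff (hz0 θ), norm_div, hzn] at h1
  rw [log_im, ofReal_add, add_mul, Complex.exp_add]
  conv_lhs => rw [← h1]
  rw [circleMap, zero_add]
  have : (r : ℂ) ≠ 0 := by exact_mod_cast hr.ne'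
  push_cast
  field_simp

/-- A sufficient coefficient condition for harmonic starlikeness of order `α`. -/
theorem isHarmonicStarlike_of_tsum_le {H G : ℂ → ℂ} {a b : ℕ → ℂ} {α : ℝ} (hα0 : 0 ≤ α)
    (hα1 : α < 1) (hH : ∀ z ∈ ball (0 : ℂ) 1, HasSum (fun n => a n * z ^ n) (H z))
    (hG : ∀ z ∈ ball (0 : ℂ) 1, HasSum (fun n => b n * z ^ n) (G z))
    (ha0 : a 0 = 0) (ha1 : a 1 = 1) (hb0 : b 0 = 0) (hb1 : b 1 = 0)
    (hsa : Summable fun n : ℕ => ((n : ℝ) + 2) * ‖a (n + 2)‖)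
    (hsb : Summable fun n : ℕ => ((n : ℝ) + 2) * ‖b (n + 2)‖)
    (hle : ∑' n : ℕ, ((n : ℝ) + 2 - α) * ‖a (n + 2)‖ + ∑' n : ℕ, ((n : ℝ) + 2 + α) * ‖b (n + 2)‖
      ≤ 1 - α) : IsHarmonicStarlike α H G := by
  have hHd := differentiableOn_of_hasSum hH
  have hGd := differentiableOn_of_hasSum hG
  have hH' := taylorCoeffZero_eq_of_hasSum hH
  have hG' := taylorCoeffZero_eq_of_hasSum hG
  have hcmp : ∀ {c : ℕ → ℂ}, Summable (fun n : ℕ => ((n : ℝ) + 2) * ‖c (n + 2)‖) →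
      Summable (fun n => ‖c (n + 2)‖) ∧
      2 * ∑' n, ‖c (n + 2)‖ ≤ ∑' n : ℕ, ((n : ℝ) + 2) * ‖c (n + 2)‖ := by
    intro c hc
    have h1 : ∀ n : ℕ, 2 * ‖c (n + 2)‖ ≤ ((n : ℝ) + 2) * ‖c (n + 2)‖ := fun n =>
      mul_le_mul_of_nonneg_right (by linarith [n.cast_nonneg (α := ℝ)]) (norm_nonneg _)
    have h2 : Summable (fun n => 2 * ‖c (n + 2)‖) :=
      Summable.of_nonneg_of_le (fun n => by positivity) h1 hc
    refine ⟨(summable_mul_left_iff two_ne_zero).1 h2, ?_⟩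
    rw [← tsum_mul_left]
    exact h2.tsum_le_tsum h1 hc
  obtain ⟨hsa0, hca⟩ := hcmp hsa
  obtain ⟨hsb0, hcb⟩ := hcmp hsb
  have hea : ∑' n : ℕ, ((n : ℝ) + 2 - α) * ‖a (n + 2)‖ =
      ∑' n : ℕ, ((n : ℝ) + 2) * ‖a (n + 2)‖ - α * ∑' n, ‖a (n + 2)‖ := by
    rw [← tsum_mul_left, ← hsa.tsum_sub (hsa0.mul_left α)]
    exact tsum_congr fun n => by ring
  have heb : ∑' n : ℕ, ((n : ℝ) + 2 + α) * ‖b (n + 2)‖ =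
      ∑' n : ℕ, ((n : ℝ) + 2) * ‖b (n + 2)‖ + α * ∑' n, ‖b (n + 2)‖ := by
    rw [← tsum_mul_left, ← hsb.tsum_add (hsb0.mul_left α)]
    exact tsum_congr fun n => by ring
  rw [hea, heb] at hle
  have hpa : 0 ≤ ∑' n, ‖a (n + 2)‖ := tsum_nonneg fun _ => norm_nonneg _
  have hpb : 0 ≤ ∑' n, ‖b (n + 2)‖ := tsum_nonneg fun _ => norm_nonneg _
  have hdG : deriv G 0 = 0 := by rw [← taylorCoeffZero_one, hG', hb1]
  refine ⟨⟨hHd, hGd, ?_, ?_, ?_, ?_⟩, fun r hr0 hr1 => ?_⟩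
  · rw [← taylorCoeffZero_zero H, hH', ha0]
  · rw [← taylorCoeffZero_one, hH', ha1]
  · rw [← taylorCoeffZero_zero G, hG', hb0]
  · rw [hdG, norm_zero]; exact one_pos
  have hbound : ∀ {c : ℕ → ℂ} {u : ℂ → ℂ},
      (∀ z ∈ ball (0 : ℂ) 1, HasSum (fun n => c n * z ^ n) (u z)) → c 0 = 0 →
      Summable (fun n => ‖c (n + 2)‖) → ∀ z ∈ ball (0 : ℂ) 1,
      ‖u z - c 1 * z‖ ≤ ‖z‖ ^ 2 * ∑' n, ‖c (n + 2)‖ := by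
    intro c u hu hc0 hc z hz
    have h1 := hu z hz
    rw [← hasSum_nat_add_iff' 2] at h1
    have h2 : u z - ∑ i ∈ Finset.range 2, c i * z ^ i = u z - c 1 * z := by
      simp [Finset.sum_range_succ, hc0]
    rw [h2] at h1
    rw [← h1.tsum_eq]
    refine tsum_of_norm_bounded (hc.hasSum.mul_left (‖z‖ ^ 2)) fun n => ?_
    have h4 : ‖z‖ ^ n ≤ 1 := pow_le_one₀ (norm_nonneg _) (mem_ball_zero_iff.1 hz).le
    rw [pow_add, norm_mul, norm_mul, norm_pow, norm_pow]
    calc ‖c (n + 2)‖ * (‖z‖ ^ n * ‖z‖ ^ 2) ≤ ‖c (n + 2)‖ * (1 * ‖z‖ ^ 2) := by gcongr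
      _ = _ := by ring
  have hzn : ∀ θ, ‖circleMap 0 r θ‖ = r := fun θ => by simp [circleMap, abs_of_pos hr0]
  have hzb : ∀ θ, circleMap 0 r θ ∈ ball (0 : ℂ) 1 := fun θ => by
    rw [mem_ball_zero_iff, hzn]; exact hr1
  have hr2 : r ^ 2 < r := by nlinarith
  refine exists_arg_of_norm_sub_lt (A := fun θ => circleMap 0 r θ * deriv H (circleMap 0 r θ) -
    (starRingEnd ℂ) (circleMap 0 r θ * deriv G (circleMap 0 r θ))) hr0 (fun θ => ?_) (fun θ => ?_)
    (fun θ => ?_)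
  · have h1 := (hasDerivAt_circle_comp hHd (hzb θ)).add
      (conjCLE.toContinuousLinearMap.hasFDerivAt.comp_hasDerivAt θ
        (hasDerivAt_circle_comp hGd (hzb θ)))
    refine h1.congr_deriv ?_
    simp only [ContinuousLinearEquiv.coe_coe, conjCLE_apply, map_mul, conj_I]
    ring
  · have h1 := hbound hH ha0 hsa0 _ (hzb θ)
    have h2 := hbound hG hb0 hsb0 _ (hzb θ)
    rw [ha1, one_mul, hzn] at h1
    rw [hb1, zero_mul, sub_zero, hzn] at h2
    have h3 : harmonicMap H G (circleMap 0 r θ) - circleMap 0 r θ =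
        (H (circleMap 0 r θ) - circleMap 0 r θ) + (starRingEnd ℂ) (G (circleMap 0 r θ)) := by
      rw [harmonicMap]; ring
    rw [h3]
    refine (norm_add_le _ _).trans_lt ?_
    rw [norm_conj]
    have h4 : ∑' n, ‖a (n + 2)‖ + ∑' n, ‖b (n + 2)‖ ≤ 1 := by nlinarith
    nlinarith [sq_nonneg r]
  -- `Re (A / w) > α` says that `A / w` is closer to `1 + α` than to `-(1 - α)`; the proof compares
  -- `|A - (1 + α) w|` with `|A + (1 - α) w|`.
  · set z := circleMap 0 r θ with hz
    have n1 := norm_mul_deriv_add_le hH ha0 hsa0 hsa (s := -(1 + α)) (by linarith) (hzb θ)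
    have n2 := norm_mul_deriv_add_le hH ha0 hsa0 hsa (s := 1 - α) (by linarith) (hzb θ)
    have n3 := norm_mul_deriv_add_le hG hb0 hsb0 hsb (s := 1 + α) (by linarith) (hzb θ)
    have n4 := norm_mul_deriv_add_le hG hb0 hsb0 hsb (s := α - 1) (by linarith) (hzb θ)
    rw [← hz, hzn, ha1, mul_one] at n1 n2
    rw [← hz, hzn, hb1, mul_zero, zero_mul, sub_zero] at n3 n4
    set w := harmonicMap H G z with hw
    set A := z * deriv H z - (starRingEnd ℂ) (z * deriv G z) with hA
    have hznz : ‖z‖ = r := hzn θ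
    have m1 : ‖A - (1 + α) * w‖ ≤ α * r + ‖z * deriv H z + ((-(1 + α) : ℝ) : ℂ) * H z -
        (1 + ((-(1 + α) : ℝ) : ℂ)) * z‖ + ‖z * deriv G z + ((1 + α : ℝ) : ℂ) * G z‖ := by
      have e : A - (1 + α) * w = (-α * z + (z * deriv H z + ((-(1 + α) : ℝ) : ℂ) * H z -
        (1 + ((-(1 + α) : ℝ) : ℂ)) * z)) -
        (starRingEnd ℂ) (z * deriv G z + ((1 + α : ℝ) : ℂ) * G z) := by
        rw [hA, hw, harmonicMap]; simp only [map_add, map_mul, conj_ofReal]; push_cast; ring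
      rw [e]
      refine (norm_sub_le _ _).trans ?_
      rw [norm_conj]
      gcongr
      refine (norm_add_le _ _).trans_eq ?_
      rw [norm_mul, norm_neg, norm_real, Real.norm_of_nonneg hα0, hznz]
    have m2 : (2 - α) * r ≤ ‖A + (1 - α) * w‖ + ‖z * deriv H z + ((1 - α : ℝ) : ℂ) * H z -
        (1 + ((1 - α : ℝ) : ℂ)) * z‖ + ‖z * deriv G z + ((α - 1 : ℝ) : ℂ) * G z‖ := by
      have e : ((2 - α : ℝ) : ℂ) * z = ((A + (1 - α) * w) - (z * deriv H z + ((1 - α : ℝ) : ℂ) * H z -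
        (1 + ((1 - α : ℝ) : ℂ)) * z)) +
        (starRingEnd ℂ) (z * deriv G z + ((α - 1 : ℝ) : ℂ) * G z) := by
        rw [hA, hw, harmonicMap]; simp only [map_add, map_mul, conj_ofReal]; push_cast; ring
      have e2 : (2 - α) * r = ‖((2 - α : ℝ) : ℂ) * z‖ := by
        rw [norm_mul, norm_real, Real.norm_of_nonneg (by linarith), hznz]
      rw [e2, e]
      refine (norm_add_le _ _).trans ?_
      rw [norm_conj]
      gcongr
      exact norm_sub_le _ _
    have key : ‖A - (1 + α) * w‖ < ‖A + (1 - α) * w‖ := by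
      -- The leading terms `α r` and `(2 - α) r` leave a gap `2 (1 - α) r`, while the four error
      -- terms add up to at most `2 (1 - α) r²`.
      have h5 : r ^ 2 * (∑' n : ℕ, ((n : ℝ) + 2) * ‖a (n + 2)‖ - α * ∑' n, ‖a (n + 2)‖ +
        (∑' n : ℕ, ((n : ℝ) + 2) * ‖b (n + 2)‖ + α * ∑' n, ‖b (n + 2)‖)) ≤ r ^ 2 * (1 - α) :=
        mul_le_mul_of_nonneg_left hle (sq_nonneg r)
      have h6 : r ^ 2 * (1 - α) < r * (1 - α) := mul_lt_mul_of_pos_right hr2 (by linarith)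
      linarith
    have hsq : normSq (A - (1 + α) * w) < normSq (A + (1 - α) * w) := by
      rw [normSq_eq_norm_sq, normSq_eq_norm_sq]
      exact pow_lt_pow_left₀ key (norm_nonneg _) two_ne_zero
    have hexp : α * normSq w < A.re * w.re + A.im * w.im := by
      simp only [normSq_apply, add_re, add_im, sub_re, sub_im, mul_re, mul_im, one_re, one_im,
        ofReal_re, ofReal_im] at hsq ⊢
      nlinarith
    have hw0 : 0 < normSq w := normSq_pos.2 fun h0 => by
      rw [h0] at hexp; simp at hexp
    rw [div_re, ← add_div, lt_div_iff₀ hw0]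
    exact hexp

/-! ### The Wright function -/

/-- Keep only `M < t ≤ M + 1` in the Gamma integral. Growth like `M ^ x` for arbitrary `M` is enough
for the Wright series to converge everywhere. -/
lemma Real.rpow_mul_exp_le_Gamma {M x : ℝ} (hM : 1 ≤ M) (hx : 0 < x) :
    M ^ x * (Real.exp (-(M + 1)) / (M + 1)) ≤ Real.Gamma x := by
  have hM0 : 0 < M := by linarith
  rw [Real.Gamma_eq_integral hx]
  have hint := Real.GammaIntegral_convergent hx
  have hsub : Ioc M (M + 1) ⊆ Ioi 0 := fun t ht => hM0.trans ht.1
  have h1 : ∫ t in Ioc M (M + 1), M ^ x * (Real.exp (-(M + 1)) / (M + 1)) ≤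
      ∫ t in Ioc M (M + 1), Real.exp (-t) * t ^ (x - 1) := by
    refine setIntegral_mono_on (integrableOn_const (by simp)) (hint.mono_set hsub)
      measurableSet_Ioc fun t ht => ?_
    have ht0 : 0 < t := hM0.trans ht.1
    rw [Real.rpow_sub_one ht0.ne']
    calc M ^ x * (Real.exp (-(M + 1)) / (M + 1)) ≤ t ^ x * (Real.exp (-t) / t) := by
          gcongr
          · exact ht.1.le
          · exact ht.2
          · exact ht.2
      _ = _ := by ring
  rw [setIntegral_const, measureReal_def, Real.volume_Ioc] at h1
  have e : (ENNReal.ofReal (M + 1 - M)).toReal = 1 := by simp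
  rw [e, one_smul] at h1
  refine h1.trans (setIntegral_mono_set hint ?_ hsub.eventuallyLE)
  filter_upwards [ae_restrict_mem measurableSet_Ioi] with t ht
  have : (0 : ℝ) < t := ht
  simp only [Pi.zero_apply]
  positivity

/-- The coefficients of the Wright series decay faster than any geometric sequence. -/
lemma summable_wright {a b c d : ℝ} (ha : 0 < a) (hc : 0 < c) (hb : 0 ≤ b) (hd : 0 ≤ d)
    (hbd : 0 < b + d) {R : ℝ} (hR : 0 ≤ R) :
    Summable fun n : ℕ => R ^ n / (Real.Gamma (a + n * b) * Real.Gamma (c + n * d)) := by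
  -- With `M ^ (b + d) = 2R + 1` the denominators dominate a multiple of `(2R + 1)ⁿ`, and the ratio
  -- `R / (2R + 1)` is below `1` even for `R = 0`.
  set M : ℝ := (2 * R + 1) ^ (1 / (b + d)) with hMdef
  have hM : 1 ≤ M := Real.one_le_rpow (by linarith) (by positivity)
  have hM0 : 0 < M := by linarith
  have hMbd : M ^ (b + d) = 2 * R + 1 := by
    rw [hMdef, ← Real.rpow_mul (by linarith), one_div_mul_cancel hbd.ne', Real.rpow_one]
  set E := Real.exp (-(M + 1)) / (M + 1) with hE
  have hE0 : 0 < E := by positivity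
  have hlow : ∀ n : ℕ, M ^ a * M ^ c * E ^ 2 * (2 * R + 1) ^ n ≤
      Real.Gamma (a + n * b) * Real.Gamma (c + n * d) := by
    intro n
    have h1 := Real.rpow_mul_exp_le_Gamma hM (show 0 < a + n * b by positivity)
    have h2 := Real.rpow_mul_exp_le_Gamma hM (show 0 < c + n * d by positivity)
    refine le_trans (le_of_eq ?_) (mul_le_mul h1 h2 (by positivity)
      (Real.Gamma_pos_of_pos (by positivity)).le)
    rw [← hMbd, ← Real.rpow_mul_natCast hM0.le, Real.rpow_add hM0, Real.rpow_add hM0]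
    have h3 : M ^ ((b + d) * n) = M ^ (n * b) * M ^ (n * d) := by
      rw [← Real.rpow_add hM0]; ring_nf
    rw [h3]; ring
  have hgeo : Summable fun n : ℕ => 1 / (M ^ a * M ^ c * E ^ 2) * (R / (2 * R + 1)) ^ n := by
    refine (summable_geometric_of_lt_one (by positivity) ?_).mul_left _
    rw [div_lt_one (by linarith)]; linarith
  refine Summable.of_nonneg_of_le (fun n => ?_) (fun n => ?_) hgeo
  · have h1 := Real.Gamma_pos_of_pos (show 0 < a + n * b by positivity)
    have h2 := Real.Gamma_pos_of_pos (show 0 < c + n * d by positivity)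
    positivity
  · have h1 : 1 / (M ^ a * M ^ c * E ^ 2) * (R / (2 * R + 1)) ^ n =
        R ^ n / (M ^ a * M ^ c * E ^ 2 * (2 * R + 1) ^ n) := by
      rw [div_pow (a := R), div_mul_div_comm, one_mul]
    rw [h1]
    exact div_le_div_of_nonneg_left (by positivity) (by positivity) (hlow n)

/-- The power series of the normalized Wright function: it is entire with nonnegative
coefficients. -/
theorem exists_hasSum_normWright {a b c d : ℝ} (ha : 0 < a) (hc : 0 < c) (hb : 0 ≤ b) (hd : 0 ≤ d)
    (hbd : 0 < b + d) : ∃ w : ℕ → ℝ, w 0 = 0 ∧ w 1 = 1 ∧ (∀ n, 0 ≤ w n) ∧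
      ∀ z : ℂ, HasSum (fun n => (w n : ℂ) * z ^ n) (normWright a b c d z) := by
  have hpos1 : ∀ n : ℕ, 0 < Real.Gamma (a + n * b) := fun n => Real.Gamma_pos_of_pos (by positivity)
  have hpos2 : ∀ n : ℕ, 0 < Real.Gamma (c + n * d) := fun n => Real.Gamma_pos_of_pos (by positivity)
  have ha' := Real.Gamma_pos_of_pos ha
  have hc' := Real.Gamma_pos_of_pos hc
  set v : ℕ → ℝ := fun n =>
    Real.Gamma a * Real.Gamma c / (Real.Gamma (a + n * b) * Real.Gamma (c + n * d)) with hv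
  refine ⟨fun n => if n = 0 then 0 else v (n - 1), by simp, ?_, fun n => ?_, fun z => ?_⟩
  · simp only [one_ne_zero, if_false, hv, Nat.sub_self, Nat.cast_zero, zero_mul, add_zero]
    exact div_self (by positivity)
  · have h1 := hpos1 (n - 1)
    have h2 := hpos2 (n - 1)
    beta_reduce
    split_ifs
    · exact le_rfl
    · positivity
  · have hs : Summable fun n : ℕ =>
        z ^ n / ((Real.Gamma (a + n * b) * Real.Gamma (c + n * d) : ℝ) : ℂ) := by
      refine Summable.of_norm ?_
      refine (summable_congr fun n => ?_).1 (summable_wright ha hc hb hd hbd (norm_nonneg z))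
      rw [norm_div, norm_pow, norm_real, Real.norm_of_nonneg (mul_pos (hpos1 n) (hpos2 n)).le]
    have h1 := hs.hasSum.mul_left (z * ((Real.Gamma a * Real.Gamma c : ℝ) : ℂ))
    rw [← hasSum_nat_add_iff' 1]
    have h2 : normWright a b c d z - ∑ i ∈ Finset.range 1,
        ((if i = 0 then (0 : ℝ) else v (i - 1) : ℝ) : ℂ) * z ^ i = normWright a b c d z := by simp
    rw [h2]
    refine (hasSum_iff_of_forall_eq fun n => ?_).1 h1
    simp only [hv, Nat.add_eq_zero_iff, one_ne_zero, and_false, if_false, Nat.add_sub_cancel]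
    push_cast
    ring

/-- Values at `1` of a power series with real coefficients and of its derivatives. -/
lemma hasSum_deriv_one {W : ℂ → ℂ} {w : ℕ → ℝ}
    (h : ∀ z : ℂ, HasSum (fun n => (w n : ℂ) * z ^ n) (W z)) :
    HasSum w (W 1).re ∧ HasSum (fun n : ℕ => (n : ℝ) * w n) (deriv W 1).re ∧
      HasSum (fun n : ℕ => (n : ℝ) * (n - 1) * w n) (iteratedDeriv 2 W 1).re := by
  have h1b : (1 : ℂ) ∈ ball (0 : ℂ) 2 := by simp
  have hd1 : ∀ z ∈ ball (0 : ℂ) 2, HasSum (fun n : ℕ => (n : ℂ) * w n * z ^ n) (z * deriv W z) :=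
    fun z hz => hasSum_mul_deriv one_le_two (fun z _ => h z) hz
  have hd2 := hasSum_mul_deriv one_le_two hd1 h1b
  have hW : DifferentiableOn ℂ W (ball 0 2) := differentiableOn_of_hasSum fun z _ => h z
  have hdd : deriv (fun z => z * deriv W z) 1 = deriv W 1 + iteratedDeriv 2 W 1 := by
    have h2 := ((hW.deriv isOpen_ball).differentiableAt (isOpen_ball.mem_nhds h1b)).hasDerivAt
    have h3 := ((hasDerivAt_id (1 : ℂ)).mul h2).deriv
    rw [one_mul, id_eq, one_mul] at h3
    rw [iteratedDeriv_succ, iteratedDeriv_one]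
    exact h3
  have h1 := hd1 1 h1b
  rw [one_mul] at h1
  rw [hdd, one_mul] at hd2
  have h2 := hd2.sub h1
  rw [add_sub_cancel_left] at h2
  refine ⟨?_, ?_, ?_⟩
  · exact (hasSum_iff_of_forall_eq fun n => by simp).1 (hasSum_re (h 1))
  · exact (hasSum_iff_of_forall_eq fun n => by simp).1 (hasSum_re h1)
  · refine (hasSum_iff_of_forall_eq fun n => ?_).1 (hasSum_re h2)
    rw [one_pow, mul_one, mul_one, show (n : ℂ) * (n * w n) - n * w n
      = ((n * (n - 1) * w n : ℝ) : ℂ) by push_cast; ring, ofReal_re]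

/-! ### The convolution operator -/

lemma hasSum_hadamardConv {u W : ℂ → ℂ} {w : ℕ → ℝ} {s : ℕ → ℝ} (hw0 : ∀ n, 0 ≤ w n)
    (hW : ∀ z : ℂ, HasSum (fun n => (w n : ℂ) * z ^ n) (W z))
    (hu : ∀ n, ‖taylorCoeffZero u n‖ ≤ s n) (hs : Summable fun n => s n * w n) {z : ℂ}
    (hz : z ∈ ball (0 : ℂ) 1) :
    HasSum (fun n => taylorCoeffZero u n * w n * z ^ n) (hadamardConv u W z) := by
  have h1 : ∀ n, taylorCoeffZero W n = w n := taylorCoeffZero_eq_of_hasSum fun z _ => hW z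
  simp only [hadamardConv, h1]
  refine (Summable.of_norm_bounded hs fun n => ?_).hasSum
  rw [norm_mul, norm_mul, norm_pow, norm_real, Real.norm_of_nonneg (hw0 n)]
  have h2 : ‖z‖ ^ n ≤ 1 := pow_le_one₀ (norm_nonneg _) (mem_ball_zero_iff.1 hz).le
  have h3 := hw0 n
  calc ‖taylorCoeffZero u n‖ * w n * ‖z‖ ^ n ≤ s n * w n * 1 := by
        have := (norm_nonneg _).trans (hu n)
        gcongr
        exact hu n
    _ = _ := mul_one _

/-- Below, `h * W₁` and `σ (g * W₂)` are the analytic and co-analytic parts of `L(f)`. The values of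
`W₁`, `W₂` and their derivatives at `1` are real numbers; `.re` reads them as such. -/
theorem mainTheorem3
    (α : ℝ) (hα0 : 0 ≤ α) (hα1 : α < 1)
    (α₁ β₁ γ₁ δ₁ α₂ β₂ γ₂ δ₂ : ℝ)
    (hα₁ : 0 < α₁) (hγ₁ : 0 < γ₁) (hβ₁ : 0 ≤ β₁) (hδ₁ : 0 ≤ δ₁) (hβδ₁ : 0 < β₁ + δ₁)
    (hα₂ : 0 < α₂) (hγ₂ : 0 < γ₂) (hβ₂ : 0 ≤ β₂) (hδ₂ : 0 ≤ δ₂) (hβδ₂ : 0 < β₂ + δ₂)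
    (σ : ℂ) (hσ : ‖σ‖ < 1)
    (h g : ℂ → ℂ) (hf : IsHarmonicConvexZero h g)
    (hineq :
      (iteratedDeriv 2 (normWright α₁ β₁ γ₁ δ₁) 1).re
        + (2 - α) * ((deriv (normWright α₁ β₁ γ₁ δ₁) 1).re - 1)
        - α * ((normWright α₁ β₁ γ₁ δ₁ 1).re - 1)
        + ‖σ‖ * ((iteratedDeriv 2 (normWright α₂ β₂ γ₂ δ₂) 1).re
            + α * ((deriv (normWright α₂ β₂ γ₂ δ₂) 1).re - (normWright α₂ β₂ γ₂ δ₂ 1).re))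
      ≤ 2 * (1 - α)) :
    IsHarmonicStarlike α
      (hadamardConv h (normWright α₁ β₁ γ₁ δ₁))
      (fun z => σ * hadamardConv g (normWright α₂ β₂ γ₂ δ₂) z) := by
  obtain ⟨v, hv0, hv1, hvn, hv⟩ := exists_hasSum_normWright hα₁ hγ₁ hβ₁ hδ₁ hβδ₁
  obtain ⟨w, hw0, hw1, hwn, hw⟩ := exists_hasSum_normWright hα₂ hγ₂ hβ₂ hδ₂ hβδ₂
  obtain ⟨sv0, sv1, sv2⟩ := hasSum_deriv_one hv
  obtain ⟨sw0, sw1, sw2⟩ := hasSum_deriv_one hw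
  have hcoef := hf.norm_taylorCoeffZero_le
  have hh0 : taylorCoeffZero h 0 = 0 := by rw [taylorCoeffZero_zero, hf.h_zero]
  have hg0 : taylorCoeffZero g 0 = 0 := by rw [taylorCoeffZero_zero, hf.g_zero]
  have hA : ∀ n : ℕ, ‖taylorCoeffZero h n‖ ≤ ((n : ℝ) + 1) / 2 := by
    rintro (_ | n)
    · rw [hh0, norm_zero]; positivity
    · refine (hcoef n).1.trans_eq ?_; push_cast; ring
  -- Half a unit weaker than the sharp bound so as to hold at `n = 0`; it serves only for
  -- convergence.
  have hB : ∀ n : ℕ, ‖taylorCoeffZero g n‖ ≤ (n : ℝ) / 2 := by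
    rintro (_ | n)
    · rw [hg0, norm_zero]; positivity
    · refine (hcoef n).2.trans ?_; push_cast; linarith
  have hH : ∀ z ∈ ball (0 : ℂ) 1, HasSum (fun n => taylorCoeffZero h n * v n * z ^ n)
      (hadamardConv h (normWright α₁ β₁ γ₁ δ₁) z) := fun z hz =>
    hasSum_hadamardConv hvn hv hA
      (((hasSum_iff_of_forall_eq (v := fun n : ℕ => ((n : ℝ) + 1) / 2 * v n) fun n => by ring).1
        ((sv1.add sv0).mul_left (1 / 2))).summable) hz
  have hG : ∀ z ∈ ball (0 : ℂ) 1, HasSum (fun n => σ * (taylorCoeffZero g n * w n) * z ^ n)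
      (σ * hadamardConv g (normWright α₂ β₂ γ₂ δ₂) z) := fun z hz =>
    (hasSum_iff_of_forall_eq fun n => by ring).1 ((hasSum_hadamardConv hwn hw hB
      (((hasSum_iff_of_forall_eq (v := fun n : ℕ => (n : ℝ) / 2 * w n) fun n => by ring).1
        (sw1.mul_left (1 / 2))).summable) hz).mul_left σ)
  -- These are `(n - α)(n + 1) = n(n - 1) + (2 - α) n - α` and `(n + α)(n - 1) = n(n - 1) + α n -
  -- α`, summed against the Wright coefficients.
  have hva := ((sv2.add (sv1.mul_left (2 - α))).sub (sv0.mul_left α)).mul_left (1 / 2)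
  have hwa := ((sw2.add (sw1.mul_left α)).sub (sw0.mul_left α)).mul_left (‖σ‖ / 2)
  -- Indices `0` and `1` account for `1 - α` in the first series, matching the subtracted constants
  -- of the hypothesis, and for nothing in the second.
  rw [← hasSum_nat_add_iff' 2] at hva hwa
  have hnA : ∀ n : ℕ, ‖taylorCoeffZero h (n + 2) * v (n + 2)‖ ≤ ((n : ℝ) + 3) / 2 * v (n + 2) := by
    intro n
    rw [norm_mul, norm_real, Real.norm_of_nonneg (hvn _)]
    refine mul_le_mul_of_nonneg_right ((hA (n + 2)).trans_eq ?_) (hvn _)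
    push_cast; ring
  have hnB : ∀ n : ℕ, ‖σ * (taylorCoeffZero g (n + 2) * w (n + 2))‖ ≤
      ‖σ‖ * (((n : ℝ) + 1) / 2 * w (n + 2)) := by
    intro n
    rw [norm_mul, norm_mul, norm_real, Real.norm_of_nonneg (hwn _)]
    refine mul_le_mul_of_nonneg_left (mul_le_mul_of_nonneg_right ((hcoef (n + 1)).2.trans_eq ?_)
      (hwn _)) (norm_nonneg _)
    push_cast; ring
  have hbA : ∀ n : ℕ, ((n : ℝ) + 2 - α) * ‖taylorCoeffZero h (n + 2) * v (n + 2)‖ ≤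
      1 / 2 * (((n + 2 : ℕ) : ℝ) * ((n + 2 : ℕ) - 1) * v (n + 2) +
        (2 - α) * ((n + 2 : ℕ) * v (n + 2)) - α * v (n + 2)) := by
    intro n
    refine (mul_le_mul_of_nonneg_left (hnA n)
      (by linarith [n.cast_nonneg (α := ℝ)])).trans_eq ?_
    push_cast; ring
  have hbB : ∀ n : ℕ, ((n : ℝ) + 2 + α) * ‖σ * (taylorCoeffZero g (n + 2) * w (n + 2))‖ ≤
      ‖σ‖ / 2 * (((n + 2 : ℕ) : ℝ) * ((n + 2 : ℕ) - 1) * w (n + 2) +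
        α * ((n + 2 : ℕ) * w (n + 2)) - α * w (n + 2)) := by
    intro n
    refine (mul_le_mul_of_nonneg_left (hnB n) (by positivity)).trans_eq ?_
    push_cast; ring
  have hsA : Summable fun n : ℕ => ((n : ℝ) + 2) * ‖taylorCoeffZero h (n + 2) * v (n + 2)‖ := by
    have h0 := ((summable_nat_add_iff 2).2 ((sv2.add (sv1.mul_left 2)).mul_left (1 / 2)).summable)
    refine Summable.of_nonneg_of_le (fun n => by positivity) (fun n => ?_) h0
    refine (mul_le_mul_of_nonneg_left (hnA n) (by positivity)).trans_eq ?_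
    push_cast; ring
  have hsB : Summable fun n : ℕ =>
      ((n : ℝ) + 2) * ‖σ * (taylorCoeffZero g (n + 2) * w (n + 2))‖ := by
    have h0 := ((summable_nat_add_iff 2).2 (sw2.mul_left (‖σ‖ / 2)).summable)
    refine Summable.of_nonneg_of_le (fun n => by positivity) (fun n => ?_) h0
    refine (mul_le_mul_of_nonneg_left (hnB n) (by positivity)).trans_eq ?_
    push_cast; ring
  refine isHarmonicStarlike_of_tsum_le hα0 hα1 hH hG (by rw [hh0, zero_mul]) ?_ ?_ ?_ hsA hsB ?_
  · rw [taylorCoeffZero_one, hf.deriv_h_zero, hv1]; simp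
  · rw [hg0]; simp
  · rw [taylorCoeffZero_one, hf.deriv_g_zero]; simp
  have tA := (Summable.of_nonneg_of_le (fun n => mul_nonneg
    (by linarith [n.cast_nonneg (α := ℝ)]) (norm_nonneg _)) hbA hva.summable).tsum_le_tsum hbA
    hva.summable
  have tB := (Summable.of_nonneg_of_le (fun n => mul_nonneg
    (by positivity) (norm_nonneg _)) hbB hwa.summable).tsum_le_tsum hbB hwa.summable
  rw [hva.tsum_eq] at tA
  rw [hwa.tsum_eq] at tB
  simp only [Finset.sum_range_succ, Finset.sum_range_zero, hv0, hv1, hw0, hw1, Nat.cast_zero,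
    Nat.cast_one] at tA tB
  linarith
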